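/- **Theorem (Central limit theorem under feasible weights).** *Setting.* Fix a horizon $l$ and a dimension $d$. For episodes $i=1,2,\dots$ we observe $Z_i=(X_{i,1},T_{i,1},\dots,X_{i,l},T_{i,l},y_i)$ with contexts $X_{i,j}\in\mathcal X$, treatments $T_{i,j}\in\mathcal T$ (with a zero treatment $0\in\mathcal T$) and outcome $y_i=y_i(T_{i,1:l})$, where $y_i(\tau_{1:l})$, $\tau_{1:l}\in\mathcal T^l$, are the counterfactual outcomes of episode $i$. Let $\mathcal F_{i-1}=\sigma(Z_{1:i-1})$, $\mathcal F_{i,-1}=\mathcal F_{i-1}$ and $\mathcal F_{i,j-1}=\sigma(Z_{1:i-1},X_{i,1:j},T_{i,1:j-1})$ for $1\le j\le l$; write $\mathbb E_{i-1}$, $\mathbb E_{i,j-1}$ for the conditional expectations. Let $\phi_j:\mathcal X^j\times\mathcal T^j\to\mathbb R^d$ be known measurable feature maps with $\phi_j(x_{1:j},(\tau_{1:j-1},0))=0$. Put $\phi_{i,0}=1$, $q_{i,0}=0$, $\mathrm{Cov}_{i,-1}(\phi_{i,0})=1$, and for $j\ge1$ put $\phi_{i,j}=\phi_j(X_{i,1:j},T_{i,1:j})$,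 $q_{i,j}=\mathbb E_{i,j-1}[\phi_{i,j}]$, $\mathrm{Cov}_{i,j-1}(\phi_{i,j})=\mathbb E_{i,j-1}[(\phi_{i,j}-q_{i,j})(\phi_{i,j}-q_{i,j})^T]$. Let $\theta=(\theta_0,\theta_1^T,\dots,\theta_l^T)^T\in\mathbb R^{1+dl}$ and, for $0\le j\le l$, $$f_{i,j}=\mathbb E_{i,j-1}\Big[\big(y_i-\sum_{j'=j}^l\theta_{j'}^T\phi_{i,j'}\big)^2\Big].$$ Let $m(Z_i;\vartheta)\in\mathbb R^{1+dl}$ be the vector with blocks $\big(y_i-\sum_{j'=j}^l\vartheta_{j'}^T\phi_{i,j'}\big)(\phi_{i,j}-q_{i,j})$, $j=0,\dots,l$, and $J_i=\nabla_\vartheta m(Z_i;\vartheta)$, the block upper triangular matrix with blocks $-(\phi_{i,j}-q_{i,j})\phi_{i,j'}^T$ for $j\le j'$. *Assumptions.* 1. (Sequential exogeneity) For all $i$ and $1\le j\le l$, the family $\{y_i(T_{i,1:j-1},\tau_{j:l}):\tau_{j:l}\in\mathcal T^{l-j+1}\}$ is independent of $T_{i,j}$ given $\mathcal F_{i,j-1}$.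 2. (Baseline mean and linear blips) $\mathbb E_{i-1}[y_i(0_{1:l})]=\theta_0$ a.s. for all $i$; and for all $i$ and $1\le j\le l$, $\mathbb E[y_i(T_{i,1:j},0_{j+1:l})-y_i(T_{i,1:j-1},0_{j:l})\mid\mathcal F_{i,j-1},T_{i,j}]=\theta_j^T\phi_{i,j}$ a.s. 3. (Residual independence) For all $i$ and $1\le j\le l$, $y_i-\sum_{j'=j}^l\theta_{j'}^T\phi_{i,j'}$ is independent of $T_{i,j}$ given $\mathcal F_{i,j-1}$. 4. (Exploration) There are $\alpha\in[0,1)$ and $c\in(0,1)$ with $c^2i^{-\alpha}I\preceq\mathrm{Cov}_{i,j-1}(\phi_{i,j})$ a.s. for all $i$ and $1\le j\le l$. 5. (Boundedness) The counterfactual outcomes and the feature maps are uniformly bounded. Let $M>0$ be such that $f_{i,j}\le M^2$ a.s. for all $i$ and $0\le j\le l$. *Weights and estimator.* Let $\sigma>0$ and, for $i\ge1$ and $0\le j\le l$, let $\hat f_{i,j}\ge\sigma^2$ be integrable and $\mathcal F_{i,j-1}$-measurable, and put $\hat h_{i,j}=\hat f_{i,j}^{-1/2}\,\mathrm{Cov}_{i,j-1}(\phi_{i,j})^{-1/2}$,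 $\hat H_i=\mathrm{diag}\{\hat h_{i,0},\hat h_{i,1},\dots,\hat h_{i,l}\}$ and $$\hat B_n=-n^{\frac\alpha2-1}\sum_{i=1}^n\hat H_iJ_i.$$ Let $\hat\theta_n$ be random vectors which solve $\frac1n\sum_{i=1}^n\hat H_i\,m(Z_i;\hat\theta_n)=0$ on the event that all eigenvalues of $\hat B_n$ have absolute value at least $c/(2M)$, and which are arbitrary elsewhere (for instance $\hat\theta_n=0$). *Conclusion.* If for every $0\le j\le l$ $$\frac1n\sum_{i=1}^n\mathbb E_{i-1}\big[|f_{i,j}-\hat f_{i,j}|\big]=o_p(1)\qquad(n\to\infty),$$ then $n^{\frac{1-\alpha}2}\hat B_n(\hat\theta_n-\theta)$ converges in distribution to $\mathcal N(0,I_{1+dl})$. -/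

import Mathlib

open MeasureTheory ProbabilityTheory Filter Topology Matrix

noncomputable section

/-- The σ-algebras `m₁` and `m₂` are conditionally independent given `m`: the product formula
`P(A ∩ B | m) = P(A | m) P(B | m)` a.s. for all `A ∈ m₁`, `B ∈ m₂`. (This is the characterization
of `ProbabilityTheory.CondIndep` in `condIndep_iff`, on an arbitrary probability space;
Mathlib's definition needs `Ω` to be standard Borel.) -/
def CondIndepGiven {Ω : Type*} [MeasurableSpace Ω] (μ : Measure Ω)
    (m m₁ m₂ : MeasurableSpace Ω) : Prop :=
  ∀ A B : Set Ω, MeasurableSet[m₁] A → MeasurableSet[m₂] B →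
    μ⟦A ∩ B | m⟧ =ᵐ[μ] μ⟦A | m⟧ * μ⟦B | m⟧

/-- The inverse square root `A^{-1/2}` of a positive definite matrix: the positive semidefinite
square root of `A⁻¹`. -/
def invSqrt {d : ℕ} (A : Matrix (Fin d) (Fin d) ℝ) : Matrix (Fin d) (Fin d) ℝ :=
  open scoped MatrixOrder in CFC.sqrt A⁻¹

/-- An infinite sequence of episodes with horizon `l`. Episodes are numbered from `0`, so that
episode `i` here is the `(i+1)`-st one; `j : Fin l` stands for stage `j + 1`. -/
structure Episodes (l : ℕ) (Ω 𝒳 𝒯 : Type*) [MeasurableSpace Ω] [MeasurableSpace 𝒳]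
    [MeasurableSpace 𝒯] where
  /-- the observed context of episode `i` at stage `j` -/
  X : ℕ → Fin l → Ω → 𝒳
  /-- the treatment assigned in episode `i` at stage `j` -/
  T : ℕ → Fin l → Ω → 𝒯
  /-- the counterfactual outcome `y_i(τ)` of episode `i` under the treatment sequence `τ` -/
  Y : ℕ → (Fin l → 𝒯) → Ω → ℝ
  measurable_X : ∀ i j, Measurable (X i j)
  measurable_T : ∀ i j, Measurable (T i j)
  measurable_Y : ∀ i, Measurable fun p : (Fin l → 𝒯) × Ω => Y i p.1 p.2

/-- The known feature maps `φ_j : 𝒳^j × 𝒯^j → ℝ^d`, `j = 1, …, l`, which vanish when the last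
treatment is `0`. -/
structure FeatureMap (l d : ℕ) (𝒳 𝒯 : Type*) [MeasurableSpace 𝒳] [MeasurableSpace 𝒯]
    [Zero 𝒯] where
  toFun : (j : Fin l) → (Fin (j + 1) → 𝒳) → (Fin (j + 1) → 𝒯) → Fin d → ℝ
  measurable_toFun : ∀ j : Fin l,
    Measurable fun p : (Fin (j + 1) → 𝒳) × (Fin (j + 1) → 𝒯) => toFun j p.1 p.2
  map_zero : ∀ (j : Fin l) (x : Fin (j + 1) → 𝒳) (τ : Fin (j + 1) → 𝒯),
    τ (Fin.last j) = 0 → toFun j x τ = 0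

/-- Coordinates of `ℝ^{1+dl}`: `none` is the coordinate of `θ_0`, and `some (j, k)` is the `k`-th
coordinate of the block `θ_{j+1} ∈ ℝ^d`. -/
abbrev Idx (l d : ℕ) : Type := Option (Fin l × Fin d)

/-- The block `0, 1, …, l` to which a coordinate belongs. -/
def stage {l d : ℕ} : Idx l d → Fin (l + 1)
  | none => 0
  | some (j, _) => j.succ

namespace Episodes

section

variable {l d : ℕ} {Ω 𝒳 𝒯 : Type*} [MeasurableSpace Ω] [MeasurableSpace 𝒳] [MeasurableSpace 𝒯]
  [Zero 𝒯] (D : Episodes l Ω 𝒳 𝒯) (φ : FeatureMap l d 𝒳 𝒯) (μ : Measure Ω)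

/-- The observed outcome `y_i = y_i(T_{i,1:l})`. -/
def outcome (i : ℕ) (ω : Ω) : ℝ := D.Y i (fun j => D.T i j ω) ω

/-- The counterfactual outcome `y_i(T_{i,1:j-1}, τ_{j:l})`. -/
def outcomeFrom (i : ℕ) (j : Fin l) (τ : Fin l → 𝒯) (ω : Ω) : ℝ :=
  D.Y i (fun k => if k < j then D.T i k ω else τ k) ω

/-- The counterfactual outcome `y_i(T_{i,1:j}, 0_{j+1:l})`. -/
def outcomeThru (i : ℕ) (j : Fin l) (ω : Ω) : ℝ :=
  D.Y i (fun k => if k ≤ j then D.T i k ω else 0) ω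

/-- The σ-algebra generated by the data `Z_i = (X_{i,1}, T_{i,1}, …, X_{i,l}, T_{i,l}, y_i)`. -/
@[reducible] def episodeSigma (i : ℕ) : MeasurableSpace Ω :=
  (⨆ j, MeasurableSpace.comap (D.X i j) inferInstance) ⊔
    (⨆ j, MeasurableSpace.comap (D.T i j) inferInstance) ⊔
    MeasurableSpace.comap (D.outcome i) inferInstance

/-- The σ-algebra generated by all episodes before episode `i`. -/
@[reducible] def past (i : ℕ) : MeasurableSpace Ω := ⨆ (i' : ℕ) (_ : i' < i), D.episodeSigma i'

/-- `ℱ_{i,s-1} = σ(Z_{1:i-1}, X_{i,1:s}, T_{i,1:s-1})` for `s = 0, 1, …, l`; for `s = 0` this is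
the σ-algebra of the past episodes. -/
@[reducible] def hist (i : ℕ) (s : Fin (l + 1)) : MeasurableSpace Ω :=
  D.past i ⊔
    (⨆ (j : Fin l) (_ : j.succ ≤ s), MeasurableSpace.comap (D.X i j) inferInstance) ⊔
    (⨆ (j : Fin l) (_ : j.succ < s), MeasurableSpace.comap (D.T i j) inferInstance)

/-- `ℱ_{i,j-1} ∨ σ(T_{i,j})`. -/
@[reducible] def histT (i : ℕ) (j : Fin l) : MeasurableSpace Ω :=
  D.hist i j.succ ⊔ MeasurableSpace.comap (D.T i j) inferInstance

/-- Coordinates of `φ_i = (φ_{i,0}, φ_{i,1}, …, φ_{i,l})`, where `φ_{i,0} = 1` and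
`φ_{i,j} = φ_j(X_{i,1:j}, T_{i,1:j})`. -/
def feat (i : ℕ) : Idx l d → Ω → ℝ
  | none, _ => 1
  | some (j, k), ω =>
      φ.toFun j (fun m => D.X i (Fin.castLE j.isLt m) ω) (fun m => D.T i (Fin.castLE j.isLt m) ω) k

/-- Coordinates of `q_i = (q_{i,0}, q_{i,1}, …, q_{i,l})`, where `q_{i,0} = 0` and
`q_{i,j} = E_{i,j-1}[φ_{i,j}]`. -/
def featMean (i : ℕ) : Idx l d → Ω → ℝ
  | none => 0
  | some (j, k) => μ[D.feat φ i (some (j, k)) | D.hist i j.succ]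

/-- The conditional covariance matrix
`Cov_{i,j-1}(φ_{i,j}) = E_{i,j-1}[(φ_{i,j} - q_{i,j})(φ_{i,j} - q_{i,j})ᵀ]` for `j = 1, …, l`. -/
def condCov (i : ℕ) (j : Fin l) (ω : Ω) : Matrix (Fin d) (Fin d) ℝ :=
  Matrix.of fun k k' =>
    (μ[fun ω' => (D.feat φ i (some (j, k)) ω' - D.featMean φ μ i (some (j, k)) ω') *
        (D.feat φ i (some (j, k')) ω' - D.featMean φ μ i (some (j, k')) ω') |
      D.hist i j.succ]) ω

/-- The residual `y_i - ∑_{j' ≥ s} ϑ_{j'}ᵀ φ_{i,j'}` for `s = 0, 1, …, l`. -/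
def resid (i : ℕ) (s : Fin (l + 1)) (ϑ : Idx l d → ℝ) (ω : Ω) : ℝ :=
  D.outcome i ω - ∑ b : Idx l d, if s ≤ stage b then ϑ b * D.feat φ i b ω else 0

/-- The moment function `m(Z_i; ϑ) ∈ ℝ^{1+dl}`, with blocks
`(y_i - ∑_{j' ≥ j} ϑ_{j'}ᵀ φ_{i,j'}) (φ_{i,j} - q_{i,j})`, `j = 0, 1, …, l`. -/
def momentVec (i : ℕ) (ϑ : Idx l d → ℝ) (ω : Ω) : Idx l d → ℝ := fun b =>
  D.resid φ i (stage b) ϑ ω * (D.feat φ i b ω - D.featMean φ μ i b ω)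

/-- The Jacobian `J_i` of `ϑ ↦ m(Z_i; ϑ)`: it is block upper triangular with blocks
`-(φ_{i,j} - q_{i,j}) φ_{i,j'}ᵀ` for `j ≤ j'`. -/
def jacobian (i : ℕ) (ω : Ω) : Matrix (Idx l d) (Idx l d) ℝ :=
  Matrix.of fun b b' =>
    if stage b ≤ stage b' then
      -((D.feat φ i b ω - D.featMean φ μ i b ω) * D.feat φ i b' ω)
    else 0

/-- `f_{i,s} = E_{i,s-1}[(y_i - ∑_{j' ≥ s} θ_{j'}ᵀ φ_{i,j'})²]` for `s = 0, 1, …, l`. -/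
def condSqResid (θ : Idx l d → ℝ) (i : ℕ) (s : Fin (l + 1)) : Ω → ℝ :=
  μ[fun ω => D.resid φ i s θ ω ^ 2 | D.hist i s]

/-- The block diagonal weight matrix `Ĥ_i = diag(ĥ_{i,0}, …, ĥ_{i,l})`, where
`ĥ_{i,j} = f̂_{i,j}^{-1/2} Cov_{i,j-1}(φ_{i,j})^{-1/2}` for `j ≥ 1` and `ĥ_{i,0} = f̂_{i,0}^{-1/2}`
(as `φ_{i,0} - q_{i,0} = 1`). -/
def weight (fhat : ℕ → Fin (l + 1) → Ω → ℝ) (i : ℕ) (ω : Ω) : Matrix (Idx l d) (Idx l d) ℝ :=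
  Matrix.of fun b b' =>
    match b, b' with
    | none, none => fhat i 0 ω ^ (-(1 / 2) : ℝ)
    | some (j, k), some (j', k') =>
        if j = j' then
          fhat i j.succ ω ^ (-(1 / 2) : ℝ) * invSqrt (D.condCov φ μ i j ω) k k'
        else 0
    | _, _ => 0

/-- `B̂_n = -n^{α/2 - 1} ∑_{i=1}^n Ĥ_i J_i`. -/
def Bhat (α : ℝ) (fhat : ℕ → Fin (l + 1) → Ω → ℝ) (n : ℕ) (ω : Ω) :
    Matrix (Idx l d) (Idx l d) ℝ :=
  -((n : ℝ) ^ (α / 2 - 1) •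
    ∑ i ∈ Finset.range n, D.weight φ μ fhat i ω * D.jacobian φ μ i ω)

/-- The event that every (complex) eigenvalue of `B̂_n` has absolute value at least `c / (2M)`. -/
def goodEvent (α c M : ℝ) (fhat : ℕ → Fin (l + 1) → Ω → ℝ) (n : ℕ) : Set Ω :=
  {ω | ∀ z ∈ spectrum ℂ ((D.Bhat φ μ α fhat n ω).map Complex.ofReal), c / (2 * M) ≤ ‖z‖}

/-- Sequential conditional exogeneity: for every episode and stage, the family of counterfactual
outcomes `y_i(T_{i,1:j-1}, τ_{j:l})`, `τ_{j:l} ∈ 𝒯^{l-j+1}`, is independent of `T_{i,j}` given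
`(T_{i,1:j-1}, X_{i,1:j})` and the data of the past episodes. -/
def Exogeneity : Prop :=
  ∀ (i : ℕ) (j : Fin l),
    CondIndepGiven μ (D.hist i j.succ)
      (⨆ τ : Fin l → 𝒯, MeasurableSpace.comap (D.outcomeFrom i j τ) inferInstance)
      (MeasurableSpace.comap (D.T i j) inferInstance)

/-- The blip function under the zero-treatment baseline policy, evaluated along the data:
`E[y_i(T_{i,1:j}, 0_{j+1:l}) - y_i(T_{i,1:j-1}, 0_{j:l}) | X_{i,1:j}, T_{i,1:j}]`, given the data
of the past episodes. -/
def blip (i : ℕ) (j : Fin l) : Ω → ℝ :=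
  μ[fun ω => D.outcomeThru i j ω - D.outcomeFrom i j 0 ω | D.histT i j]

/-- Linear blip assumption: the blip function at stage `j` is `θ_jᵀ φ_j`. -/
def LinearBlip (θ : Idx l d → ℝ) : Prop :=
  ∀ (i : ℕ) (j : Fin l),
    D.blip μ i j =ᵐ[μ] fun ω => ∑ k, θ (some (j, k)) * D.feat φ i (some (j, k)) ω

/-- `θ_0` is the mean outcome under the zero-treatment baseline policy, in each episode given the
data of the past episodes. -/
def IsBaselineMean (θ₀ : ℝ) : Prop :=
  ∀ i : ℕ, μ[D.Y i 0 | D.past i] =ᵐ[μ] fun _ => θ₀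

/-- The residual `r_{i,j} = y_i - ∑_{j' ≥ j} θ_{j'}ᵀ φ_{i,j'}` is independent of `T_{i,j}` given
`(T_{i,1:j-1}, X_{i,1:j})` and the data of the past episodes. -/
def ResidualIndependence (θ : Idx l d → ℝ) : Prop :=
  ∀ (i : ℕ) (j : Fin l),
    CondIndepGiven μ (D.hist i j.succ)
      (MeasurableSpace.comap (D.resid φ i j.succ θ) inferInstance)
      (MeasurableSpace.comap (D.T i j) inferInstance)

/-- Exploration of the behavior policy: `c² i^{-α} I ⪯ Cov_{i,j-1}(φ_{i,j})` in the `i`-th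
episode, at every stage `j = 1, …, l`. -/
def Exploration (α c : ℝ) : Prop :=
  ∀ (i : ℕ) (j : Fin l), ∀ᵐ ω ∂μ,
    (D.condCov φ μ i j ω -
      (c ^ 2 * ((i : ℝ) + 1) ^ (-α)) • (1 : Matrix (Fin d) (Fin d) ℝ)).PosSemidef

/-- Outcomes and features are uniformly bounded. -/
def BoundedData : Prop :=
  ∃ C : ℝ, (∀ i τ ω, |D.Y i τ ω| ≤ C) ∧ ∀ j x τ k, |φ.toFun j x τ k| ≤ C

/-- `θhat n` is the `ĥ`-weighted Z-estimator from the first `n` episodes: on the event that the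
eigenvalues of `B̂_n` have absolute value at least `c / (2M)` it solves
`(1/n) ∑_{i=1}^n Ĥ_i m(Z_i; θ̂_n) = 0`; its value elsewhere is arbitrary (for instance `0`). -/
def IsZEstimator (α c M : ℝ) (fhat : ℕ → Fin (l + 1) → Ω → ℝ) (θhat : ℕ → Ω → Idx l d → ℝ) :
    Prop :=
  (∀ n, AEMeasurable (θhat n) μ) ∧
    ∀ n, ∀ᵐ ω ∂μ, ω ∈ D.goodEvent φ μ α c M fhat n →
      (n : ℝ)⁻¹ • ∑ i ∈ Finset.range n,
        D.weight φ μ fhat i ω *ᵥ D.momentVec φ μ i (θhat n ω) ω = 0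

end

end Episodes

end

/-!
The estimating equation is linear in the parameter. On the event that it holds, it therefore turns
the studentized error `n^{(1-α)/2} B̂_n (θ̂_n - θ)` into the normalized sum
`n^{-1/2} ∑ Ĥ_i m(Z_i; θ)` of the weighted scores at the true parameter, exactly and without any
invertibility of `B̂_n` (`Episodes.rpow_smul_Bhat_mulVec_eq_scoreSum`). Two things remain: a central
limit theorem for the scores, and the fact that the eigenvalues of `B̂_n` have absolute value at
least `c / (2M)` with probability tending to one.

*Central limit theorem.* The weighted scores are martingale differences
(`Episodes.condExp_score`): for the stages `j ≥ 1`, residual independence makes the conditional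
mean of the residual insensitive to the treatment, while the weighted features are conditionally
centred; for the intercept, the blips telescope. The same argument shows that scores of different
stages are conditionally uncorrelated, and within a stage the weights turn the conditional
covariance of the features into `f̂⁻¹` times the identity, so that the conditional covariance
matrix of a score given the past episodes is diagonal with entries `E_{i-1}[f_{i,j} / f̂_{i,j}]`
(`Episodes.condExp_score_mul_score`). By consistency of `f̂` these average to `1`. Exploration
bounds the scores by a multiple of `i^{α/2}`, which is negligible compared to `n^{1/2}` as `α < 1`.
The central limit theorem for bounded martingale differences is proved through characteristic
functions: if `S_k` are the partial sums and `V_k` the accumulated conditional variances, then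
`exp (i S_k + V_k / 2)` has almost constant expectation
(`tendsto_integral_exp_sum_of_martingale_differences`), and Lévy's continuity theorem concludes.

*Eigenvalues.* `B̂_n` is block upper triangular, so that its eigenvalues are those of its diagonal
blocks, and a lower bound for the quadratic forms of these blocks bounds the absolute values of the
eigenvalues (`le_norm_of_mem_spectrum_of_blockTriangular`). The summand of episode `i` in the
diagonal block `j` has the conditional expectation `f̂_{i,j}^{-1/2} Cov(φ_{i,j})^{1/2}`, which
exploration bounds below by `c i^{-α/2} f̂_{i,j}^{-1/2}`
(`Episodes.le_sum_condExp_wfeat_mul_feat`). As `f ≤ M²` and `f̂` is consistent for `f`, the average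
shortfall of `f̂^{-1/2}` below `M⁻¹` vanishes in probability
(`Episodes.tendstoInMeasure_shortfall`), and the deviations from the conditional expectations
vanish by orthogonality (`Episodes.tendstoInMeasure_fluctuation`). This leaves quadratic forms of
at least `c / M - o_p(1)`.
-/

/-! ### Almost surely bounded random variables -/

/-- A real random variable which is almost surely bounded by a constant. -/
def AEBdd {Ω : Type*} [MeasurableSpace Ω] (μ : Measure Ω) (f : Ω → ℝ) : Prop :=
  ∃ C : ℝ, ∀ᵐ ω ∂μ, |f ω| ≤ C

namespace AEBdd

variable {Ω : Type*} {m m₀ : MeasurableSpace Ω} {μ : Measure Ω} {f g : Ω → ℝ}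

lemma const (a : ℝ) : AEBdd μ (fun _ => a) := ⟨|a|, by simp⟩

lemma of_forall {C : ℝ} (h : ∀ ω, |f ω| ≤ C) : AEBdd μ f := ⟨C, .of_forall h⟩

lemma mono (hg : AEBdd μ g) (h : ∀ᵐ ω ∂μ, |f ω| ≤ |g ω|) : AEBdd μ f := by
  obtain ⟨C, hC⟩ := hg
  exact ⟨C, by filter_upwards [h, hC] with ω h1 h2 using h1.trans h2⟩

lemma congr (hg : AEBdd μ g) (h : f =ᵐ[μ] g) : AEBdd μ f :=
  hg.mono (by filter_upwards [h] with ω h1 using by rw [h1])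

lemma add (hf : AEBdd μ f) (hg : AEBdd μ g) : AEBdd μ (fun ω => f ω + g ω) := by
  obtain ⟨C, hC⟩ := hf
  obtain ⟨C', hC'⟩ := hg
  exact ⟨C + C', by
    filter_upwards [hC, hC'] with ω h1 h2 using (abs_add_le _ _).trans (add_le_add h1 h2)⟩

lemma neg (hf : AEBdd μ f) : AEBdd μ (fun ω => -f ω) := hf.mono (by simp)

lemma sub (hf : AEBdd μ f) (hg : AEBdd μ g) : AEBdd μ (fun ω => f ω - g ω) := by
  simpa [sub_eq_add_neg] using hf.add hg.neg

lemma mul (hf : AEBdd μ f) (hg : AEBdd μ g) : AEBdd μ (fun ω => f ω * g ω) := by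
  obtain ⟨C, hC⟩ := hf
  obtain ⟨C', hC'⟩ := hg
  exact ⟨C * C', by
    filter_upwards [hC, hC'] with ω h1 h2
    rw [abs_mul]
    exact mul_le_mul h1 h2 (abs_nonneg _) ((abs_nonneg _).trans h1)⟩

lemma sq (hf : AEBdd μ f) : AEBdd μ (fun ω => f ω ^ 2) := by
  simpa [pow_two] using hf.mul hf

lemma sum {ι : Type*} (s : Finset ι) {f : ι → Ω → ℝ} (hf : ∀ i ∈ s, AEBdd μ (f i)) :
    AEBdd μ (fun ω => ∑ i ∈ s, f i ω) := by
  classical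
  induction s using Finset.induction_on with
  | empty => simpa using const 0
  | insert a s ha ih =>
    simp only [Finset.sum_insert ha]
    exact (hf a (Finset.mem_insert_self a s)).add
      (ih fun i hi => hf i (Finset.mem_insert_of_mem hi))

lemma integrable [IsFiniteMeasure μ] (hf : AEBdd μ f) (hm : AEStronglyMeasurable f μ) :
    Integrable f μ := by
  obtain ⟨C, hC⟩ := hf
  exact Integrable.of_bound hm C hC

lemma condExp (hf : AEBdd μ f) : AEBdd μ (μ[f | m]) := by
  obtain ⟨C, hC⟩ := hf
  exact ⟨|C|, by
    have h1 := ae_bdd_abs_condExp_of_ae_bdd_abs (R := |C|) (m := m) (μ := μ) (f := f) (by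
      filter_upwards [hC] with ω h using h.trans (le_abs_self C))
    exact h1⟩

end AEBdd

section PullOut

variable {Ω : Type*} {m m₀ : MeasurableSpace Ω} {μ : Measure Ω} [IsFiniteMeasure μ]

/-- Complex weights which are measurable with respect to `m` do not distinguish a random variable
from its conditional expectation given `m`. -/
lemma integral_mul_condExp_complex (hm : m ≤ m₀) {g : Ω → ℂ} {f : Ω → ℝ}
    (hg : StronglyMeasurable[m] g) {C : ℝ} (hgC : ∀ᵐ ω ∂μ, ‖g ω‖ ≤ C) (hf : Integrable f μ) :
    ∫ ω, g ω * (f ω : ℂ) ∂μ = ∫ ω, g ω * ((μ[f | m]) ω : ℂ) ∂μ := by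
  let B : ℂ →L[ℝ] ℝ →L[ℝ] ℂ := (ContinuousLinearMap.lsmul ℝ ℝ).flip
  have hB : ∀ z r, B z r = z * (r : ℂ) := fun z r => by simp [B, mul_comm]
  have hint : Integrable (fun ω => B (g ω) (f ω)) μ := by
    simp only [hB]
    exact hf.ofReal.bdd_mul (hg.mono hm).aestronglyMeasurable hgC
  have h := condExp_bilin_of_stronglyMeasurable_left B hg hint hf
  simp only [hB] at h
  rw [← integral_condExp hm, integral_congr_ae h]

end PullOut

section BoundedConvergence

variable {Ω : Type*} {m₀ : MeasurableSpace Ω} {μ : Measure Ω} [IsProbabilityMeasure μ]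

/-- Bounded convergence in probability. -/
lemma tendsto_integral_abs_of_tendstoInMeasure {f : ℕ → Ω → ℝ}
    (hm : ∀ n, AEStronglyMeasurable (f n) μ) {K : ℝ} (hK : ∀ n, ∀ᵐ ω ∂μ, |f n ω| ≤ K)
    (h : TendstoInMeasure μ f atTop (fun _ => 0)) :
    Tendsto (fun n => ∫ ω, |f n ω| ∂μ) atTop (𝓝 0) := by
  have h1 := (tendstoInMeasure_iff_measureReal_norm.mp h)
  have hK0 : 0 ≤ K := by
    obtain ⟨ω, hω⟩ := (hK 0).exists
    exact (abs_nonneg _).trans hω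
  rw [Metric.tendsto_atTop]
  intro ε hε
  have h2 := (h1 (ε / 2) (by positivity)).const_mul K
  rw [mul_zero] at h2
  obtain ⟨N, hN⟩ := Metric.tendsto_atTop.mp h2 (ε / 2) (by positivity)
  refine ⟨N, fun n hn => ?_⟩
  have h3 := hN n hn
  rw [Real.dist_eq, sub_zero] at h3 ⊢
  rw [abs_of_nonneg (integral_nonneg fun ω => abs_nonneg _)]
  set A : Set Ω := {ω | ε / 2 ≤ ‖f n ω - 0‖} with hA
  have hAm : NullMeasurableSet A μ := by
    have : AEMeasurable (fun ω => ‖f n ω - 0‖) μ := by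
      have := (hm n).aemeasurable
      fun_prop
    exact nullMeasurableSet_le aemeasurable_const this
  have hint : Integrable (fun ω => A.indicator (fun _ => K) ω + ε / 2) μ :=
    ((integrable_const K).indicator₀ hAm).add (integrable_const _)
  calc ∫ ω, |f n ω| ∂μ ≤ ∫ ω, (A.indicator (fun _ => K) ω + ε / 2) ∂μ := by
        refine integral_mono_ae (Integrable.of_bound (hm n) K (hK n)).abs hint ?_
        filter_upwards [hK n] with ω hω
        by_cases hωA : ω ∈ A
        · simp only [Set.indicator_of_mem hωA]; linarith
        · simp only [Set.indicator_of_notMem hωA]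
          simp only [hA, Set.mem_ofPred_eq, not_le, sub_zero, Real.norm_eq_abs] at hωA
          linarith
    _ = K * μ.real A + ε / 2 := by
        rw [integral_add ((integrable_const K).indicator₀ hAm) (integrable_const _),
          integral_indicator₀ hAm]
        simp [mul_comm]
    _ < ε := by linarith [(le_abs_self _).trans_lt h3]

lemma tendstoInMeasure_of_tendsto_integral_abs {f : ℕ → Ω → ℝ}
    (hi : ∀ n, Integrable (f n) μ) (h : Tendsto (fun n => ∫ ω, |f n ω| ∂μ) atTop (𝓝 0)) :
    TendstoInMeasure μ f atTop (fun _ => 0) := by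
  rw [tendstoInMeasure_iff_measureReal_norm]
  intro ε hε
  have h2 := h.const_mul ε⁻¹
  rw [mul_zero] at h2
  refine squeeze_zero (fun n => measureReal_nonneg) (fun n => ?_) h2
  have := mul_meas_ge_le_integral_of_nonneg (μ := μ) (f := fun ω => |f n ω|)
    (.of_forall fun ω => abs_nonneg _) (hi n).abs ε
  simp only [sub_zero, Real.norm_eq_abs]
  rw [inv_mul_eq_div, le_div_iff₀ hε, mul_comm]
  exact this

end BoundedConvergence

/-! ### The characteristic function of a sum of martingale differences -/

/-- `exp u` and `1 - u` are inverse to each other up to second order. -/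
lemma abs_exp_mul_one_sub_sub_one_le {u : ℝ} (h : u ≤ 1) :
    |Real.exp u * (1 - u) - 1| ≤ u ^ 2 := by
  have h1 : Real.exp u * (1 - u) ≤ 1 := by
    have := Real.one_sub_le_exp_neg u
    calc Real.exp u * (1 - u) ≤ Real.exp u * Real.exp (-u) := by gcongr
      _ = 1 := by rw [← Real.exp_add]; simp
  have h2 : 1 - u ^ 2 ≤ Real.exp u * (1 - u) := by
    have := mul_le_mul_of_nonneg_right (Real.add_one_le_exp u) (sub_nonneg.mpr h)
    nlinarith
  rw [abs_le]; constructor <;> nlinarith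

/-- Second order Taylor expansion of `x ↦ exp (i x)` at `0`. -/
lemma norm_exp_mul_I_sub_le {x : ℝ} (hx : |x| ≤ 1) :
    ‖Complex.exp (x * Complex.I) - (1 + x * Complex.I - (x ^ 2 / 2 : ℝ))‖ ≤ |x| ^ 3 := by
  have hn : ‖(x : ℂ) * Complex.I‖ = |x| := by simp
  have h := Complex.exp_bound (x := x * Complex.I) (by rw [hn]; exact hx) (n := 3) (by norm_num)
  rw [hn] at h
  have he : ∑ m ∈ Finset.range 3, ((x : ℂ) * Complex.I) ^ m / (m.factorial : ℂ) =
      1 + x * Complex.I - (x ^ 2 / 2 : ℝ) := by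
    simp [Finset.sum_range_succ, mul_pow, Nat.factorial]
    ring
  rw [he] at h
  refine h.trans ?_
  have : (0 : ℝ) ≤ |x| ^ 3 := by positivity
  norm_num [Nat.factorial]
  nlinarith

section MartingaleCharFun

variable {Ω : Type*} {m m₀ : MeasurableSpace Ω} {μ : Measure Ω} [IsProbabilityMeasure μ]

/-- One step of the comparison of a sum of martingale differences with a Gaussian: multiplying an
`m`-measurable weight `g` by `exp (i x + v / 2)`, where `x` has conditional mean zero and
conditional variance `v` given `m`, changes its integral only to third order in `x`. -/
lemma norm_integral_mul_exp_sub_le (hm : m ≤ m₀) {g : Ω → ℂ}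
    (hg : StronglyMeasurable[m] g) {C ε : ℝ} (hgC : ∀ᵐ ω ∂μ, ‖g ω‖ ≤ C) {x : Ω → ℝ}
    (hx : StronglyMeasurable x) (hε : ε ≤ 1) (hxε : ∀ᵐ ω ∂μ, |x ω| ≤ ε)
    (hx0 : μ[x | m] =ᵐ[μ] 0) {v : Ω → ℝ} (hv : v = μ[fun ω => x ω ^ 2 | m]) :
    ‖∫ ω, g ω * Complex.exp (x ω * Complex.I + (v ω / 2 : ℝ)) ∂μ - ∫ ω, g ω ∂μ‖ ≤
      3 * C * ε * ∫ ω, v ω ∂μ := by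
  have hε0 : 0 ≤ ε := by
    obtain ⟨ω, hω⟩ := hxε.exists
    exact (abs_nonneg _).trans hω
  have hC0 : 0 ≤ C := by
    obtain ⟨ω, hω⟩ := hgC.exists
    exact (norm_nonneg _).trans hω
  have hxb : AEBdd μ x := ⟨ε, hxε⟩
  have hxi : Integrable x μ := hxb.integrable hx.aestronglyMeasurable
  have hx2i : Integrable (fun ω => x ω ^ 2) μ :=
    hxb.sq.integrable (hx.pow 2).aestronglyMeasurable
  have hvm : StronglyMeasurable[m] v := hv ▸ stronglyMeasurable_condExp
  have hvi : Integrable v μ := hv ▸ integrable_condExp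
  have hv0 : ∀ᵐ ω ∂μ, 0 ≤ v ω := by
    have := condExp_nonneg (μ := μ) (m := m) (f := fun ω => x ω ^ 2)
      (.of_forall fun ω => sq_nonneg _)
    rw [← hv] at this
    exact this
  have hvε : ∀ᵐ ω ∂μ, v ω ≤ ε ^ 2 := by
    have := condExp_le_nonneg_const (μ := μ) (m := m) (f := fun ω => x ω ^ 2) (sq_nonneg ε) (by
      filter_upwards [hxε] with ω h
      rw [← sq_abs]
      gcongr)
    rw [← hv] at this
    exact this
  have hvb : ∀ᵐ ω ∂μ, Real.exp (v ω / 2) ≤ 2 := by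
    filter_upwards [hvε] with ω h
    have h1 : v ω / 2 ≤ 1 / 2 := by nlinarith
    have h2 : Real.exp (1 / 2 : ℝ) ≤ 2 := by
      have h3 := Real.exp_one_lt_d9
      have h4 : Real.exp (1 / 2 : ℝ) ^ 2 = Real.exp 1 := by rw [← Real.exp_nat_mul]; norm_num
      nlinarith [Real.exp_pos (1 / 2 : ℝ)]
    exact (Real.exp_le_exp.mpr h1).trans h2
  -- The weight `G` is again `m`-measurable, so that `x` and `x ^ 2` may be replaced by their
  -- conditional expectations `0` and `v` when they are integrated against it.
  set G : Ω → ℂ := fun ω => g ω * (Real.exp (v ω / 2) : ℝ) with hG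
  have hGm : StronglyMeasurable[m] G := by
    refine hg.mul (Complex.continuous_ofReal.comp_stronglyMeasurable ?_)
    exact Real.continuous_exp.comp_stronglyMeasurable
      (hvm.measurable.div_const 2).stronglyMeasurable
  have hGC : ∀ᵐ ω ∂μ, ‖G ω‖ ≤ C * 2 := by
    filter_upwards [hgC, hvb] with ω h1 h2
    simp only [hG, norm_mul, Complex.norm_real, Real.norm_eq_abs, Real.abs_exp]
    gcongr
  have hi1 : ∫ ω, G ω * (x ω : ℂ) ∂μ = 0 := by
    rw [integral_mul_condExp_complex hm hGm hGC hxi, ← integral_zero Ω ℂ (μ := μ)]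
    refine integral_congr_ae ?_
    filter_upwards [hx0] with ω h
    simp [h]
  have hi2 : ∫ ω, G ω * ((x ω ^ 2 : ℝ) : ℂ) ∂μ = ∫ ω, G ω * (v ω : ℂ) ∂μ := by
    rw [integral_mul_condExp_complex hm hGm hGC hx2i, ← hv]
  have hGa := (hGm.mono hm).aestronglyMeasurable (μ := μ)
  have hga := (hg.mono hm).aestronglyMeasurable (μ := μ)
  have hI1 : Integrable (fun ω => G ω * (x ω : ℂ)) μ := hxi.ofReal.bdd_mul hGa hGC
  have hI2 : Integrable (fun ω => G ω * ((x ω ^ 2 : ℝ) : ℂ)) μ := hx2i.ofReal.bdd_mul hGa hGC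
  have hI3 : Integrable (fun ω => G ω * (v ω : ℂ)) μ := hvi.ofReal.bdd_mul hGa hGC
  have hIg : Integrable g μ := Integrable.of_bound hga C hgC
  have hIG : Integrable (fun ω => G ω * Complex.exp (x ω * Complex.I)) μ := by
    refine Integrable.of_bound (hGa.mul ?_) (C * 2) ?_
    · have : Measurable x := hx.measurable
      exact Measurable.aestronglyMeasurable (by fun_prop)
    · filter_upwards [hGC] with ω h
      rw [norm_mul, Complex.norm_exp_ofReal_mul_I, mul_one]
      exact h
  have hsplit : (fun ω => g ω * Complex.exp (x ω * Complex.I + (v ω / 2 : ℝ))) =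
      fun ω => G ω * Complex.exp (x ω * Complex.I) := by
    funext ω
    simp only [hG, Complex.ofReal_exp]
    rw [Complex.exp_add]; ring
  have hkey : ∫ ω, g ω * Complex.exp (x ω * Complex.I + (v ω / 2 : ℝ)) ∂μ - ∫ ω, g ω ∂μ =
      ∫ ω, (G ω * Complex.exp (x ω * Complex.I) - g ω - G ω * (x ω : ℂ) * Complex.I
        + (2 : ℂ)⁻¹ * (G ω * ((x ω ^ 2 : ℝ) : ℂ) - G ω * (v ω : ℂ))) ∂μ := by
    have hA : Integrable (fun ω => G ω * Complex.exp (x ω * Complex.I) - g ω) μ := hIG.sub hIg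
    have hB : Integrable (fun ω => G ω * (x ω : ℂ) * Complex.I) μ := hI1.mul_const _
    have hAB : Integrable (fun ω => G ω * Complex.exp (x ω * Complex.I) - g ω -
        G ω * (x ω : ℂ) * Complex.I) μ := hA.sub hB
    have hD : Integrable (fun ω => (2 : ℂ)⁻¹ *
        (G ω * ((x ω ^ 2 : ℝ) : ℂ) - G ω * (v ω : ℂ))) μ := (hI2.sub hI3).const_mul _
    rw [integral_add hAB hD, integral_sub hA hB, integral_sub hIG hIg, integral_mul_const, hi1,
      integral_const_mul, integral_sub hI2 hI3, hi2, hsplit]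
    simp
  rw [hkey]
  have hvx : ∫ ω, v ω ∂μ = ∫ ω, x ω ^ 2 ∂μ := by rw [hv, integral_condExp hm]
  calc ‖∫ ω, _ ∂μ‖ ≤ ∫ ω, (C * ε * v ω + 2 * C * ε * x ω ^ 2) ∂μ := by
        refine norm_integral_le_of_norm_le ((hvi.const_mul _).add (hx2i.const_mul _)) ?_
        filter_upwards [hgC, hvb, hv0, hvε, hxε, hGC] with ω h1 h2 h3 h4 h5 h6
        have e : G ω * Complex.exp (x ω * Complex.I) - g ω - G ω * (x ω : ℂ) * Complex.I
            + (2 : ℂ)⁻¹ * (G ω * ((x ω ^ 2 : ℝ) : ℂ) - G ω * (v ω : ℂ)) =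
            g ω * ((Real.exp (v ω / 2) * (1 - v ω / 2) - 1 : ℝ) : ℂ) +
            G ω * (Complex.exp (x ω * Complex.I) -
              (1 + x ω * Complex.I - (x ω ^ 2 / 2 : ℝ))) := by
          simp only [hG]; push_cast; ring
        rw [e]
        refine (norm_add_le _ _).trans ?_
        rw [norm_mul, norm_mul, Complex.norm_real, Real.norm_eq_abs]
        have b1 := abs_exp_mul_one_sub_sub_one_le (u := v ω / 2) (by nlinarith)
        have b2 := norm_exp_mul_I_sub_le (h5.trans hε)
        have b3 : |x ω| ^ 3 ≤ ε * x ω ^ 2 := by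
          rw [pow_succ, sq_abs, mul_comm]
          gcongr
        have b4 : (v ω / 2) ^ 2 ≤ ε * v ω := by nlinarith
        have c1 := mul_le_mul h1 (b1.trans b4) (abs_nonneg _) hC0
        have c2 := mul_le_mul h6 (b2.trans b3) (norm_nonneg _) (by positivity)
        linarith
    _ = 3 * C * ε * ∫ ω, v ω ∂μ := by
        rw [integral_add (hvi.const_mul _) (hx2i.const_mul _), integral_const_mul,
          integral_const_mul, ← hvx]
        ring

/-- A triangular array of martingale differences with uniformly small increments, whose conditional
variances sum up to a bounded random variable converging in probability to a constant `s`, has a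
sum whose characteristic function at `1` converges to `exp (-s / 2)`. -/
theorem tendsto_integral_exp_sum_of_martingale_differences (ℱ : ℕ → MeasurableSpace Ω)
    (hmono : Monotone ℱ) (hle : ∀ i, ℱ i ≤ m₀) (x : ℕ → ℕ → Ω → ℝ)
    (hx : ∀ n i, StronglyMeasurable[ℱ (i + 1)] (x n i)) (ε : ℕ → ℝ)
    (hε : Tendsto ε atTop (𝓝 0)) (hxε : ∀ n, ∀ i < n, ∀ᵐ ω ∂μ, |x n i ω| ≤ ε n)
    (hx0 : ∀ n, ∀ i < n, μ[x n i | ℱ i] =ᵐ[μ] 0) (K s : ℝ)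
    (hK : ∀ n, ∀ᵐ ω ∂μ, ∑ i ∈ Finset.range n, (μ[fun ω' => x n i ω' ^ 2 | ℱ i]) ω ≤ K)
    (hs : TendstoInMeasure μ
      (fun n ω => ∑ i ∈ Finset.range n, (μ[fun ω' => x n i ω' ^ 2 | ℱ i]) ω) atTop (fun _ => s)) :
    Tendsto (fun n => ∫ ω, Complex.exp ((∑ i ∈ Finset.range n, x n i ω : ℝ) * Complex.I) ∂μ)
      atTop (𝓝 (Complex.exp (-(s / 2 : ℝ)))) := by
  set v : ℕ → ℕ → Ω → ℝ := fun n i => μ[fun ω' => x n i ω' ^ 2 | ℱ i] with hv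
  have hvm : ∀ n i, StronglyMeasurable[ℱ i] (v n i) := fun n i => stronglyMeasurable_condExp
  have hvi : ∀ n i, Integrable (v n i) μ := fun n i => integrable_condExp
  have hv0 : ∀ n i, ∀ᵐ ω ∂μ, 0 ≤ v n i ω := fun n i =>
    condExp_nonneg (.of_forall fun ω => sq_nonneg _)
  have hv0' : ∀ n, ∀ᵐ ω ∂μ, ∀ i, 0 ≤ v n i ω := fun n => ae_all_iff.mpr (hv0 n)
  -- the exponential process, which would be a martingale for Gaussian increments
  let P : ℕ → ℕ → Ω → ℂ := fun n k ω =>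
    Complex.exp ((∑ i ∈ Finset.range k, x n i ω : ℝ) * Complex.I +
      ((∑ i ∈ Finset.range k, v n i ω) / 2 : ℝ))
  have hPm : ∀ n k, StronglyMeasurable[ℱ k] (P n k) := by
    intro n k
    have h1 : StronglyMeasurable[ℱ k] (fun ω => ∑ i ∈ Finset.range k, x n i ω) :=
      Finset.stronglyMeasurable_fun_sum _ fun i hi =>
        (hx n i).mono (hmono (Finset.mem_range.mp hi))
    have h2 : StronglyMeasurable[ℱ k] (fun ω => ∑ i ∈ Finset.range k, v n i ω) :=
      Finset.stronglyMeasurable_fun_sum _ fun i hi =>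
        (hvm n i).mono (hmono (Finset.mem_range.mp hi).le)
    refine Complex.continuous_exp.comp_stronglyMeasurable ?_
    exact ((Complex.continuous_ofReal.comp_stronglyMeasurable h1).mul_const _).add
      (Complex.continuous_ofReal.comp_stronglyMeasurable
        (h2.measurable.div_const 2).stronglyMeasurable)
  have hPn : ∀ n k ω, ‖P n k ω‖ = Real.exp ((∑ i ∈ Finset.range k, v n i ω) / 2) := by
    intro n k ω
    simp only [P]
    rw [Complex.norm_exp]
    simp
  have hPC : ∀ n, ∀ k ≤ n, ∀ᵐ ω ∂μ, ‖P n k ω‖ ≤ Real.exp (K / 2) := by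
    intro n k hk
    filter_upwards [hv0' n, hK n] with ω h1 h2
    rw [hPn]
    gcongr
    refine le_trans ?_ h2
    exact Finset.sum_le_sum_of_subset_of_nonneg (Finset.range_mono hk) fun i _ _ => h1 i
  have hK0 : 0 ≤ K := by
    obtain ⟨ω, h1, h2⟩ := ((hv0' 0).and (hK 0)).exists
    simpa using h2
  have hIv : ∀ n, ∑ i ∈ Finset.range n, ∫ ω, v n i ω ∂μ ≤ K := by
    intro n
    rw [← integral_finsetSum _ fun i _ => hvi n i]
    calc _ ≤ ∫ _, K ∂μ :=
          integral_mono_ae (integrable_finsetSum _ fun i _ => hvi n i) (integrable_const _) (hK n)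
      _ = K := by simp
  have hstep : ∀ n, ε n ≤ 1 → ∀ k ≤ n, ‖∫ ω, P n k ω ∂μ - 1‖ ≤
      ∑ i ∈ Finset.range k, 3 * Real.exp (K / 2) * ε n * ∫ ω, v n i ω ∂μ := by
    intro n hn k
    induction k with
    | zero => intro _; simp [P]
    | succ k ih =>
      intro hk
      have h1 := norm_integral_mul_exp_sub_le (hle k) (hPm n k) (hPC n k (by omega))
        ((hx n k).mono (hle (k + 1))) hn (hxε n k hk) (hx0 n k hk) (v := v n k) rfl
      have h2 : (fun ω => P n k ω * Complex.exp (x n k ω * Complex.I + (v n k ω / 2 : ℝ))) =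
          P n (k + 1) := by
        funext ω
        simp only [P, Finset.sum_range_succ]
        rw [← Complex.exp_add]
        congr 1
        push_cast
        ring
      rw [h2] at h1
      rw [Finset.sum_range_succ]
      calc _ = ‖(∫ ω, P n k ω ∂μ - 1) + (∫ ω, P n (k + 1) ω ∂μ - ∫ ω, P n k ω ∂μ)‖ := by
            congr 1; ring
        _ ≤ _ := (norm_add_le _ _).trans (add_le_add (ih (by omega)) h1)
  have hlim1 : Tendsto (fun n => ∫ ω, P n n ω ∂μ) atTop (𝓝 1) := by
    rw [tendsto_iff_norm_sub_tendsto_zero]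
    have hb : Tendsto (fun n => 3 * Real.exp (K / 2) * ε n * K) atTop (𝓝 0) := by
      simpa using (hε.const_mul (3 * Real.exp (K / 2))).mul_const K
    refine squeeze_zero' (.of_forall fun n => norm_nonneg _) ?_ hb
    filter_upwards [hε.eventually_le_const (zero_lt_one), eventually_gt_atTop 0] with n hn hn0
    have hε0 : 0 ≤ ε n := by
      obtain ⟨ω, hω⟩ := (hxε n 0 hn0).exists
      exact (abs_nonneg _).trans hω
    refine (hstep n hn n le_rfl).trans ?_
    rw [← Finset.mul_sum]
    exact mul_le_mul_of_nonneg_left (hIv n) (by positivity)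
  have hlim2 : Tendsto (fun n => ∫ ω, |(∑ i ∈ Finset.range n, v n i ω) - s| ∂μ) atTop (𝓝 0) := by
    refine tendsto_integral_abs_of_tendstoInMeasure (K := K + |s|) (fun n => ?_) (fun n => ?_) ?_
    · exact ((integrable_finsetSum _ fun i _ => hvi n i).sub
        (integrable_const s)).aestronglyMeasurable
    · filter_upwards [hv0' n, hK n] with ω h1 h2
      have h3 : 0 ≤ ∑ i ∈ Finset.range n, v n i ω := Finset.sum_nonneg fun i _ => h1 i
      refine (abs_sub _ _).trans ?_
      rw [abs_of_nonneg h3]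
      gcongr
    · rw [tendstoInMeasure_iff_norm] at hs ⊢
      simpa using hs
  set E : ℕ → Ω → ℂ := fun n ω =>
    Complex.exp ((∑ i ∈ Finset.range n, x n i ω : ℝ) * Complex.I) with hE
  have hEn : ∀ n ω, ‖E n ω‖ = 1 := fun n ω => Complex.norm_exp_ofReal_mul_I _
  have hEm : ∀ n, AEStronglyMeasurable (E n) μ := by
    intro n
    have h1 : StronglyMeasurable (fun ω => ∑ i ∈ Finset.range n, x n i ω) :=
      Finset.stronglyMeasurable_fun_sum _ fun i hi => (hx n i).mono (hle _)
    exact (Complex.continuous_exp.comp_stronglyMeasurable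
      ((Complex.continuous_ofReal.comp_stronglyMeasurable h1).mul_const _)).aestronglyMeasurable
  have hEi : ∀ n, Integrable (E n) μ := fun n =>
    Integrable.of_bound (hEm n) 1 (.of_forall fun ω => (hEn n ω).le)
  have hPi : ∀ n, Integrable (P n n) μ := fun n =>
    Integrable.of_bound ((hPm n n).mono (hle n)).aestronglyMeasurable _ (hPC n n le_rfl)
  -- In the exponential process the accumulated conditional variance may be replaced by `s`.
  have hlim3 : Tendsto (fun n => ∫ ω, P n n ω ∂μ - Complex.exp (s / 2 : ℝ) * ∫ ω, E n ω ∂μ)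
      atTop (𝓝 0) := by
    rw [tendsto_zero_iff_norm_tendsto_zero]
    have hb := hlim2.const_mul (Real.exp (K / 2 + |s| / 2))
    rw [mul_zero] at hb
    refine squeeze_zero (fun n => norm_nonneg _) (fun n => ?_) hb
    rw [← integral_const_mul, ← integral_sub (hPi n) ((hEi n).const_mul _), ← integral_const_mul]
    refine norm_integral_le_of_norm_le ((((integrable_finsetSum _ fun i _ => hvi n i).sub
        (integrable_const s)).abs).const_mul _) ?_
    filter_upwards [hv0' n, hK n] with ω h1 h2
    set V := ∑ i ∈ Finset.range n, v n i ω with hV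
    have e : P n n ω - Complex.exp (s / 2 : ℝ) * E n ω =
        E n ω * ((Real.exp (V / 2) - Real.exp (s / 2) : ℝ) : ℂ) := by
      simp only [P, hE, ← hV]
      rw [Complex.exp_add]
      push_cast
      ring
    change ‖P n n ω - Complex.exp (s / 2 : ℝ) * E n ω‖ ≤ _
    rw [e, norm_mul, hEn, one_mul, Complex.norm_real, Real.norm_eq_abs]
    have key : ∀ a b L : ℝ, a ≤ L → b ≤ L → |Real.exp a - Real.exp b| ≤ Real.exp L * |a - b| := by
      have aux : ∀ a b L : ℝ, b ≤ a → a ≤ L →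
          |Real.exp a - Real.exp b| ≤ Real.exp L * |a - b| := by
        intro a b L hab haL
        rw [abs_of_nonneg (sub_nonneg.mpr (Real.exp_le_exp.mpr hab)),
          abs_of_nonneg (sub_nonneg.mpr hab)]
        have h3 := Real.add_one_le_exp (b - a)
        have h4 : Real.exp b = Real.exp a * Real.exp (b - a) := by rw [← Real.exp_add]; ring_nf
        have h5 := Real.exp_le_exp.mpr haL
        have h6 := Real.exp_pos a
        calc Real.exp a - Real.exp b = Real.exp a * (1 - Real.exp (b - a)) := by rw [h4]; ring
          _ ≤ Real.exp a * (a - b) := mul_le_mul_of_nonneg_left (by linarith) h6.le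
          _ ≤ Real.exp L * (a - b) :=
            mul_le_mul_of_nonneg_right h5 (sub_nonneg.mpr hab)
      intro a b L ha hb
      rcases le_total b a with h | h
      · exact aux a b L h ha
      · rw [abs_sub_comm, abs_sub_comm a b]; exact aux b a L h hb
    have hVK : V / 2 ≤ K / 2 + |s| / 2 := by linarith [abs_nonneg s]
    have hsK : s / 2 ≤ K / 2 + |s| / 2 := by linarith [le_abs_self s]
    refine (key _ _ _ hVK hsK).trans ?_
    refine mul_le_mul_of_nonneg_left ?_ (Real.exp_pos _).le
    rw [show V / 2 - s / 2 = (V - s) / 2 by ring, abs_div]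
    rw [abs_two]
    linarith [abs_nonneg (V - s)]
  have hlim4 := (hlim1.sub hlim3).const_mul (Complex.exp (-(s / 2 : ℝ)))
  simp only [sub_sub_cancel, ← mul_assoc, ← Complex.exp_add, neg_add_cancel, Complex.exp_zero,
    one_mul, sub_zero, mul_one] at hlim4
  exact hlim4

end MartingaleCharFun

/-! ### Conditional independence and conditional expectations -/

section CondIndep

variable {Ω : Type*} {m m₁ m₂ m₀ : MeasurableSpace Ω} {μ : Measure Ω}

lemma setIntegral_inter_eq_integral_mul {A B : Set Ω} (hA : MeasurableSet A)
    (hB : MeasurableSet B) (f : Ω → ℝ) :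
    ∫ ω in A ∩ B, f ω ∂μ = ∫ ω in A, B.indicator (fun _ => (1 : ℝ)) ω * f ω ∂μ := by
  rw [← integral_indicator (hA.inter hB), ← integral_indicator hA]
  congr 1
  funext ω
  by_cases h1 : ω ∈ A <;> by_cases h2 : ω ∈ B <;> simp [h1, h2]

variable [IsProbabilityMeasure μ]

/-- The sets `A ∩ B` with `A ∈ m₁`, `B ∈ m₂` generate `m₁ ⊔ m₂`, so that they suffice to identify
a conditional expectation given `m₁ ⊔ m₂`. -/
lemma ae_eq_condExp_sup_of_forall_setIntegral_inter (hm₁ : m₁ ≤ m₀) (hm₂ : m₂ ≤ m₀) {f g : Ω → ℝ}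
    (hf : Integrable f μ) (hg : Integrable g μ) (hgm : StronglyMeasurable[m₁ ⊔ m₂] g)
    (h : ∀ A B, MeasurableSet[m₁] A → MeasurableSet[m₂] B →
      ∫ ω in A ∩ B, g ω ∂μ = ∫ ω in A ∩ B, f ω ∂μ) :
    g =ᵐ[μ] μ[f | m₁ ⊔ m₂] := by
  have hle : m₁ ⊔ m₂ ≤ m₀ := sup_le hm₁ hm₂
  refine ae_eq_condExp_of_forall_setIntegral_eq hle hf (fun s _ _ => hg.integrableOn) ?_
    hgm.aestronglyMeasurable
  intro s hs _
  have hgen : m₁ ⊔ m₂ = MeasurableSpace.generateFrom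
      {s | ∃ A B, MeasurableSet[m₁] A ∧ MeasurableSet[m₂] B ∧ A ∩ B = s} := by
    refine le_antisymm (sup_le ?_ ?_) ?_
    · intro A hA
      exact MeasurableSpace.measurableSet_generateFrom ⟨A, Set.univ, hA, .univ, by simp⟩
    · intro B hB
      exact MeasurableSpace.measurableSet_generateFrom ⟨Set.univ, B, .univ, hB, by simp⟩
    · refine MeasurableSpace.generateFrom_le ?_
      rintro _ ⟨A, B, hA, hB, rfl⟩
      exact MeasurableSet.inter ((le_sup_left : m₁ ≤ m₁ ⊔ m₂) _ hA)
        ((le_sup_right : m₂ ≤ m₁ ⊔ m₂) _ hB)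
  have hpi : IsPiSystem {s | ∃ A B, MeasurableSet[m₁] A ∧ MeasurableSet[m₂] B ∧ A ∩ B = s} := by
    rintro _ ⟨A, B, hA, hB, rfl⟩ _ ⟨A', B', hA', hB', rfl⟩ _
    exact ⟨A ∩ A', B ∩ B', hA.inter hA', hB.inter hB', by
      ext; simp only [Set.mem_inter_iff]; tauto⟩
  have huniv : ∫ ω, g ω ∂μ = ∫ ω, f ω ∂μ := by
    simpa using h Set.univ Set.univ .univ .univ
  induction s, hs using MeasurableSpace.induction_on_inter hgen hpi with
  | empty => simp
  | basic t ht =>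
    obtain ⟨A, B, hA, hB, rfl⟩ := ht
    exact h A B hA hB
  | compl t ht ih =>
    rw [setIntegral_compl (hle _ ht) hg, setIntegral_compl (hle _ ht) hf, huniv,
      ih (measure_lt_top _ _)]
  | iUnion t hd ht ih =>
    rw [integral_iUnion (fun i => hle _ (ht i)) hd hg.integrableOn,
      integral_iUnion (fun i => hle _ (ht i)) hd hf.integrableOn]
    exact tsum_congr fun i => ih i (measure_lt_top _ _)

lemma integrable_indicator_one (hm : m ≤ m₀) {B : Set Ω} (hB : MeasurableSet[m] B) :
    Integrable (B.indicator fun _ => (1 : ℝ)) μ :=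
  (integrable_const (1 : ℝ)).indicator (hm _ hB)

lemma abs_indicator_one_le (B : Set Ω) (ω : Ω) : |B.indicator (fun _ => (1 : ℝ)) ω| ≤ 1 := by
  by_cases h : ω ∈ B <;> simp [h]

/-- If `m₁` and `m₂` are conditionally independent given `m`, then further knowledge of `m₁` does
not change the conditional probability given `m` of an event in `m₂`. -/
lemma CondIndepGiven.condExp_indicator_sup (hm : m ≤ m₀) (hm₁ : m₁ ≤ m₀) (hm₂ : m₂ ≤ m₀)
    (h : CondIndepGiven μ m m₁ m₂) {B : Set Ω} (hB : MeasurableSet[m₂] B) :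
    μ⟦B | m⟧ =ᵐ[μ] μ⟦B | m ⊔ m₁⟧ := by
  refine ae_eq_condExp_sup_of_forall_setIntegral_inter hm hm₁ (integrable_indicator_one hm₂ hB)
    integrable_condExp (stronglyMeasurable_condExp.mono le_sup_left) ?_
  intro A C hA hC
  have hiC := integrable_indicator_one (μ := μ) hm₁ hC
  have hiB := integrable_indicator_one (μ := μ) hm₂ hB
  have hBC : Integrable (fun ω => C.indicator (fun _ => (1 : ℝ)) ω * (μ⟦B | m⟧) ω) μ :=
    integrable_condExp.bdd_mul hiC.aestronglyMeasurable (c := 1)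
      (.of_forall fun ω => abs_indicator_one_le C ω)
  have e1 : μ[fun ω => C.indicator (fun _ => (1 : ℝ)) ω * (μ⟦B | m⟧) ω | m] =ᵐ[μ]
      μ⟦C | m⟧ * μ⟦B | m⟧ :=
    condExp_mul_of_stronglyMeasurable_right stronglyMeasurable_condExp hBC hiC
  calc ∫ ω in A ∩ C, (μ⟦B | m⟧) ω ∂μ
      = ∫ ω in A, C.indicator (fun _ => (1 : ℝ)) ω * (μ⟦B | m⟧) ω ∂μ :=
        setIntegral_inter_eq_integral_mul (hm _ hA) (hm₁ _ hC) _
    _ = ∫ ω in A, (μ⟦C ∩ B | m⟧) ω ∂μ := by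
        rw [← setIntegral_condExp hm hBC hA]
        exact setIntegral_congr_ae (hm _ hA)
          ((e1.trans (h C B hC hB).symm).mono fun ω hω _ => hω)
    _ = ∫ ω in A, (C ∩ B).indicator (fun _ => (1 : ℝ)) ω ∂μ :=
        setIntegral_condExp hm ((integrable_const (1 : ℝ)).indicator
          ((hm₁ _ hC).inter (hm₂ _ hB))) hA
    _ = ∫ ω in A ∩ C, B.indicator (fun _ => (1 : ℝ)) ω ∂μ := by
        rw [setIntegral_inter_eq_integral_mul (hm _ hA) (hm₁ _ hC)]
        congr 1
        funext ω
        by_cases h1 : ω ∈ C <;> by_cases h2 : ω ∈ B <;> simp [h1, h2]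

/-- If `m₁` and `m₂` are conditionally independent given `m`, then further knowledge of `m₂` does
not change the conditional expectation given `m` of a bounded `m₁`-measurable variable. -/
theorem CondIndepGiven.condExp_sup (hm : m ≤ m₀) (hm₁ : m₁ ≤ m₀) (hm₂ : m₂ ≤ m₀)
    (h : CondIndepGiven μ m m₁ m₂) {f : Ω → ℝ} (hfm : StronglyMeasurable[m₁] f)
    (hfb : AEBdd μ f) : μ[f | m ⊔ m₂] =ᵐ[μ] μ[f | m] := by
  have hfi : Integrable f μ := hfb.integrable (hfm.mono hm₁).aestronglyMeasurable
  symm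
  refine ae_eq_condExp_sup_of_forall_setIntegral_inter hm hm₂ hfi integrable_condExp
    (stronglyMeasurable_condExp.mono le_sup_left) ?_
  intro A B hA hB
  have hiB := integrable_indicator_one (μ := μ) hm₂ hB
  have hsup : m ⊔ m₁ ≤ m₀ := sup_le hm hm₁
  obtain ⟨C, hC⟩ := id hfb
  obtain ⟨C', hC'⟩ := hfb.condExp (m := m)
  have i1 : Integrable (fun ω => B.indicator (fun _ => (1 : ℝ)) ω * (μ[f | m]) ω) μ :=
    integrable_condExp.bdd_mul hiB.aestronglyMeasurable (c := 1)
      (.of_forall fun ω => abs_indicator_one_le B ω)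
  have i2 : Integrable (fun ω => (μ⟦B | m⟧) ω * f ω) μ :=
    integrable_condExp.mul_bdd (hfm.mono hm₁).aestronglyMeasurable hC
  have i3 : Integrable (fun ω => B.indicator (fun _ => (1 : ℝ)) ω * f ω) μ :=
    hfi.bdd_mul hiB.aestronglyMeasurable (c := 1)
      (.of_forall fun ω => abs_indicator_one_le B ω)
  have e1 : μ[fun ω => B.indicator (fun _ => (1 : ℝ)) ω * (μ[f | m]) ω | m] =ᵐ[μ]
      μ⟦B | m⟧ * μ[f | m] :=
    condExp_mul_of_stronglyMeasurable_right stronglyMeasurable_condExp i1 hiB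
  have e2 : μ[fun ω => (μ⟦B | m⟧) ω * f ω | m] =ᵐ[μ] μ⟦B | m⟧ * μ[f | m] :=
    condExp_mul_of_stronglyMeasurable_left stronglyMeasurable_condExp i2 hfi
  have e3 : μ[fun ω => B.indicator (fun _ => (1 : ℝ)) ω * f ω | m ⊔ m₁] =ᵐ[μ]
      μ⟦B | m ⊔ m₁⟧ * f :=
    condExp_mul_of_stronglyMeasurable_right (hfm.mono le_sup_right) i3 hiB
  have e4 := h.condExp_indicator_sup hm hm₁ hm₂ hB
  -- Both sides are integrals over `A` of `f` weighted by the conditional probability of `B`, given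
  -- `m` or, which is the same, given `m ⊔ m₁`.
  calc ∫ ω in A ∩ B, (μ[f | m]) ω ∂μ
      = ∫ ω in A, B.indicator (fun _ => (1 : ℝ)) ω * (μ[f | m]) ω ∂μ :=
        setIntegral_inter_eq_integral_mul (hm _ hA) (hm₂ _ hB) _
    _ = ∫ ω in A, (μ⟦B | m⟧) ω * f ω ∂μ := by
        rw [← setIntegral_condExp hm i1 hA, ← setIntegral_condExp hm i2 hA]
        exact setIntegral_congr_ae (hm _ hA) ((e1.trans e2.symm).mono fun ω hω _ => hω)
    _ = ∫ ω in A, B.indicator (fun _ => (1 : ℝ)) ω * f ω ∂μ := by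
        rw [← setIntegral_condExp hsup i3 ((le_sup_left : m ≤ m ⊔ m₁) _ hA)]
        refine setIntegral_congr_ae (hm _ hA) ?_
        filter_upwards [e3, e4] with ω h3 h4 _
        rw [h3, Pi.mul_apply, h4]
    _ = ∫ ω in A ∩ B, f ω ∂μ :=
        (setIntegral_inter_eq_integral_mul (hm _ hA) (hm₂ _ hB) _).symm

end CondIndep

/-! ### Conditional expectations of bounded variables -/

section BddCondExp

variable {Ω : Type*} {m m' m₀ : MeasurableSpace Ω} {μ : Measure Ω} [IsProbabilityMeasure μ]

/-- Pull-out property after conditioning on a larger σ-algebra first. -/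
lemma condExp_mul_eq_of_condExp_eq (hmm' : m ≤ m') (hm' : m' ≤ m₀) {f g f' : Ω → ℝ}
    (hg : StronglyMeasurable[m'] g) (hgb : AEBdd μ g) (hf : Integrable f μ)
    (hff' : μ[f | m'] =ᵐ[μ] f') :
    μ[fun ω => f ω * g ω | m] =ᵐ[μ] μ[fun ω => f' ω * g ω | m] := by
  obtain ⟨C, hC⟩ := hgb
  have hfg : Integrable (fun ω => f ω * g ω) μ :=
    hf.mul_bdd (hg.mono hm').aestronglyMeasurable hC
  refine (condExp_condExp_of_le hmm' hm').symm.trans (condExp_congr_ae ?_)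
  have h1 : μ[fun ω => f ω * g ω | m'] =ᵐ[μ] μ[f | m'] * g :=
    condExp_mul_of_stronglyMeasurable_right hg hfg hf
  filter_upwards [h1, hff'] with ω h2 h3
  rw [h2, Pi.mul_apply, h3]

/-- Partial sums of variables `e i` which are measurable at the later times and have conditional
mean zero at time `i` are orthogonal, so that their second moments grow linearly. -/
lemma integral_sq_sum_le_of_condExp_eq_zero (ℱ : ℕ → MeasurableSpace Ω) (hle : ∀ i, ℱ i ≤ m₀)
    (e : ℕ → Ω → ℝ) (hem : ∀ i j, i < j → StronglyMeasurable[ℱ j] (e i))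
    (heb : ∀ i, AEBdd μ (e i)) (he0 : ∀ i, μ[e i | ℱ i] =ᵐ[μ] 0) {K : ℝ}
    (hK : ∀ i, ∫ ω, e i ω ^ 2 ∂μ ≤ K) (n : ℕ) :
    ∫ ω, (∑ i ∈ Finset.range n, e i ω) ^ 2 ∂μ ≤ n * K := by
  have hem' : ∀ i, StronglyMeasurable (e i) := fun i => (hem i (i + 1) (by omega)).mono (hle _)
  induction n with
  | zero => simp
  | succ n ih =>
    have hSm : StronglyMeasurable[ℱ n] (fun ω => ∑ i ∈ Finset.range n, e i ω) :=
      Finset.stronglyMeasurable_fun_sum _ fun i hi => hem i n (Finset.mem_range.mp hi)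
    have hSb : AEBdd μ (fun ω => ∑ i ∈ Finset.range n, e i ω) := AEBdd.sum _ fun i _ => heb i
    have hSa := (hSm.mono (hle n)).aestronglyMeasurable (μ := μ)
    have hea := (hem' n).aestronglyMeasurable (μ := μ)
    have hcross : ∫ ω, (∑ i ∈ Finset.range n, e i ω) * e n ω ∂μ = 0 := by
      have h1 : μ[fun ω => (∑ i ∈ Finset.range n, e i ω) * e n ω | ℱ n] =ᵐ[μ]
          (fun ω => ∑ i ∈ Finset.range n, e i ω) * μ[e n | ℱ n] :=
        condExp_mul_of_stronglyMeasurable_left hSm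
          ((hSb.mul (heb n)).integrable (hSa.mul hea)) ((heb n).integrable hea)
      rw [← integral_condExp (hle n), integral_congr_ae h1]
      refine (integral_congr_ae ?_).trans (integral_zero Ω ℝ)
      filter_upwards [he0 n] with ω h2
      simp [h2]
    have i1 := hSb.sq.integrable (hSa.pow 2)
    have i2 := (heb n).sq.integrable (hea.pow 2)
    have i3 := ((hSb.mul (heb n)).integrable (hSa.mul hea)).const_mul 2
    have hexp : ∀ ω, (∑ i ∈ Finset.range (n + 1), e i ω) ^ 2 =
        (∑ i ∈ Finset.range n, e i ω) ^ 2 + 2 * ((∑ i ∈ Finset.range n, e i ω) * e n ω) +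
          e n ω ^ 2 := by
      intro ω
      rw [Finset.sum_range_succ]
      ring
    simp only [hexp]
    have i12 : Integrable (fun ω => (∑ i ∈ Finset.range n, e i ω) ^ 2 +
        2 * ((∑ i ∈ Finset.range n, e i ω) * e n ω)) μ := i1.add i3
    rw [integral_add i12 i2, integral_add i1 i3, integral_const_mul, hcross]
    push_cast
    linarith [hK n]

end BddCondExp

/-! ### Inverse square roots of positive definite matrices -/

section InvSqrt

variable {d : ℕ} {A : Matrix (Fin d) (Fin d) ℝ} {r : ℝ}

lemma invSqrt_posSemidef (A : Matrix (Fin d) (Fin d) ℝ) : (invSqrt A).PosSemidef :=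
  open scoped MatrixOrder in (CFC.sqrt_nonneg A⁻¹).posSemidef

lemma invSqrt_mul_invSqrt (hA : A.PosSemidef) : invSqrt A * invSqrt A = A⁻¹ :=
  open scoped MatrixOrder in CFC.sqrt_mul_sqrt_self A⁻¹ hA.inv.nonneg

lemma invSqrt_transpose (A : Matrix (Fin d) (Fin d) ℝ) : (invSqrt A)ᵀ = invSqrt A := by
  have := (invSqrt_posSemidef A).isHermitian
  rwa [Matrix.IsHermitian, Matrix.conjTranspose_eq_transpose_of_trivial] at this

lemma invSqrt_symm (A : Matrix (Fin d) (Fin d) ℝ) (k k' : Fin d) :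
    invSqrt A k k' = invSqrt A k' k := by
  conv_lhs => rw [← invSqrt_transpose A]
  rfl

lemma posDef_of_sub_smul_one_posSemidef (hr : 0 < r)
    (h : (A - r • (1 : Matrix (Fin d) (Fin d) ℝ)).PosSemidef) : A.PosDef := by
  have := Matrix.PosDef.posSemidef_add h (Matrix.PosDef.one.smul hr)
  simpa using this

lemma le_dotProduct_mulVec_of_sub_smul_one_posSemidef
    (h : (A - r • (1 : Matrix (Fin d) (Fin d) ℝ)).PosSemidef) (x : Fin d → ℝ) :
    r * (x ⬝ᵥ x) ≤ x ⬝ᵥ A *ᵥ x := by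
  have := h.dotProduct_mulVec_nonneg x
  rw [sub_mulVec, dotProduct_sub, smul_mulVec, one_mulVec, dotProduct_smul] at this
  simpa using this

lemma dotProduct_mulVec_comm_invSqrt (x y : Fin d → ℝ) :
    x ⬝ᵥ invSqrt A *ᵥ y = (invSqrt A *ᵥ x) ⬝ᵥ y := by
  rw [dotProduct_mulVec, ← mulVec_transpose, invSqrt_transpose]

/-- If `A` is at least `r`, then the square of the operator norm of `A^{-1/2}` is at most `1/r`. -/
lemma mul_dotProduct_invSqrt_mulVec_le (hr : 0 < r)
    (h : (A - r • (1 : Matrix (Fin d) (Fin d) ℝ)).PosSemidef) (x : Fin d → ℝ) :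
    r * ((invSqrt A *ᵥ x) ⬝ᵥ (invSqrt A *ᵥ x)) ≤ x ⬝ᵥ x := by
  have hA := posDef_of_sub_smul_one_posSemidef hr h
  have hu : IsUnit A.det := (Matrix.isUnit_iff_isUnit_det A).mp hA.isUnit
  set z := A⁻¹ *ᵥ x with hz
  have hx : A *ᵥ z = x := by rw [hz, mulVec_mulVec, Matrix.mul_nonsing_inv A hu, one_mulVec]
  have e : (invSqrt A *ᵥ x) ⬝ᵥ (invSqrt A *ᵥ x) = x ⬝ᵥ z := by
    rw [← dotProduct_mulVec_comm_invSqrt, mulVec_mulVec, invSqrt_mul_invSqrt hA.posSemidef]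
  have h1 := le_dotProduct_mulVec_of_sub_smul_one_posSemidef h z
  rw [hx] at h1
  have h2 : 0 ≤ (x - r • z) ⬝ᵥ (x - r • z) := by
    simpa using dotProduct_star_self_nonneg (x - r • z)
  simp only [sub_dotProduct, dotProduct_sub, smul_dotProduct, dotProduct_smul, smul_eq_mul] at h2
  rw [e]
  rw [dotProduct_comm z x] at h1 h2
  nlinarith

/-- If `A` is at least `r`, then the entries of `A^{-1/2}` are at most `r^{-1/2}`. -/
lemma abs_invSqrt_apply_le (hr : 0 < r)
    (h : (A - r • (1 : Matrix (Fin d) (Fin d) ℝ)).PosSemidef) (k k' : Fin d) :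
    |invSqrt A k k'| ≤ (√r)⁻¹ := by
  have h1 := mul_dotProduct_invSqrt_mulVec_le hr h (Pi.single k' 1)
  rw [mulVec_single_one] at h1
  have h2 : invSqrt A k k' ^ 2 ≤ (invSqrt A).col k' ⬝ᵥ (invSqrt A).col k' := by
    rw [dotProduct, pow_two]
    exact Finset.single_le_sum (f := fun i => (invSqrt A).col k' i * (invSqrt A).col k' i)
      (fun i _ => mul_self_nonneg _) (Finset.mem_univ k)
  have h3 : (Pi.single k' (1 : ℝ) : Fin d → ℝ) ⬝ᵥ Pi.single k' 1 = 1 := by simp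
  rw [h3] at h1
  rw [← Real.sqrt_inv]
  refine Real.abs_le_sqrt (h2.trans ?_)
  rw [inv_eq_one_div, le_div_iff₀ hr]
  linarith

/-- If `A` is at least `r`, then `A^{-1/2} A = A^{1/2}` is at least `r^{1/2}`. -/
lemma sqrt_mul_dotProduct_le_invSqrt_mul (hr : 0 < r)
    (h : (A - r • (1 : Matrix (Fin d) (Fin d) ℝ)).PosSemidef) (x : Fin d → ℝ) :
    √r * (x ⬝ᵥ x) ≤ x ⬝ᵥ (invSqrt A * A) *ᵥ x := by
  have hA := posDef_of_sub_smul_one_posSemidef hr h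
  have hu : IsUnit A.det := (Matrix.isUnit_iff_isUnit_det A).mp hA.isUnit
  have hs : √r * √r = r := Real.mul_self_sqrt hr.le
  have hs0 : 0 < √r := Real.sqrt_pos.mpr hr
  set w := (invSqrt A * A) *ᵥ x with hw
  have hx : invSqrt A *ᵥ w = x := by
    rw [hw, mulVec_mulVec, ← Matrix.mul_assoc, invSqrt_mul_invSqrt hA.posSemidef,
      Matrix.nonsing_inv_mul A hu, one_mulVec]
  have h1 := mul_dotProduct_invSqrt_mulVec_le hr h x
  have h2 : 0 ≤ (x - √r • invSqrt A *ᵥ x) ⬝ᵥ (x - √r • invSqrt A *ᵥ x) := by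
    simpa using dotProduct_star_self_nonneg (x - √r • invSqrt A *ᵥ x)
  have h3 := (invSqrt_posSemidef A).dotProduct_mulVec_nonneg (w - √r • x)
  rw [mulVec_sub, mulVec_smul, hx] at h3
  simp only [star_trivial, sub_dotProduct, dotProduct_sub, smul_dotProduct, dotProduct_smul,
    smul_eq_mul] at h2 h3
  rw [dotProduct_mulVec_comm_invSqrt w x, hx] at h3
  rw [dotProduct_comm (invSqrt A *ᵥ x) x] at h2
  rw [dotProduct_comm w x] at h3
  set a := x ⬝ᵥ x
  set b := x ⬝ᵥ invSqrt A *ᵥ x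
  set b2 := (invSqrt A *ᵥ x) ⬝ᵥ (invSqrt A *ᵥ x)
  have h4 : √r * (√r * b2) = r * b2 := by rw [← mul_assoc, hs]
  have h5 : √r * b ≤ a := by nlinarith
  have h6 : √r * (√r * b) ≤ √r * a := mul_le_mul_of_nonneg_left h5 hs0.le
  linarith

section Measurability

open scoped MatrixOrder

/-- The square root of a matrix is a Borel function of its entries: on the closed set of positive
semidefinite matrices it is the inverse of an injective continuous map, and elsewhere it is `0`. -/
lemma measurable_cfcSqrt : Measurable fun a : Fin d → Fin d → ℝ =>
    (fun k k' => CFC.sqrt (Matrix.of a) k k' : Fin d → Fin d → ℝ) := by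
  set S : Set (Fin d → Fin d → ℝ) := {a | (Matrix.of a).PosSemidef} with hS
  have hSc : IsClosed S := by
    have e : S = {a | (Matrix.of a)ᵀ = Matrix.of a} ∩
        ⋂ x : Fin d → ℝ, {a | 0 ≤ x ⬝ᵥ Matrix.of a *ᵥ x} := by
      ext a
      simp only [hS, Set.mem_ofPred_eq, Matrix.posSemidef_iff_dotProduct_mulVec, Set.mem_inter_iff,
        Set.mem_iInter, Matrix.IsHermitian, Matrix.conjTranspose_eq_transpose_of_trivial,
        star_trivial]
    rw [e]
    refine IsClosed.inter ?_ (isClosed_iInter fun x => ?_)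
    · have : {a : Fin d → Fin d → ℝ | (Matrix.of a)ᵀ = Matrix.of a} =
          ⋂ k, ⋂ k', {a | a k' k = a k k'} := by
        ext a
        simp only [Set.mem_ofPred_eq, Set.mem_iInter, ← Matrix.ext_iff, Matrix.transpose_apply,
          Matrix.of_apply]
      rw [this]
      exact isClosed_iInter fun k => isClosed_iInter fun k' =>
        isClosed_eq (by fun_prop) (by fun_prop)
    · refine isClosed_le continuous_const ?_
      simp only [dotProduct, mulVec, Matrix.of_apply]
      fun_prop
  have hSm : MeasurableSet S := hSc.measurableSet
  have : StandardBorelSpace S := hSm.standardBorel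
  let g : S → (Fin d → Fin d → ℝ) := fun a k k' => (Matrix.of a.1 * Matrix.of a.1) k k'
  have hgm : Measurable g := by
    refine Continuous.measurable ?_
    simp only [g, Matrix.mul_apply, Matrix.of_apply]
    have hc : ∀ k k', Continuous fun a : S => a.1 k k' := fun k k' =>
      (continuous_apply_apply k k').comp continuous_subtype_val
    exact continuous_pi fun k => continuous_pi fun k' =>
      continuous_finsetSum _ fun j _ => (hc k j).mul (hc j k')
  have hgi : Function.Injective g := by
    intro a b hab
    have h1 : Matrix.of a.1 * Matrix.of a.1 = Matrix.of b.1 * Matrix.of b.1 := by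
      ext k k'; exact congr_fun (congr_fun hab k) k'
    have h2 := congr_arg CFC.sqrt h1
    rw [CFC.sqrt_mul_self _ (a.2 : (Matrix.of a.1).PosSemidef).nonneg,
      CFC.sqrt_mul_self _ (b.2 : (Matrix.of b.1).PosSemidef).nonneg] at h2
    exact Subtype.ext (Matrix.of.injective h2)
  have hemb : MeasurableEmbedding g := hgm.measurableEmbedding hgi
  have hF := hemb.measurable_extend measurable_subtype_coe
    (measurable_const (a := (0 : Fin d → Fin d → ℝ)))
  convert hF using 1
  funext a
  by_cases ha : a ∈ S
  · have hb : (CFC.sqrt (Matrix.of a)).PosSemidef := (CFC.sqrt_nonneg _).posSemidef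
    have hab : a = g ⟨fun k k' => CFC.sqrt (Matrix.of a) k k', hb⟩ := by
      funext k k'
      have := CFC.sqrt_mul_sqrt_self (Matrix.of a) (ha : (Matrix.of a).PosSemidef).nonneg
      exact (congr_fun (congr_fun this k) k').symm
    conv_rhs => rw [hab]
    rw [hgi.extend_apply]
  · have h0 : CFC.sqrt (Matrix.of a) = 0 := by
      refine CFC.sqrt_of_not_nonneg fun h => ha ?_
      exact h.posSemidef
    rw [Function.extend_apply']
    · rw [h0]; rfl
    · rintro ⟨b, rfl⟩
      refine ha ?_
      have hb : (Matrix.of b.1).PosSemidef := b.2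
      have := Matrix.posSemidef_conjTranspose_mul_self (Matrix.of b.1)
      rw [hb.isHermitian.eq] at this
      exact this

lemma measurable_matrix_inv : Measurable fun a : Fin d → Fin d → ℝ =>
    (fun k k' => (Matrix.of a)⁻¹ k k' : Fin d → Fin d → ℝ) := by
  simp only [Matrix.inv_def, Ring.inverse_eq_inv', Matrix.smul_apply, smul_eq_mul]
  have h1 : Measurable fun a : Fin d → Fin d → ℝ => (Matrix.of a).det :=
    Continuous.measurable (Continuous.matrix_det (by exact continuous_id))
  refine measurable_pi_lambda _ fun k => measurable_pi_lambda _ fun k' => ?_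
  refine h1.inv.mul (Continuous.measurable ?_)
  exact (Continuous.matrix_adjugate (by exact continuous_id)).matrix_elem k k'

lemma measurable_invSqrt : Measurable fun a : Fin d → Fin d → ℝ =>
    (fun k k' => invSqrt (Matrix.of a) k k' : Fin d → Fin d → ℝ) :=
  measurable_cfcSqrt.comp measurable_matrix_inv

end Measurability

end InvSqrt

/-! ### Eigenvalues of block triangular matrices -/

/-- The eigenvalues of a block upper triangular real matrix whose diagonal blocks have quadratic
forms bounded below by `r` have absolute value at least `r`. -/
theorem le_norm_of_mem_spectrum_of_blockTriangular {ι β : Type*} [Fintype ι] [DecidableEq ι]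
    [LinearOrder β] (f : ι → β) (B : Matrix ι ι ℝ) (r : ℝ)
    (htri : ∀ b b', f b' < f b → B b b' = 0)
    (hpos : ∀ (s : β) (x : ι → ℝ), (∀ b, f b ≠ s → x b = 0) →
      r * ∑ b, x b ^ 2 ≤ ∑ b, ∑ b', x b * B b b' * x b')
    (z : ℂ) (hz : z ∈ spectrum ℂ (B.map Complex.ofReal)) : r ≤ ‖z‖ := by
  rw [← Matrix.spectrum_toLin', ← Module.End.hasEigenvalue_iff_mem_spectrum] at hz
  obtain ⟨v, hv⟩ := hz.exists_hasEigenvector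
  have hv0 := hv.2
  have hvz : (B.map Complex.ofReal) *ᵥ v = z • v := by
    have := hv.apply_eq_smul
    simpa using this
  -- The last block on which the eigenvector does not vanish is an eigenvector of that block.
  obtain ⟨b₀, hb₀, hmax⟩ : ∃ b₀, v b₀ ≠ 0 ∧ ∀ b, v b ≠ 0 → f b ≤ f b₀ := by
    obtain ⟨b₁, hb₁⟩ := Function.ne_iff.mp hv0
    obtain ⟨b₀, hb₀, h⟩ := Finset.exists_max_image (Finset.univ.filter fun b => v b ≠ 0) f
      ⟨b₁, by simpa using hb₁⟩
    exact ⟨b₀, by simpa using hb₀, fun b hb => h b (by simpa using hb)⟩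
  set x : ι → ℝ := fun b => if f b = f b₀ then (v b).re else 0 with hx
  set y : ι → ℝ := fun b => if f b = f b₀ then (v b).im else 0 with hy
  have hrow : ∀ b, f b = f b₀ → (∑ b', B b b' * x b' = z.re * x b - z.im * y b) ∧
      (∑ b', B b b' * y b' = z.re * y b + z.im * x b) := by
    intro b hb
    have h1 := congr_fun hvz b
    simp only [mulVec, dotProduct, Matrix.map_apply, Pi.smul_apply, smul_eq_mul] at h1
    have hcoord : ∀ b', (B b b' * (v b').re = B b b' * x b') ∧
        (B b b' * (v b').im = B b b' * y b') := by
      intro b'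
      by_cases h2 : f b' = f b₀
      · simp [hx, hy, h2]
      · rcases lt_or_gt_of_ne h2 with h3 | h3
        · simp [htri b b' (by rw [hb]; exact h3)]
        · have h4 : v b' = 0 := by
            by_contra h4
            exact absurd (hmax b' h4) (not_le.mpr h3)
          simp [hx, hy, h2, h4]
    have hre := congr_arg Complex.re h1
    have him := congr_arg Complex.im h1
    simp only [Complex.re_sum, Complex.im_sum, Complex.mul_re, Complex.mul_im, Complex.ofReal_re,
      Complex.ofReal_im, zero_mul, sub_zero, add_zero] at hre him
    simp only [fun b' => (hcoord b').1] at hre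
    simp only [fun b' => (hcoord b').2] at him
    exact ⟨by rw [hre]; simp [hx, hy, hb], by rw [him]; simp [hx, hy, hb]⟩
  have hX := hpos (f b₀) x fun b hb => by simp [hx, hb]
  have hY := hpos (f b₀) y fun b hb => by simp [hy, hb]
  have hsum : (∑ b, ∑ b', x b * B b b' * x b') + (∑ b, ∑ b', y b * B b b' * y b') =
      z.re * (∑ b, x b ^ 2 + ∑ b, y b ^ 2) := by
    simp only [mul_assoc, ← Finset.mul_sum]
    rw [← Finset.sum_add_distrib, ← Finset.sum_add_distrib, Finset.mul_sum]
    refine Finset.sum_congr rfl fun b _ => ?_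
    by_cases hb : f b = f b₀
    · rw [(hrow b hb).1, (hrow b hb).2]; ring
    · simp [hx, hy, hb]
  have hN : 0 < ∑ b, x b ^ 2 + ∑ b, y b ^ 2 := by
    rw [← Finset.sum_add_distrib]
    refine Finset.sum_pos' (fun b _ => by positivity) ⟨b₀, Finset.mem_univ _, ?_⟩
    have h5 : 0 < Complex.normSq (v b₀) := Complex.normSq_pos.mpr hb₀
    rw [Complex.normSq_apply] at h5
    simp only [hx, hy, if_true]
    linarith [sq (v b₀).re, sq (v b₀).im]
  have h6 : r * (∑ b, x b ^ 2 + ∑ b, y b ^ 2) ≤ z.re * (∑ b, x b ^ 2 + ∑ b, y b ^ 2) := by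
    rw [← hsum, mul_add]; exact add_le_add hX hY
  exact (le_of_mul_le_mul_right h6 hN).trans ((le_abs_self _).trans (Complex.abs_re_le_norm z))

/-! ### The σ-algebras of the sequential experiment -/

namespace Episodes

section Measurability

variable {l d : ℕ} {Ω 𝒳 𝒯 : Type*} [m₀ : MeasurableSpace Ω] [MeasurableSpace 𝒳]
  [MeasurableSpace 𝒯] (D : Episodes l Ω 𝒳 𝒯)

lemma measurable_Y_comp (i : ℕ) {τ : Ω → Fin l → 𝒯} (hτ : Measurable τ) :
    Measurable fun ω => D.Y i (τ ω) ω :=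
  (D.measurable_Y i).comp (hτ.prodMk measurable_id)

lemma measurable_outcome (i : ℕ) : Measurable (D.outcome i) :=
  D.measurable_Y_comp i (measurable_pi_lambda _ fun j => D.measurable_T i j)

lemma measurable_outcomeFrom (i : ℕ) (j : Fin l) (τ : Fin l → 𝒯) :
    Measurable (D.outcomeFrom i j τ) := by
  refine D.measurable_Y_comp i (measurable_pi_lambda _ fun k => ?_)
  by_cases h : k < j
  · simpa [h] using D.measurable_T i k
  · simp [h]

lemma episodeSigma_le (i : ℕ) : D.episodeSigma i ≤ m₀ :=
  sup_le (sup_le (iSup_le fun j => (D.measurable_X i j).comap_le)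
    (iSup_le fun j => (D.measurable_T i j).comap_le)) (D.measurable_outcome i).comap_le

lemma comap_X_le_episodeSigma (i : ℕ) (j : Fin l) :
    MeasurableSpace.comap (D.X i j) inferInstance ≤ D.episodeSigma i :=
  (le_iSup (fun j => MeasurableSpace.comap (D.X i j) inferInstance) j).trans
    (le_sup_left.trans le_sup_left)

lemma comap_T_le_episodeSigma (i : ℕ) (j : Fin l) :
    MeasurableSpace.comap (D.T i j) inferInstance ≤ D.episodeSigma i :=
  (le_iSup (fun j => MeasurableSpace.comap (D.T i j) inferInstance) j).trans
    (le_sup_right.trans le_sup_left)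

lemma episodeSigma_le_past {i n : ℕ} (h : i < n) : D.episodeSigma i ≤ D.past n :=
  le_iSup₂_of_le i h le_rfl

lemma past_le (i : ℕ) : D.past i ≤ m₀ := iSup₂_le fun i' _ => D.episodeSigma_le i'

lemma past_mono : Monotone D.past := fun _ _ h =>
  iSup₂_le fun _ hi => D.episodeSigma_le_past (lt_of_lt_of_le hi h)

lemma past_le_hist (i : ℕ) (s : Fin (l + 1)) : D.past i ≤ D.hist i s :=
  le_sup_left.trans le_sup_left

lemma comap_X_le_hist (i : ℕ) {j : Fin l} {s : Fin (l + 1)} (h : j.succ ≤ s) :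
    MeasurableSpace.comap (D.X i j) inferInstance ≤ D.hist i s :=
  le_sup_of_le_left (le_sup_of_le_right (le_iSup₂_of_le j h le_rfl))

lemma comap_T_le_hist (i : ℕ) {j : Fin l} {s : Fin (l + 1)} (h : j.succ < s) :
    MeasurableSpace.comap (D.T i j) inferInstance ≤ D.hist i s :=
  le_sup_of_le_right (le_iSup₂_of_le j h le_rfl)

lemma hist_le_past_succ (i : ℕ) (s : Fin (l + 1)) : D.hist i s ≤ D.past (i + 1) :=
  sup_le (sup_le (D.past_mono i.le_succ)
    (iSup₂_le fun j _ => (D.comap_X_le_episodeSigma i j).trans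
      (D.episodeSigma_le_past i.lt_succ_self)))
    (iSup₂_le fun j _ => (D.comap_T_le_episodeSigma i j).trans
      (D.episodeSigma_le_past i.lt_succ_self))

lemma hist_le (i : ℕ) (s : Fin (l + 1)) : D.hist i s ≤ m₀ :=
  (D.hist_le_past_succ i s).trans (D.past_le _)

lemma hist_mono (i : ℕ) {s s' : Fin (l + 1)} (h : s ≤ s') : D.hist i s ≤ D.hist i s' :=
  sup_le (sup_le (D.past_le_hist i s')
    (iSup₂_le fun _ hj => D.comap_X_le_hist i (hj.trans h)))
    (iSup₂_le fun _ hj => D.comap_T_le_hist i (hj.trans_le h))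

lemma hist_zero (i : ℕ) : D.hist i 0 = D.past i := by
  refine le_antisymm (sup_le (sup_le le_rfl ?_) ?_) (D.past_le_hist i 0)
  · exact iSup₂_le fun j hj => absurd (lt_of_lt_of_le (Fin.succ_pos j) hj) (lt_irrefl _)
  · exact iSup₂_le fun j hj => absurd (hj.trans (Fin.succ_pos j)) (lt_irrefl _)

lemma histT_le_hist (i : ℕ) {j : Fin l} {s : Fin (l + 1)} (h : j.succ < s) :
    D.histT i j ≤ D.hist i s :=
  sup_le (D.hist_mono i h.le) (D.comap_T_le_hist i h)

lemma histT_le_past_succ (i : ℕ) (j : Fin l) : D.histT i j ≤ D.past (i + 1) :=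
  sup_le (D.hist_le_past_succ i _)
    ((D.comap_T_le_episodeSigma i j).trans (D.episodeSigma_le_past i.lt_succ_self))

/-- The information with respect to which the features of a coordinate are determined: the past
episodes for the intercept, and the history up to and including the treatment of stage `j` for a
coordinate of the block `j`. -/
@[reducible] def featSigma (i : ℕ) : Idx l d → MeasurableSpace Ω
  | none => D.hist i 0
  | some (j, _) => D.histT i j

lemma hist_le_featSigma (i : ℕ) (b : Idx l d) : D.hist i (stage b) ≤ D.featSigma i b := by
  rcases b with _ | ⟨j, k⟩
  · exact le_rfl
  · exact le_sup_left

lemma featSigma_le_past_succ (i : ℕ) (b : Idx l d) : D.featSigma i b ≤ D.past (i + 1) := by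
  rcases b with _ | ⟨j, k⟩
  · exact D.hist_le_past_succ i 0
  · exact D.histT_le_past_succ i j

lemma featSigma_le (i : ℕ) (b : Idx l d) : D.featSigma i b ≤ m₀ :=
  (D.featSigma_le_past_succ i b).trans (D.past_le _)

lemma featSigma_le_hist (i : ℕ) {b : Idx l d} {s : Fin (l + 1)} (h : stage b < s) :
    D.featSigma i b ≤ D.hist i s := by
  rcases b with _ | ⟨j, k⟩
  · exact D.hist_mono i (Fin.zero_le s)
  · exact D.histT_le_hist i h

lemma featSigma_congr (i : ℕ) {b b' : Idx l d} (h : stage b = stage b') :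
    D.featSigma i b = D.featSigma i b' := by
  rcases b with _ | ⟨j, k⟩ <;> rcases b' with _ | ⟨j', k'⟩
  · rfl
  · exact absurd h (Fin.succ_ne_zero j').symm
  · exact absurd h (Fin.succ_ne_zero j)
  · obtain rfl : j = j' := Fin.succ_injective _ h
    rfl

variable [Zero 𝒯] (φ : FeatureMap l d 𝒳 𝒯) (μ : Measure Ω)

lemma measurable_outcomeThru (i : ℕ) (j : Fin l) : Measurable (D.outcomeThru i j) := by
  refine D.measurable_Y_comp i (measurable_pi_lambda _ fun k => ?_)
  by_cases h : k ≤ j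
  · simpa [h] using D.measurable_T i k
  · simp [h]

lemma measurable_feat (i : ℕ) (b : Idx l d) : Measurable[D.featSigma i b] (D.feat φ i b) := by
  rcases b with _ | ⟨j, k⟩
  · exact measurable_const
  · have hX : Measurable[D.histT i j] fun ω => fun m => D.X i (Fin.castLE j.isLt m) ω := by
      refine @measurable_pi_lambda _ _ _ (D.histT i j) _ _ fun m => ?_
      rw [measurable_iff_comap_le]
      refine (D.comap_X_le_hist i ?_).trans le_sup_left
      rw [Fin.le_def]
      simp only [Fin.val_succ, Fin.val_castLE]
      omega
    have hT : Measurable[D.histT i j] fun ω => fun m => D.T i (Fin.castLE j.isLt m) ω := by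
      refine @measurable_pi_lambda _ _ _ (D.histT i j) _ _ fun m => ?_
      rw [measurable_iff_comap_le]
      rcases Nat.lt_succ_iff_lt_or_eq.mp m.isLt with h | h
      · refine (D.comap_T_le_hist i ?_).trans le_sup_left
        rw [Fin.lt_def]
        simp only [Fin.val_succ, Fin.val_castLE]
        omega
      · have : Fin.castLE j.isLt m = j := Fin.ext h
        rw [this]
        exact le_sup_right
    have h := (φ.measurable_toFun j).comp (Measurable.prodMk (m := D.histT i j) hX hT)
    exact (measurable_pi_apply k).comp h

lemma stronglyMeasurable_feat (i : ℕ) (b : Idx l d) :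
    StronglyMeasurable[D.featSigma i b] (D.feat φ i b) :=
  (D.measurable_feat φ i b).stronglyMeasurable

lemma stronglyMeasurable_featMean (i : ℕ) (b : Idx l d) :
    StronglyMeasurable[D.hist i (stage b)] (D.featMean φ μ i b) := by
  rcases b with _ | ⟨j, k⟩
  · exact stronglyMeasurable_zero
  · exact stronglyMeasurable_condExp

lemma stronglyMeasurable_resid (i : ℕ) (s : Fin (l + 1)) (ϑ : Idx l d → ℝ) :
    StronglyMeasurable[D.past (i + 1)] (D.resid φ i s ϑ) := by
  have h1 : StronglyMeasurable[D.past (i + 1)] (D.outcome i) := by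
    have : Measurable[D.past (i + 1)] (D.outcome i) := by
      rw [measurable_iff_comap_le]
      exact le_sup_right.trans (D.episodeSigma_le_past i.lt_succ_self)
    exact this.stronglyMeasurable
  refine h1.sub (Finset.stronglyMeasurable_fun_sum _ fun b _ => ?_)
  by_cases h : s ≤ stage b
  · simpa [h] using ((D.stronglyMeasurable_feat φ i b).mono
      (D.featSigma_le_past_succ i b)).const_mul (ϑ b)
  · simpa [h] using stronglyMeasurable_const

lemma stronglyMeasurable_weight {fhat : ℕ → Fin (l + 1) → Ω → ℝ}
    (hf : ∀ i s, StronglyMeasurable[D.hist i s] (fhat i s)) (i : ℕ) (b b' : Idx l d) :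
    StronglyMeasurable[D.hist i (stage b)] fun ω => D.weight φ μ fhat i ω b b' := by
  rcases b with _ | ⟨j, k⟩ <;> rcases b' with _ | ⟨j', k'⟩
  · simp only [weight, Matrix.of_apply]
    exact ((hf i 0).measurable.pow_const _).stronglyMeasurable
  · simpa [weight] using stronglyMeasurable_const
  · simpa [weight] using stronglyMeasurable_const
  · simp only [weight, Matrix.of_apply]
    split_ifs
    · have hC : Measurable[D.hist i j.succ]
          fun ω => (fun k k' => D.condCov φ μ i j ω k k' : Fin d → Fin d → ℝ) := by
        refine @measurable_pi_lambda _ _ _ (D.hist i j.succ) _ _ fun k => ?_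
        refine @measurable_pi_lambda _ _ _ (D.hist i j.succ) _ _ fun k' => ?_
        exact stronglyMeasurable_condExp.measurable
      have hS : Measurable[D.hist i j.succ] fun ω => invSqrt (D.condCov φ μ i j ω) k k' :=
        (measurable_pi_apply k').comp ((measurable_pi_apply k).comp (measurable_invSqrt.comp hC))
      exact (((hf i j.succ).measurable.pow_const _).mul hS).stronglyMeasurable
    · exact stronglyMeasurable_zero

/-- The weighted centred features `u_i = Ĥ_i (φ_i - q_i)`. -/
noncomputable def wfeat (fhat : ℕ → Fin (l + 1) → Ω → ℝ) (i : ℕ) (b : Idx l d) (ω : Ω) : ℝ :=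
  ∑ b', D.weight φ μ fhat i ω b b' * (D.feat φ i b' ω - D.featMean φ μ i b' ω)

lemma weight_of_stage_ne (fhat : ℕ → Fin (l + 1) → Ω → ℝ) (i : ℕ) (ω : Ω) {b b' : Idx l d}
    (h : stage b ≠ stage b') : D.weight φ μ fhat i ω b b' = 0 := by
  rcases b with _ | ⟨j, k⟩ <;> rcases b' with _ | ⟨j', k'⟩
  · exact absurd rfl h
  · rfl
  · rfl
  · simp only [weight, Matrix.of_apply]
    rw [if_neg]
    rintro rfl
    exact h rfl

lemma wfeat_none (fhat : ℕ → Fin (l + 1) → Ω → ℝ) (i : ℕ) (ω : Ω) :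
    D.wfeat φ μ fhat i none ω = fhat i 0 ω ^ (-(1 / 2) : ℝ) := by
  rw [wfeat, Fintype.sum_option]
  simp [weight, feat, featMean]

lemma wfeat_some (fhat : ℕ → Fin (l + 1) → Ω → ℝ) (i : ℕ) (j : Fin l) (k : Fin d) (ω : Ω) :
    D.wfeat φ μ fhat i (some (j, k)) ω = ∑ m, (fhat i j.succ ω ^ (-(1 / 2) : ℝ) *
      invSqrt (D.condCov φ μ i j ω) k m) *
        (D.feat φ i (some (j, m)) ω - D.featMean φ μ i (some (j, m)) ω) := by
  rw [wfeat, Fintype.sum_option, Fintype.sum_prod_type]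
  simp only [weight, Matrix.of_apply, zero_mul, zero_add]
  rw [Finset.sum_eq_single j]
  · simp
  · intro j' _ hj'
    simp [Ne.symm hj']
  · simp

lemma weight_mulVec_momentVec (fhat : ℕ → Fin (l + 1) → Ω → ℝ) (ϑ : Idx l d → ℝ) (i : ℕ) (ω : Ω)
    (b : Idx l d) : (D.weight φ μ fhat i ω *ᵥ D.momentVec φ μ i ϑ ω) b =
      D.resid φ i (stage b) ϑ ω * D.wfeat φ μ fhat i b ω := by
  simp only [mulVec, dotProduct, momentVec, wfeat, Finset.mul_sum]
  refine Finset.sum_congr rfl fun b' _ => ?_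
  by_cases h : stage b = stage b'
  · rw [h]; ring
  · rw [D.weight_of_stage_ne φ μ fhat i ω h]; ring

lemma weight_mul_jacobian (fhat : ℕ → Fin (l + 1) → Ω → ℝ) (i : ℕ) (ω : Ω) (b b' : Idx l d) :
    (D.weight φ μ fhat i ω * D.jacobian φ μ i ω) b b' =
      if stage b ≤ stage b' then -(D.wfeat φ μ fhat i b ω * D.feat φ i b' ω) else 0 := by
  have h : ∀ b'', D.weight φ μ fhat i ω b b'' * D.jacobian φ μ i ω b'' b' =
      if stage b ≤ stage b' then -(D.weight φ μ fhat i ω b b'' *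
        (D.feat φ i b'' ω - D.featMean φ μ i b'' ω) * D.feat φ i b' ω) else 0 := by
    intro b''
    by_cases h : stage b = stage b''
    · rw [h]
      simp only [jacobian, Matrix.of_apply]
      split_ifs <;> ring
    · rw [D.weight_of_stage_ne φ μ fhat i ω h]; simp
  rw [Matrix.mul_apply]
  simp only [h]
  split_ifs
  · rw [wfeat, Finset.sum_mul, Finset.sum_neg_distrib]
  · simp

lemma stronglyMeasurable_wfeat {fhat : ℕ → Fin (l + 1) → Ω → ℝ}
    (hf : ∀ i s, StronglyMeasurable[D.hist i s] (fhat i s)) (i : ℕ) (b : Idx l d) :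
    StronglyMeasurable[D.featSigma i b] (D.wfeat φ μ fhat i b) := by
  refine Finset.stronglyMeasurable_fun_sum _ fun b' _ => ?_
  by_cases h : stage b = stage b'
  · have hb : D.featSigma i b' = D.featSigma i b := (D.featSigma_congr i h).symm
    have h1 := D.stronglyMeasurable_feat φ i b'
    have h2 := (D.stronglyMeasurable_featMean φ μ i b').mono (D.hist_le_featSigma i b')
    rw [hb] at h1 h2
    exact ((D.stronglyMeasurable_weight φ μ hf i b b').mono (D.hist_le_featSigma i b)).mul
      (h1.sub h2)
  · simp only [D.weight_of_stage_ne φ μ fhat i _ h, zero_mul]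
    exact stronglyMeasurable_zero

end Measurability

end Episodes

/-! ### Pull-out properties of conditional expectations -/

section BddCondExpSum

variable {Ω : Type*} {m m' m₀ : MeasurableSpace Ω} {μ : Measure Ω} [IsProbabilityMeasure μ]

/-- Pull-out property for finite linear combinations with bounded random coefficients. -/
lemma condExp_sum_mul_of_bdd {ι : Type*} [Fintype ι] (hm : m ≤ m₀) {W g : ι → Ω → ℝ}
    (hW : ∀ k, StronglyMeasurable[m] (W k)) (hWb : ∀ k, AEBdd μ (W k))
    (hg : ∀ k, StronglyMeasurable[m₀] (g k)) (hgb : ∀ k, AEBdd μ (g k)) :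
    μ[fun ω => ∑ k, W k ω * g k ω | m] =ᵐ[μ] fun ω => ∑ k, W k ω * (μ[g k | m]) ω := by
  have hi : ∀ k, Integrable (fun ω => W k ω * g k ω) μ := fun k =>
    ((hWb k).mul (hgb k)).integrable
      (((hW k).mono hm).aestronglyMeasurable.mul (hg k).aestronglyMeasurable)
  have h1 := condExp_finsetSum (μ := μ) (s := Finset.univ) (f := fun k ω => W k ω * g k ω)
    (fun k _ => hi k) m
  have h2 : ∀ k, μ[fun ω => W k ω * g k ω | m] =ᵐ[μ] W k * μ[g k | m] := fun k =>
    condExp_mul_of_stronglyMeasurable_left (hW k) (hi k)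
      ((hgb k).integrable (hg k).aestronglyMeasurable)
  have h3 : (∑ k, fun ω => W k ω * g k ω) = fun ω => ∑ k, W k ω * g k ω := by
    funext ω; simp
  rw [h3] at h1
  filter_upwards [h1, ae_all_iff.mpr h2] with ω h4 h5
  rw [h4, Finset.sum_apply]
  exact Finset.sum_congr rfl fun k _ => by rw [h5 k, Pi.mul_apply]

/-- If `u` has conditional mean zero given `m`, and the conditional expectation of `F` given the
larger σ-algebra `m'` is already `m`-measurable, then `F g u` has conditional mean zero given `m`
for all `m`-measurable `g`. -/
lemma condExp_mul_mul_eq_zero (hmm' : m ≤ m') (hm' : m' ≤ m₀) {F F' g u : Ω → ℝ}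
    (hF : StronglyMeasurable[m₀] F) (hFb : AEBdd μ F) (hF' : StronglyMeasurable[m] F')
    (hFF' : μ[F | m'] =ᵐ[μ] F') (hg : StronglyMeasurable[m] g) (hgb : AEBdd μ g)
    (hu : StronglyMeasurable[m'] u) (hub : AEBdd μ u) (hu0 : μ[u | m] =ᵐ[μ] 0) :
    μ[fun ω => F ω * (g ω * u ω) | m] =ᵐ[μ] 0 := by
  have hF'b : AEBdd μ F' := (hFb.condExp (m := m')).congr hFF'.symm
  refine (condExp_mul_eq_of_condExp_eq hmm' hm' ((hg.mono hmm').mul hu) (hgb.mul hub)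
    (hFb.integrable hF.aestronglyMeasurable) hFF').trans ?_
  have hi : Integrable (fun ω => (F' ω * g ω) * u ω) μ :=
    ((hF'b.mul hgb).mul hub).integrable (((hF'.mono (hmm'.trans hm')).mul
      (hg.mono (hmm'.trans hm'))).mul (hu.mono hm')).aestronglyMeasurable
  have h1 : μ[fun ω => (F' ω * g ω) * u ω | m] =ᵐ[μ] (fun ω => F' ω * g ω) * μ[u | m] :=
    condExp_mul_of_stronglyMeasurable_left (hF'.mul hg) hi
      (hub.integrable (hu.mono hm').aestronglyMeasurable)
  simp only [mul_assoc] at h1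
  filter_upwards [h1, hu0] with ω h2 h3
  refine h2.trans ?_
  rw [Pi.mul_apply, h3]
  simp

end BddCondExpSum

/-! ### Negative square roots of real numbers -/

section InverseSquareRoot

lemma rpow_neg_half_eq {x : ℝ} (hx : 0 ≤ x) : x ^ (-(1 / 2) : ℝ) = (√x)⁻¹ := by
  rw [Real.rpow_neg hx, Real.sqrt_eq_rpow]

lemma rpow_neg_half_mul_self {x : ℝ} (hx : 0 ≤ x) :
    x ^ (-(1 / 2) : ℝ) * x ^ (-(1 / 2) : ℝ) = x⁻¹ := by
  rw [rpow_neg_half_eq hx, ← mul_inv, Real.mul_self_sqrt hx]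

lemma rpow_neg_half_le {σ x : ℝ} (hσ : 0 < σ) (hx : σ ^ 2 ≤ x) :
    x ^ (-(1 / 2) : ℝ) ≤ σ⁻¹ := by
  rw [rpow_neg_half_eq ((sq_nonneg σ).trans hx)]
  exact inv_anti₀ hσ (Real.le_sqrt_of_sq_le hx)

end InverseSquareRoot

namespace Episodes

variable {l d : ℕ} {Ω 𝒳 𝒯 : Type*} [m₀ : MeasurableSpace Ω] [MeasurableSpace 𝒳]
  [MeasurableSpace 𝒯] [Zero 𝒯] (D : Episodes l Ω 𝒳 𝒯) (φ : FeatureMap l d 𝒳 𝒯) (μ : Measure Ω)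

/-! ### Bounds on features, residuals and weights -/

section Bounds

variable {C : ℝ}

lemma abs_feat_le (hφ : ∀ j x τ k, |φ.toFun j x τ k| ≤ C) (i : ℕ) (b : Idx l d) (ω : Ω) :
    |D.feat φ i b ω| ≤ max C 1 := by
  rcases b with _ | ⟨j, k⟩
  · simp [feat]
  · exact (hφ _ _ _ _).trans (le_max_left _ _)

lemma abs_featMean_le (hφ : ∀ j x τ k, |φ.toFun j x τ k| ≤ C) (i : ℕ) (b : Idx l d) :
    ∀ᵐ ω ∂μ, |D.featMean φ μ i b ω| ≤ max C 1 := by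
  have h0 : (0 : ℝ) ≤ max C 1 := zero_le_one.trans (le_max_right _ _)
  rcases b with _ | ⟨j, k⟩
  · simp [featMean]
  · refine ae_bdd_abs_condExp_of_ae_bdd_abs (R := max C 1) ?_
    exact .of_forall fun ω => D.abs_feat_le φ hφ i _ ω

lemma abs_resid_le (hY : ∀ i τ ω, |D.Y i τ ω| ≤ C) (hφ : ∀ j x τ k, |φ.toFun j x τ k| ≤ C)
    (θ : Idx l d → ℝ) (i : ℕ) (s : Fin (l + 1)) (ω : Ω) :
    |D.resid φ i s θ ω| ≤ C + ∑ b, |θ b| * max C 1 := by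
  refine (abs_sub _ _).trans (add_le_add (hY _ _ _) ?_)
  refine (Finset.abs_sum_le_sum_abs _ _).trans (Finset.sum_le_sum fun b _ => ?_)
  have h0 : (0 : ℝ) ≤ max C 1 := zero_le_one.trans (le_max_right _ _)
  split_ifs
  · rw [abs_mul]
    exact mul_le_mul_of_nonneg_left (D.abs_feat_le φ hφ i b ω) (abs_nonneg _)
  · rw [abs_zero]
    exact mul_nonneg (abs_nonneg (θ b)) h0

variable {α c σ : ℝ}

lemma exploration_rate_pos (hc : 0 < c) (i : ℕ) : 0 < c ^ 2 * ((i : ℝ) + 1) ^ (-α) := by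
  positivity

lemma sqrt_exploration_rate (hc : 0 < c) (i : ℕ) :
    √(c ^ 2 * ((i : ℝ) + 1) ^ (-α)) = c * ((i : ℝ) + 1) ^ (-(α / 2)) := by
  rw [Real.sqrt_mul (sq_nonneg c), Real.sqrt_sq hc.le, Real.sqrt_eq_rpow,
    ← Real.rpow_mul (by positivity)]
  ring_nf

lemma abs_weight_coeff_le (hc : 0 < c) (hσ : 0 < σ) (hexpl : D.Exploration φ μ α c)
    {fhat : ℕ → Fin (l + 1) → Ω → ℝ} (hlb : ∀ i s, ∀ᵐ ω ∂μ, σ ^ 2 ≤ fhat i s ω)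
    (i : ℕ) (j : Fin l) : ∀ᵐ ω ∂μ, ∀ k m, |fhat i j.succ ω ^ (-(1 / 2) : ℝ) *
      invSqrt (D.condCov φ μ i j ω) k m| ≤ σ⁻¹ * (c⁻¹ * ((i : ℝ) + 1) ^ (α / 2)) := by
  filter_upwards [hlb i j.succ, hexpl i j] with ω h1 h2 k m
  have h3 := abs_invSqrt_apply_le (exploration_rate_pos hc i) h2 k m
  rw [sqrt_exploration_rate hc, mul_inv, ← Real.rpow_neg (by positivity), neg_neg] at h3
  rw [abs_mul, abs_of_nonneg (Real.rpow_nonneg ((sq_nonneg σ).trans h1) _)]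
  exact mul_le_mul (rpow_neg_half_le hσ h1) h3 (abs_nonneg _) (by positivity)

/-- The weighted features grow at most like `i^{α/2}`. -/
lemma exists_abs_wfeat_le (hα : 0 ≤ α) (hc : 0 < c) (hσ : 0 < σ)
    (hφ : ∀ j x τ k, |φ.toFun j x τ k| ≤ C)
    (hexpl : D.Exploration φ μ α c)
    {fhat : ℕ → Fin (l + 1) → Ω → ℝ} (hlb : ∀ i s, ∀ᵐ ω ∂μ, σ ^ 2 ≤ fhat i s ω) :
    ∃ K : ℝ, ∀ (i : ℕ) (b : Idx l d),
      ∀ᵐ ω ∂μ, |D.wfeat φ μ fhat i b ω| ≤ K * ((i : ℝ) + 1) ^ (α / 2) := by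
  set R := max C 1 with hR
  have hR0 : 0 ≤ R := zero_le_one.trans (le_max_right _ _)
  refine ⟨σ⁻¹ + d * (σ⁻¹ * c⁻¹ * (2 * R)), fun i b => ?_⟩
  have hone : 1 ≤ ((i : ℝ) + 1) ^ (α / 2) :=
    Real.one_le_rpow (by linarith [(Nat.cast_nonneg i : (0 : ℝ) ≤ i)]) (by linarith)
  have hσ0 : 0 ≤ σ⁻¹ := inv_nonneg.mpr hσ.le
  have hP : 0 ≤ d * (σ⁻¹ * c⁻¹ * (2 * R)) := by positivity
  rcases b with _ | ⟨j, k⟩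
  · filter_upwards [hlb i 0] with ω h1
    rw [wfeat_none, abs_of_nonneg (Real.rpow_nonneg ((sq_nonneg σ).trans h1) _)]
    have h2 := rpow_neg_half_le hσ h1
    nlinarith
  · filter_upwards [D.abs_weight_coeff_le φ μ hc hσ hexpl hlb i j,
      ae_all_iff.mpr fun b => D.abs_featMean_le φ μ hφ i b] with ω h1 h2
    rw [wfeat_some]
    refine (Finset.abs_sum_le_sum_abs _ _).trans ?_
    calc _ ≤ ∑ _m : Fin d, σ⁻¹ * (c⁻¹ * ((i : ℝ) + 1) ^ (α / 2)) * (2 * R) := by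
          refine Finset.sum_le_sum fun m _ => ?_
          rw [abs_mul]
          refine mul_le_mul (h1 k m) ?_ (abs_nonneg _) (by positivity)
          refine (abs_sub _ _).trans ?_
          linarith [D.abs_feat_le φ hφ i (some (j, m)) ω, h2 (some (j, m))]
      _ ≤ _ := by
          rw [Finset.sum_const, Finset.card_univ, Fintype.card_fin, nsmul_eq_mul]
          have : 0 ≤ σ⁻¹ * ((i : ℝ) + 1) ^ (α / 2) := by positivity
          nlinarith

end Bounds

/-! ### Conditional moments of the weighted features -/

section Moments

variable [IsProbabilityMeasure μ] {C α c σ : ℝ}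

/-- The weights are determined by the history and can be pulled out of conditional expectations. -/
lemma condExp_wfeat_some_mul (hc : 0 < c) (hσ : 0 < σ) (hφ : ∀ j x τ k, |φ.toFun j x τ k| ≤ C)
    (hexpl : D.Exploration φ μ α c) {fhat : ℕ → Fin (l + 1) → Ω → ℝ}
    (hf : ∀ i s, StronglyMeasurable[D.hist i s] (fhat i s))
    (hlb : ∀ i s, ∀ᵐ ω ∂μ, σ ^ 2 ≤ fhat i s ω) (i : ℕ) (j : Fin l) (k : Fin d) {g : Ω → ℝ}
    (hg : StronglyMeasurable g) (hgb : AEBdd μ g) :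
    μ[fun ω => D.wfeat φ μ fhat i (some (j, k)) ω * g ω | D.hist i j.succ] =ᵐ[μ]
      fun ω => ∑ m, (fhat i j.succ ω ^ (-(1 / 2) : ℝ) * invSqrt (D.condCov φ μ i j ω) k m) *
        (μ[fun ω' => (D.feat φ i (some (j, m)) ω' - D.featMean φ μ i (some (j, m)) ω') * g ω' |
          D.hist i j.succ]) ω := by
  simp only [D.wfeat_some, Finset.sum_mul, mul_assoc]
  have hW : ∀ m, StronglyMeasurable[D.hist i j.succ] fun ω =>
      fhat i j.succ ω ^ (-(1 / 2) : ℝ) * invSqrt (D.condCov φ μ i j ω) k m := by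
    intro m
    have := D.stronglyMeasurable_weight φ μ hf i (some (j, k)) (some (j, m))
    simp only [weight, Matrix.of_apply, if_true] at this
    exact this
  have h := condExp_sum_mul_of_bdd (μ := μ) (D.hist_le i j.succ) (W := fun m ω =>
      fhat i j.succ ω ^ (-(1 / 2) : ℝ) * invSqrt (D.condCov φ μ i j ω) k m)
    (g := fun m ω' => (D.feat φ i (some (j, m)) ω' - D.featMean φ μ i (some (j, m)) ω') * g ω')
    hW (fun m => ⟨_, (D.abs_weight_coeff_le φ μ hc hσ hexpl hlb i j).mono fun ω h => h k m⟩)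
    (fun m => (((D.stronglyMeasurable_feat φ i _).mono (D.featSigma_le i _)).sub
      ((D.stronglyMeasurable_featMean φ μ i _).mono (D.hist_le i _))).mul hg)
    (fun m => ((AEBdd.of_forall (D.abs_feat_le φ hφ i _)).sub
      ⟨_, D.abs_featMean_le φ μ hφ i _⟩).mul hgb)
  simpa only [mul_assoc] using h

lemma condExp_centred_feat (hφ : ∀ j x τ k, |φ.toFun j x τ k| ≤ C) (i : ℕ) (j : Fin l)
    (k : Fin d) : μ[fun ω => D.feat φ i (some (j, k)) ω - D.featMean φ μ i (some (j, k)) ω |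
      D.hist i j.succ] =ᵐ[μ] 0 := by
  have hi : Integrable (D.feat φ i (some (j, k))) μ :=
    (AEBdd.of_forall (D.abs_feat_le φ hφ i _)).integrable
      ((D.stronglyMeasurable_feat φ i _).mono (D.featSigma_le i _)).aestronglyMeasurable
  have h1 : μ[D.feat φ i (some (j, k)) - D.featMean φ μ i (some (j, k)) | D.hist i j.succ] =ᵐ[μ]
      _ := condExp_sub hi integrable_condExp _
  have h2 : μ[μ[D.feat φ i (some (j, k)) | D.hist i j.succ] | D.hist i j.succ] =
      μ[D.feat φ i (some (j, k)) | D.hist i j.succ] :=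
    condExp_of_stronglyMeasurable (D.hist_le i _) stronglyMeasurable_condExp integrable_condExp
  rw [h2] at h1
  refine h1.trans (.of_forall fun ω => ?_)
  simp

lemma condExp_centred_feat_mul_feat (hφ : ∀ j x τ k, |φ.toFun j x τ k| ≤ C) (i : ℕ)
    (j : Fin l) (k k' : Fin d) :
    μ[fun ω => (D.feat φ i (some (j, k)) ω - D.featMean φ μ i (some (j, k)) ω) *
        D.feat φ i (some (j, k')) ω | D.hist i j.succ] =ᵐ[μ]
      fun ω => D.condCov φ μ i j ω k k' := by
  set ψ : Fin d → Ω → ℝ := fun k ω =>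
    D.feat φ i (some (j, k)) ω - D.featMean φ μ i (some (j, k)) ω with hψ
  have hψm : ∀ k, StronglyMeasurable (ψ k) := fun k =>
    ((D.stronglyMeasurable_feat φ i _).mono (D.featSigma_le i _)).sub
      ((D.stronglyMeasurable_featMean φ μ i _).mono (D.hist_le i _))
  have hqb : AEBdd μ (D.featMean φ μ i (some (j, k'))) := ⟨_, D.abs_featMean_le φ μ hφ i _⟩
  have hψb : ∀ k, AEBdd μ (ψ k) := fun k => (AEBdd.of_forall (D.abs_feat_le φ hφ i _)).sub
      ⟨_, D.abs_featMean_le φ μ hφ i _⟩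
  have hqm : StronglyMeasurable[D.hist i j.succ] (D.featMean φ μ i (some (j, k'))) :=
    D.stronglyMeasurable_featMean φ μ i (some (j, k'))
  have i1 : Integrable (fun ω => ψ k ω * ψ k' ω) μ :=
    ((hψb k).mul (hψb k')).integrable ((hψm k).mul (hψm k')).aestronglyMeasurable
  have i2 : Integrable (fun ω => ψ k ω * D.featMean φ μ i (some (j, k')) ω) μ :=
    ((hψb k).mul hqb).integrable ((hψm k).mul (hqm.mono (D.hist_le i _))).aestronglyMeasurable
  have h1 := condExp_add i1 i2 (D.hist i j.succ)
  have h2 : μ[fun ω => ψ k ω * D.featMean φ μ i (some (j, k')) ω | D.hist i j.succ] =ᵐ[μ]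
      μ[ψ k | D.hist i j.succ] * D.featMean φ μ i (some (j, k')) :=
    condExp_mul_of_stronglyMeasurable_right hqm i2 ((hψb k).integrable (hψm k).aestronglyMeasurable)
  have e : (fun ω => ψ k ω * D.feat φ i (some (j, k')) ω) =
      (fun ω => ψ k ω * ψ k' ω) + fun ω => ψ k ω * D.featMean φ μ i (some (j, k')) ω := by
    funext ω
    simp only [hψ, Pi.add_apply]
    ring
  change μ[fun ω => ψ k ω * D.feat φ i (some (j, k')) ω | D.hist i j.succ] =ᵐ[μ] _
  rw [e]
  filter_upwards [h1, h2, D.condExp_centred_feat φ μ hφ i j k] with ω h3 h4 h5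
  rw [h3, Pi.add_apply, h4, Pi.mul_apply, h5]
  simp [condCov, hψ]

/-- The weighted features of the stages `j ≥ 1` are conditionally centred. -/
lemma condExp_wfeat_some (hc : 0 < c) (hσ : 0 < σ) (hφ : ∀ j x τ k, |φ.toFun j x τ k| ≤ C)
    (hexpl : D.Exploration φ μ α c) {fhat : ℕ → Fin (l + 1) → Ω → ℝ}
    (hf : ∀ i s, StronglyMeasurable[D.hist i s] (fhat i s))
    (hlb : ∀ i s, ∀ᵐ ω ∂μ, σ ^ 2 ≤ fhat i s ω) (i : ℕ) (j : Fin l) (k : Fin d) :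
    μ[D.wfeat φ μ fhat i (some (j, k)) | D.hist i j.succ] =ᵐ[μ] 0 := by
  have h := D.condExp_wfeat_some_mul φ μ hc hσ hφ hexpl hf hlb i j k
    (g := fun _ => 1) stronglyMeasurable_const (AEBdd.const 1)
  simp only [mul_one] at h
  filter_upwards [h, ae_all_iff.mpr fun m => D.condExp_centred_feat φ μ hφ i j m] with ω h1 h2
  refine h1.trans ?_
  simp [h2]

/-- The conditional covariance matrix of the weighted features of a stage is `f̂⁻¹` times the
identity matrix. -/
lemma condExp_wfeat_mul_wfeat (hα : 0 ≤ α) (hc : 0 < c) (hσ : 0 < σ)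
    (hφ : ∀ j x τ k, |φ.toFun j x τ k| ≤ C)
    (hexpl : D.Exploration φ μ α c) {fhat : ℕ → Fin (l + 1) → Ω → ℝ}
    (hf : ∀ i s, StronglyMeasurable[D.hist i s] (fhat i s))
    (hlb : ∀ i s, ∀ᵐ ω ∂μ, σ ^ 2 ≤ fhat i s ω) (i : ℕ) {b b' : Idx l d}
    (hbb' : stage b = stage b') :
    μ[fun ω => D.wfeat φ μ fhat i b ω * D.wfeat φ μ fhat i b' ω | D.hist i (stage b)] =ᵐ[μ]
      fun ω => if b = b' then (fhat i (stage b) ω)⁻¹ else 0 := by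
  obtain ⟨K, hK⟩ := D.exists_abs_wfeat_le φ μ hα hc hσ hφ hexpl hlb
  have hub : ∀ b, AEBdd μ (D.wfeat φ μ fhat i b) := fun b => ⟨_, hK i b⟩
  have hum : ∀ b, StronglyMeasurable (D.wfeat φ μ fhat i b) := fun b =>
    (D.stronglyMeasurable_wfeat φ μ hf i b).mono (D.featSigma_le i b)
  rcases b with _ | ⟨j, k⟩ <;> rcases b' with _ | ⟨j', k'⟩
  · have hm : StronglyMeasurable[D.hist i 0] (D.wfeat φ μ fhat i (none : Idx l d)) :=
      D.stronglyMeasurable_wfeat φ μ hf i none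
    have h1 := condExp_of_stronglyMeasurable (μ := μ) (D.hist_le i 0) (hm.mul hm)
      (((hub none).mul (hub none)).integrable ((hum none).mul (hum none)).aestronglyMeasurable)
    refine (Filter.EventuallyEq.of_eq h1).trans ?_
    filter_upwards [hlb i 0] with ω h2
    rw [Pi.mul_apply, wfeat_none, rpow_neg_half_mul_self ((sq_nonneg σ).trans h2)]
    simp [stage]
  · exact absurd hbb' (Fin.succ_ne_zero j').symm
  · exact absurd hbb' (Fin.succ_ne_zero j)
  · obtain rfl : j = j' := Fin.succ_injective _ hbb'
    change μ[_ | D.hist i j.succ] =ᵐ[μ]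
      fun ω => if some (j, k) = some (j, k') then (fhat i j.succ ω)⁻¹ else 0
    set ψ : Fin d → Ω → ℝ := fun k ω =>
      D.feat φ i (some (j, k)) ω - D.featMean φ μ i (some (j, k)) ω with hψ
    have hψm : ∀ k, StronglyMeasurable (ψ k) := fun k =>
      ((D.stronglyMeasurable_feat φ i _).mono (D.featSigma_le i _)).sub
        ((D.stronglyMeasurable_featMean φ μ i _).mono (D.hist_le i _))
    have hψb : ∀ k, AEBdd μ (ψ k) := fun k => (AEBdd.of_forall (D.abs_feat_le φ hφ i _)).sub
      ⟨_, D.abs_featMean_le φ μ hφ i _⟩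
    have h1 := D.condExp_wfeat_some_mul φ μ hc hσ hφ hexpl hf hlb i j k (hum (some (j, k')))
      (hub (some (j, k')))
    have h2 : ∀ m, _ := fun m => D.condExp_wfeat_some_mul φ μ hc hσ hφ hexpl hf hlb i j k'
      (hψm m) (hψb m)
    filter_upwards [h1, ae_all_iff.mpr h2, hlb i j.succ, hexpl i j] with ω h3 h4 h5 h6
    rw [h3]
    set A := D.condCov φ μ i j ω with hA
    have hAd := posDef_of_sub_smul_one_posSemidef (exploration_rate_pos hc i) h6
    have h7 : ∀ m, (μ[fun ω' => (D.feat φ i (some (j, m)) ω' -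
        D.featMean φ μ i (some (j, m)) ω') * D.wfeat φ μ fhat i (some (j, k')) ω' |
          D.hist i j.succ]) ω =
        fhat i j.succ ω ^ (-(1 / 2) : ℝ) * ∑ m', invSqrt A k' m' * A m' m := by
      intro m
      have h8 := h4 m
      simp only [hψ] at h8
      simp only [mul_comm _ (D.wfeat φ μ fhat i (some (j, k')) _)]
      rw [h8, Finset.mul_sum]
      refine Finset.sum_congr rfl fun m' _ => ?_
      rw [mul_assoc]
      rfl
    simp only [h7]
    have h9 : invSqrt A * A * invSqrt A = 1 := by
      have hu : IsUnit A.det := (Matrix.isUnit_iff_isUnit_det A).mp hAd.isUnit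
      refine mul_eq_one_comm.mp ?_
      rw [← Matrix.mul_assoc, invSqrt_mul_invSqrt hAd.posSemidef, Matrix.nonsing_inv_mul A hu]
    have h10 := congr_fun (congr_fun h9 k') k
    rw [Matrix.mul_apply] at h10
    simp only [Matrix.mul_apply] at h10
    calc _ = (fhat i j.succ ω ^ (-(1 / 2) : ℝ) * fhat i j.succ ω ^ (-(1 / 2) : ℝ)) *
          ∑ m, (∑ m', invSqrt A k' m' * A m' m) * invSqrt A m k := by
          rw [Finset.mul_sum]
          refine Finset.sum_congr rfl fun m _ => ?_
          rw [invSqrt_symm A m k]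
          ring
      _ = _ := by
          rw [h10, rpow_neg_half_mul_self ((sq_nonneg σ).trans h5), Matrix.one_apply]
          by_cases hk : k = k'
          · simp [hk]
          · simp [hk, Ne.symm hk]

/-- The diagonal blocks of the conditional expectation of `-Ĥ_i J_i` are
`f̂^{-1/2} Cov(φ)^{1/2}`, and exploration bounds them from below. -/
lemma le_sum_condExp_wfeat_mul_feat (hα : 0 ≤ α) (hc : 0 < c) (hc1 : c < 1) (hσ : 0 < σ)
    (hφ : ∀ j x τ k, |φ.toFun j x τ k| ≤ C)
    (hexpl : D.Exploration φ μ α c) {fhat : ℕ → Fin (l + 1) → Ω → ℝ}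
    (hf : ∀ i s, StronglyMeasurable[D.hist i s] (fhat i s))
    (hlb : ∀ i s, ∀ᵐ ω ∂μ, σ ^ 2 ≤ fhat i s ω) (i : ℕ) (s : Fin (l + 1)) :
    ∀ᵐ ω ∂μ, ∀ x : Idx l d → ℝ, (∀ b, stage b ≠ s → x b = 0) →
      c * ((i : ℝ) + 1) ^ (-(α / 2)) * fhat i s ω ^ (-(1 / 2) : ℝ) * ∑ b, x b ^ 2 ≤
        ∑ b, ∑ b', x b * (μ[fun ω' => D.wfeat φ μ fhat i b ω' * D.feat φ i b' ω' |
          D.hist i (stage b)]) ω * x b' := by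
  have hple : ((i : ℝ) + 1) ^ (-(α / 2)) ≤ 1 :=
    Real.rpow_le_one_of_one_le_of_nonpos (by linarith [(Nat.cast_nonneg i : (0 : ℝ) ≤ i)])
      (by linarith)
  have hp0 : 0 ≤ ((i : ℝ) + 1) ^ (-(α / 2)) := by positivity
  obtain ⟨K, hK⟩ := D.exists_abs_wfeat_le φ μ hα hc hσ hφ hexpl hlb
  induction s using Fin.cases with
  | zero =>
    have hm : StronglyMeasurable[D.hist i 0] (D.wfeat φ μ fhat i (none : Idx l d)) :=
      D.stronglyMeasurable_wfeat φ μ hf i none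
    have h1 := condExp_of_stronglyMeasurable (μ := μ) (D.hist_le i 0) hm
      (AEBdd.integrable ⟨_, hK i none⟩ (hm.mono (D.hist_le i 0)).aestronglyMeasurable)
    filter_upwards [hlb i 0] with ω h2 x hx
    have hx0 : ∀ p, x (some p) = 0 := fun p => hx (some p) (Fin.succ_ne_zero p.1)
    have h3 : (μ[fun ω' => D.wfeat φ μ fhat i none ω' * D.feat φ i none ω' |
        D.hist i (stage (none : Idx l d))]) ω = fhat i 0 ω ^ (-(1 / 2) : ℝ) := by
      simp only [feat, mul_one]
      have := congr_fun h1 ω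
      rw [wfeat_none] at this
      exact this
    simp only [Fintype.sum_option, hx0, h3]
    simp only [ne_eq, OfNat.ofNat_ne_zero, not_false_eq_true, zero_pow, Finset.sum_const_zero,
      add_zero, mul_zero, zero_mul]
    have h4 : 0 ≤ fhat i 0 ω ^ (-(1 / 2) : ℝ) := Real.rpow_nonneg ((sq_nonneg σ).trans h2) _
    have h5 : c * ((i : ℝ) + 1) ^ (-(α / 2)) ≤ 1 := by nlinarith
    have h6 : 0 ≤ fhat i 0 ω ^ (-(1 / 2) : ℝ) * x none ^ 2 := by positivity
    nlinarith
  | succ j =>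
    have h1 : ∀ k k', _ := fun k k' => D.condExp_wfeat_some_mul φ μ hc hσ hφ hexpl hf hlb i j k
      ((D.stronglyMeasurable_feat φ i (some (j, k'))).mono (D.featSigma_le i _))
      (AEBdd.of_forall (D.abs_feat_le φ hφ i _))
    filter_upwards [ae_all_iff.mpr fun k => ae_all_iff.mpr (h1 k), hlb i j.succ, hexpl i j,
      ae_all_iff.mpr fun k => ae_all_iff.mpr (D.condExp_centred_feat_mul_feat φ μ hφ i j k)]
      with ω h2 h3 h4 h5 x hx
    set A := D.condCov φ μ i j ω with hA
    have hx0 : x none = 0 := hx none (Fin.succ_ne_zero j).symm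
    have hx1 : ∀ j', j' ≠ j → ∀ k, x (some (j', k)) = 0 := fun j' hj' k =>
      hx (some (j', k)) fun h => hj' (Fin.succ_injective _ h)
    have hred : ∀ g : Idx l d → ℝ, (∀ b, x b = 0 → g b = 0) →
        ∑ b, g b = ∑ k, g (some (j, k)) := by
      intro g hg
      rw [Fintype.sum_option, hg none hx0, zero_add, Fintype.sum_prod_type,
        Finset.sum_eq_single j]
      · intro j' _ hj'
        exact Finset.sum_eq_zero fun k _ => hg _ (hx1 j' hj' k)
      · simp
    have h6 : ∀ k k', (μ[fun ω' => D.wfeat φ μ fhat i (some (j, k)) ω' *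
        D.feat φ i (some (j, k')) ω' | D.hist i (stage (some (j, k) : Idx l d))]) ω =
        fhat i j.succ ω ^ (-(1 / 2) : ℝ) * (invSqrt A * A) k k' := by
      intro k k'
      refine (h2 k k').trans ?_
      rw [Matrix.mul_apply, Finset.mul_sum]
      refine Finset.sum_congr rfl fun m _ => ?_
      rw [h5 m k', mul_assoc]
    rw [hred (fun b => x b ^ 2) (fun b hb => by simp [hb]),
      hred (fun b => ∑ b', x b * _ * x b') (fun b hb => by simp [hb])]
    have h7 : ∀ k, ∑ b', x (some (j, k)) * (μ[fun ω' => D.wfeat φ μ fhat i (some (j, k)) ω' *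
        D.feat φ i b' ω' | D.hist i (stage (some (j, k) : Idx l d))]) ω * x b' =
        ∑ k', x (some (j, k)) * (fhat i j.succ ω ^ (-(1 / 2) : ℝ) * (invSqrt A * A) k k') *
          x (some (j, k')) := by
      intro k
      rw [hred _ (fun b hb => by simp [hb])]
      exact Finset.sum_congr rfl fun k' _ => by rw [h6]
    simp only [h7]
    have h8 := sqrt_mul_dotProduct_le_invSqrt_mul (exploration_rate_pos hc i) h4
      fun k => x (some (j, k))
    rw [sqrt_exploration_rate hc] at h8
    have h9 : 0 ≤ fhat i j.succ ω ^ (-(1 / 2) : ℝ) := Real.rpow_nonneg ((sq_nonneg σ).trans h3) _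
    have h10 := mul_le_mul_of_nonneg_left h8 h9
    simp only [dotProduct, mulVec] at h10
    refine le_of_eq_of_le ?_ (h10.trans_eq ?_)
    · simp only [pow_two]; ring
    · simp only [Finset.mul_sum]
      refine Finset.sum_congr rfl fun k _ => Finset.sum_congr rfl fun k' _ => ?_
      ring

end Moments

/-! ### The weighted scores -/

/-- Coordinates of the weighted score `Ĥ_i m(Z_i; θ)` at the true parameter. -/
noncomputable def score (θ : Idx l d → ℝ) (fhat : ℕ → Fin (l + 1) → Ω → ℝ) (i : ℕ) (b : Idx l d)
    (ω : Ω) : ℝ :=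
  D.resid φ i (stage b) θ ω * D.wfeat φ μ fhat i b ω

lemma stronglyMeasurable_score (θ : Idx l d → ℝ) {fhat : ℕ → Fin (l + 1) → Ω → ℝ}
    (hf : ∀ i s, StronglyMeasurable[D.hist i s] (fhat i s)) (i : ℕ) (b : Idx l d) :
    StronglyMeasurable[D.past (i + 1)] (D.score φ μ θ fhat i b) :=
  (D.stronglyMeasurable_resid φ i _ θ).mul
    ((D.stronglyMeasurable_wfeat φ μ hf i b).mono (D.featSigma_le_past_succ i b))

section Scores

variable {C α c σ : ℝ}

/-- The weighted scores grow at most like `i^{α/2}`. -/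
lemma exists_abs_score_le (hα : 0 ≤ α) (hc : 0 < c) (hσ : 0 < σ)
    (hY : ∀ i τ ω, |D.Y i τ ω| ≤ C) (hφ : ∀ j x τ k, |φ.toFun j x τ k| ≤ C)
    (hexpl : D.Exploration φ μ α c) (θ : Idx l d → ℝ)
    {fhat : ℕ → Fin (l + 1) → Ω → ℝ} (hlb : ∀ i s, ∀ᵐ ω ∂μ, σ ^ 2 ≤ fhat i s ω) :
    ∃ K : ℝ, ∀ (i : ℕ) (b : Idx l d),
      ∀ᵐ ω ∂μ, |D.score φ μ θ fhat i b ω| ≤ K * ((i : ℝ) + 1) ^ (α / 2) := by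
  obtain ⟨K, hK⟩ := D.exists_abs_wfeat_le φ μ hα hc hσ hφ hexpl hlb
  refine ⟨(C + ∑ b, |θ b| * max C 1) * K, fun i b => ?_⟩
  filter_upwards [hK i b] with ω h
  have h1 := D.abs_resid_le φ hY hφ θ i (stage b) ω
  rw [score, abs_mul, mul_assoc]
  exact mul_le_mul h1 h (abs_nonneg _) ((abs_nonneg _).trans h1)

variable [IsProbabilityMeasure μ]

/-! ### Conditional moments of the residuals -/

/-- By residual independence, the treatment of stage `j` does not change conditional expectations
of functions of the residual of stage `j` given the history. -/
lemma condExp_comp_resid_featSigma {θ : Idx l d → ℝ} (hres : D.ResidualIndependence φ μ θ) (i : ℕ)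
    (b : Idx l d) {f : ℝ → ℝ} (hf : Measurable f)
    (hb : AEBdd μ fun ω => f (D.resid φ i (stage b) θ ω)) :
    μ[fun ω => f (D.resid φ i (stage b) θ ω) | D.featSigma i b] =ᵐ[μ]
      μ[fun ω => f (D.resid φ i (stage b) θ ω) | D.hist i (stage b)] := by
  rcases b with _ | ⟨j, k⟩
  · exact Filter.EventuallyEq.rfl
  · have hm : StronglyMeasurable (D.resid φ i j.succ θ) :=
      (D.stronglyMeasurable_resid φ i j.succ θ).mono (D.past_le _)
    refine (hres i j).condExp_sup (D.hist_le i j.succ) hm.measurable.comap_le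
      (D.measurable_T i j).comap_le ?_ hb
    exact (hf.comp (comap_measurable (D.resid φ i j.succ θ))).stronglyMeasurable

/-- The observed outcome differs from the baseline outcome by the sum of the effects of switching
on the treatments of the stages one after the other. -/
lemma outcome_sub_eq_sum (i : ℕ) (ω : Ω) :
    D.outcome i ω - D.Y i 0 ω = ∑ j, (D.outcomeThru i j ω - D.outcomeFrom i j 0 ω) := by
  set g : ℕ → ℝ := fun m => D.Y i (fun k => if (k : ℕ) < m then D.T i k ω else 0) ω with hg
  have h1 : ∀ j : Fin l, D.outcomeThru i j ω - D.outcomeFrom i j 0 ω = g (j + 1) - g j := by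
    intro j
    simp only [hg, outcomeThru, outcomeFrom, Nat.lt_succ_iff, Fin.le_def, Fin.lt_def, Pi.zero_apply]
  have h2 : g l = D.outcome i ω := by simp [hg, outcome]
  have h3 : g 0 = D.Y i 0 ω := by
    simp only [hg, Nat.not_lt_zero, if_false]
    rfl
  simp only [h1]
  rw [← h2, ← h3, Fin.sum_univ_eq_sum_range fun m => g (m + 1) - g m, Finset.sum_range_sub]

/-- The residual of the intercept is conditionally centred: the blips telescope to the difference
of the observed and the baseline outcome. -/
lemma condExp_resid_zero {θ : Idx l d → ℝ} (hbase : D.IsBaselineMean μ (θ none))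
    (hblip : D.LinearBlip φ μ θ) (hY : ∀ i τ ω, |D.Y i τ ω| ≤ C)
    (hφ : ∀ j x τ k, |φ.toFun j x τ k| ≤ C) (i : ℕ) :
    μ[D.resid φ i 0 θ | D.past i] =ᵐ[μ] 0 := by
  set G : Fin l → Ω → ℝ := fun j ω => D.outcomeThru i j ω - D.outcomeFrom i j 0 ω with hG
  set L : Fin l → Ω → ℝ := fun j ω => ∑ k, θ (some (j, k)) * D.feat φ i (some (j, k)) ω with hL
  have hGi : ∀ j, Integrable (G j) μ := fun j =>
    ((AEBdd.of_forall (C := C) fun ω => hY i _ ω).sub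
      (AEBdd.of_forall (C := C) fun ω => hY i _ ω)).integrable
      ((D.measurable_outcomeThru i j).sub (D.measurable_outcomeFrom i j 0)).aestronglyMeasurable
  have hLi : ∀ j, Integrable (L j) μ := fun j =>
    integrable_finsetSum _ fun k _ => ((AEBdd.of_forall (D.abs_feat_le φ hφ i _)).integrable
      ((D.stronglyMeasurable_feat φ i _).mono
        (D.featSigma_le i _)).aestronglyMeasurable).const_mul _
  have hYi : Integrable (D.Y i 0) μ := by
    refine (AEBdd.of_forall (C := C) fun ω => hY i _ ω).integrable ?_
    exact (D.measurable_Y_comp i (τ := fun _ => 0) measurable_const).aestronglyMeasurable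
  have h0 : ∀ j, μ[fun ω => G j ω - L j ω | D.past i] =ᵐ[μ] 0 := by
    intro j
    have h1 : μ[G j | D.histT i j] =ᵐ[μ] L j := hblip i j
    have hle : D.past i ≤ D.histT i j := (D.past_le_hist i j.succ).trans le_sup_left
    have h2 : μ[μ[G j | D.histT i j] | D.past i] =ᵐ[μ] μ[G j | D.past i] :=
      condExp_condExp_of_le hle ((D.histT_le_past_succ i j).trans (D.past_le _))
    have h3 : μ[μ[G j | D.histT i j] | D.past i] =ᵐ[μ] μ[L j | D.past i] := condExp_congr_ae h1
    have h4 : μ[fun ω => G j ω - L j ω | D.past i] =ᵐ[μ] _ :=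
      condExp_sub (hGi j) (hLi j) (D.past i)
    filter_upwards [h2, h3, h4] with ω h5 h6 h7
    rw [h7, Pi.sub_apply, ← h5, h6, sub_self]
    rfl
  have e : D.resid φ i 0 θ = (D.Y i 0 - fun _ => θ none) + ∑ j, fun ω => G j ω - L j ω := by
    funext ω
    simp only [resid, Fin.zero_le, if_true, Fintype.sum_option, Fintype.sum_prod_type,
      Pi.add_apply, Pi.sub_apply, Finset.sum_apply, Finset.sum_sub_distrib, hL, feat, mul_one]
    have := D.outcome_sub_eq_sum i ω
    rw [← this]
    ring
  rw [e]
  have h5 := condExp_add (hYi.sub (integrable_const (θ none)))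
    (integrable_finsetSum' Finset.univ fun j _ => (hGi j).sub (hLi j)) (D.past i)
  have h6 := condExp_sub hYi (integrable_const (θ none)) (D.past i)
  have h7 := condExp_finsetSum (μ := μ) (s := Finset.univ) (f := fun j ω => G j ω - L j ω)
    (fun j _ => (hGi j).sub (hLi j)) (D.past i)
  rw [condExp_const (D.past_le i)] at h6
  filter_upwards [h5, h6, h7, hbase i, ae_all_iff.mpr h0] with ω h8 h9 h10 h11 h12
  refine h8.trans ?_
  rw [Pi.add_apply, h9, Pi.sub_apply, h11]
  refine (congr_arg _ h10).trans ?_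
  rw [Finset.sum_apply, Finset.sum_eq_zero fun j _ => h12 j]
  simp

/-! ### The weighted scores are martingale differences -/

/-- For a stage `j ≥ 1` the score has conditional mean zero already given the history of the stage:
the conditional mean of the residual given the treatment does not depend on the treatment, and the
weighted features are conditionally centred. -/
lemma condExp_score (hα : 0 ≤ α) (hc : 0 < c) (hσ : 0 < σ)
    {θ : Idx l d → ℝ} (hbase : D.IsBaselineMean μ (θ none))
    (hblip : D.LinearBlip φ μ θ) (hres : D.ResidualIndependence φ μ θ)
    (hY : ∀ i τ ω, |D.Y i τ ω| ≤ C) (hφ : ∀ j x τ k, |φ.toFun j x τ k| ≤ C)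
    (hexpl : D.Exploration φ μ α c) {fhat : ℕ → Fin (l + 1) → Ω → ℝ}
    (hf : ∀ i s, StronglyMeasurable[D.hist i s] (fhat i s))
    (hlb : ∀ i s, ∀ᵐ ω ∂μ, σ ^ 2 ≤ fhat i s ω) (i : ℕ) (b : Idx l d) :
    μ[D.score φ μ θ fhat i b | D.past i] =ᵐ[μ] 0 := by
  obtain ⟨K, hK⟩ := D.exists_abs_wfeat_le φ μ hα hc hσ hφ hexpl hlb
  have hub : AEBdd μ (D.wfeat φ μ fhat i b) := ⟨_, hK i b⟩
  have hrb : ∀ s, AEBdd μ (D.resid φ i s θ) := fun s =>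
    AEBdd.of_forall (D.abs_resid_le φ hY hφ θ i s)
  have hrm : ∀ s, StronglyMeasurable (D.resid φ i s θ) := fun s =>
    (D.stronglyMeasurable_resid φ i s θ).mono (D.past_le _)
  rcases b with _ | ⟨j, k⟩
  · have hm : StronglyMeasurable[D.past i] (D.wfeat φ μ fhat i (none : Idx l d)) := by
      rw [← D.hist_zero i]
      exact D.stronglyMeasurable_wfeat φ μ hf i none
    have h1 : μ[D.score φ μ θ fhat i none | D.past i] =ᵐ[μ]
        μ[D.resid φ i 0 θ | D.past i] * D.wfeat φ μ fhat i none :=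
      condExp_mul_of_stronglyMeasurable_right hm (((hrb 0).mul hub).integrable
        ((hrm 0).mul (hm.mono (D.past_le i))).aestronglyMeasurable)
        ((hrb 0).integrable (hrm 0).aestronglyMeasurable)
    filter_upwards [h1, D.condExp_resid_zero φ μ hbase hblip hY hφ i] with ω h2 h3
    rw [h2, Pi.mul_apply, h3]
    simp
  · have h1 := condExp_mul_mul_eq_zero (μ := μ) (D.hist_le_featSigma i (some (j, k)))
      (D.featSigma_le i (some (j, k))) (hrm j.succ) (hrb j.succ) stronglyMeasurable_condExp
      (D.condExp_comp_resid_featSigma φ μ hres i (some (j, k)) measurable_id (hrb j.succ))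
      (stronglyMeasurable_const (b := (1 : ℝ))) (AEBdd.const 1)
      (D.stronglyMeasurable_wfeat φ μ hf i (some (j, k))) hub
      (D.condExp_wfeat_some φ μ hc hσ hφ hexpl hf hlb i j k)
    simp only [one_mul] at h1
    have h2 : μ[μ[D.score φ μ θ fhat i (some (j, k)) | D.hist i j.succ] | D.past i] =ᵐ[μ]
        μ[D.score φ μ θ fhat i (some (j, k)) | D.past i] :=
      condExp_condExp_of_le (D.past_le_hist i j.succ) (D.hist_le i j.succ)
    refine h2.symm.trans ((condExp_congr_ae h1).trans ?_)
    rw [condExp_zero]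

/-- Scores of different stages are conditionally uncorrelated: the residual of the earlier stage
differs from the one of the later stage by a variable which is determined by the history of the
later stage. -/
lemma condExp_score_mul_score_of_stage_lt (hα : 0 ≤ α) (hc : 0 < c) (hσ : 0 < σ)
    {θ : Idx l d → ℝ} (hres : D.ResidualIndependence φ μ θ)
    (hY : ∀ i τ ω, |D.Y i τ ω| ≤ C) (hφ : ∀ j x τ k, |φ.toFun j x τ k| ≤ C)
    (hexpl : D.Exploration φ μ α c) {fhat : ℕ → Fin (l + 1) → Ω → ℝ}
    (hf : ∀ i s, StronglyMeasurable[D.hist i s] (fhat i s))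
    (hlb : ∀ i s, ∀ᵐ ω ∂μ, σ ^ 2 ≤ fhat i s ω) (i : ℕ) {b b' : Idx l d}
    (hbb' : stage b < stage b') :
    μ[fun ω => D.score φ μ θ fhat i b ω * D.score φ μ θ fhat i b' ω | D.past i] =ᵐ[μ] 0 := by
  rcases b' with _ | ⟨j, k⟩
  · exact absurd hbb' (Fin.not_lt_zero _)
  obtain ⟨K, hK⟩ := D.exists_abs_wfeat_le φ μ hα hc hσ hφ hexpl hlb
  have hub : ∀ b, AEBdd μ (D.wfeat φ μ fhat i b) := fun b => ⟨_, hK i b⟩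
  have hum : ∀ b, StronglyMeasurable[D.featSigma i b] (D.wfeat φ μ fhat i b) := fun b =>
    D.stronglyMeasurable_wfeat φ μ hf i b
  have hrb : ∀ s, AEBdd μ (D.resid φ i s θ) := fun s =>
    AEBdd.of_forall (D.abs_resid_le φ hY hφ θ i s)
  have hrm : ∀ s, StronglyMeasurable (D.resid φ i s θ) := fun s =>
    (D.stronglyMeasurable_resid φ i s θ).mono (D.past_le _)
  -- The difference of the residuals of the two stages.
  set w : Ω → ℝ := fun ω => ∑ b'' : Idx l d, (if stage b ≤ stage b'' ∧ stage b'' < j.succ then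
    -(θ b'' * D.feat φ i b'' ω) else 0) with hw
  have hwm : StronglyMeasurable[D.hist i j.succ] w := by
    refine Finset.stronglyMeasurable_fun_sum _ fun b'' _ => ?_
    by_cases h : stage b ≤ stage b'' ∧ stage b'' < j.succ
    · simp only [h, and_self, if_true]
      exact (((D.stronglyMeasurable_feat φ i b'').mono (D.featSigma_le_hist i h.2)).const_mul
        (θ b'')).neg
    · simp only [h, if_false]
      exact stronglyMeasurable_const
  have hwr : ∀ ω, D.resid φ i (stage b) θ ω = D.resid φ i j.succ θ ω + w ω := by
    intro ω
    simp only [resid, hw, sub_add, ← Finset.sum_sub_distrib]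
    congr 1
    refine Finset.sum_congr rfl fun b'' _ => ?_
    have hbj : stage b < j.succ := hbb'
    by_cases h1 : j.succ ≤ stage b''
    · have h2 : stage b ≤ stage b'' := hbj.le.trans h1
      simp [h1, h2, not_lt.mpr h1]
    · by_cases h2 : stage b ≤ stage b'' <;> simp [h1, h2, not_le.mp h1]
  have hwb : AEBdd μ w := ((hrb (stage b)).sub (hrb j.succ)).congr
    (.of_forall fun ω => by simp only [hwr ω]; ring)
  have hubm : StronglyMeasurable[D.hist i j.succ] (D.wfeat φ μ fhat i b) :=
    (hum b).mono (D.featSigma_le_hist i hbb')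
  have hu0 := D.condExp_wfeat_some φ μ hc hσ hφ hexpl hf hlb i j k
  have h1 := condExp_mul_mul_eq_zero (μ := μ) (D.hist_le_featSigma i (some (j, k)))
    (D.featSigma_le i (some (j, k))) (hrm j.succ) (hrb j.succ) stronglyMeasurable_condExp
    (D.condExp_comp_resid_featSigma φ μ hres i (some (j, k)) measurable_id (hrb j.succ))
    (hwm.mul hubm) (hwb.mul (hub b)) (hum (some (j, k))) (hub (some (j, k))) hu0
  have h2 := condExp_mul_mul_eq_zero (μ := μ) (D.hist_le_featSigma i (some (j, k)))
    (D.featSigma_le i (some (j, k))) ((hrm j.succ).pow 2) (hrb j.succ).sq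
    stronglyMeasurable_condExp
    (D.condExp_comp_resid_featSigma φ μ hres i (some (j, k)) (measurable_id.pow_const 2)
      (hrb j.succ).sq)
    hubm (hub b) (hum (some (j, k))) (hub (some (j, k))) hu0
  have hum' : ∀ b, StronglyMeasurable (D.wfeat φ μ fhat i b) := fun b =>
    (hum b).mono (D.featSigma_le i b)
  have hwm' := hwm.mono (D.hist_le i j.succ)
  have i1 : Integrable (fun ω => D.resid φ i j.succ θ ω * ((w * D.wfeat φ μ fhat i b) ω *
      D.wfeat φ μ fhat i (some (j, k)) ω)) μ :=
    ((hrb _).mul ((hwb.mul (hub b)).mul (hub _))).integrable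
      ((hrm _).mul ((hwm'.mul (hum' b)).mul (hum' _))).aestronglyMeasurable
  have i2 : Integrable (fun ω => (D.resid φ i j.succ θ ^ 2) ω * (D.wfeat φ μ fhat i b ω *
      D.wfeat φ μ fhat i (some (j, k)) ω)) μ :=
    ((hrb _).sq.mul ((hub b).mul (hub _))).integrable
      (((hrm _).pow 2).mul ((hum' b).mul (hum' _))).aestronglyMeasurable
  have h3 := condExp_add i1 i2 (D.hist i j.succ)
  have e : (fun ω => D.score φ μ θ fhat i b ω * D.score φ μ θ fhat i (some (j, k)) ω) =
      (fun ω => D.resid φ i j.succ θ ω * ((w * D.wfeat φ μ fhat i b) ω *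
        D.wfeat φ μ fhat i (some (j, k)) ω)) + fun ω => (D.resid φ i j.succ θ ^ 2) ω *
          (D.wfeat φ μ fhat i b ω * D.wfeat φ μ fhat i (some (j, k)) ω) := by
    funext ω
    have hst : stage (some (j, k) : Idx l d) = j.succ := rfl
    simp only [score, hwr ω, Pi.add_apply, Pi.mul_apply, Pi.pow_apply, hst]
    ring
  rw [e]
  refine (condExp_condExp_of_le (D.past_le_hist i j.succ) (D.hist_le i j.succ)).symm.trans ?_
  refine (condExp_congr_ae (g := 0) ?_).trans (by rw [condExp_zero])
  filter_upwards [h1, h2, h3] with ω h4 h5 h6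
  rw [h6, Pi.add_apply]
  refine (congr_arg₂ (· + ·) h4 h5).trans ?_
  simp

/-- The conditional covariance matrix of the weighted score given the past episodes is diagonal
with entries `E_{i-1}[f_{i,j} / f̂_{i,j}]`. -/
theorem condExp_score_mul_score (hα : 0 ≤ α) (hc : 0 < c) (hσ : 0 < σ)
    {θ : Idx l d → ℝ} (hres : D.ResidualIndependence φ μ θ)
    (hY : ∀ i τ ω, |D.Y i τ ω| ≤ C) (hφ : ∀ j x τ k, |φ.toFun j x τ k| ≤ C)
    (hexpl : D.Exploration φ μ α c) {fhat : ℕ → Fin (l + 1) → Ω → ℝ}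
    (hf : ∀ i s, StronglyMeasurable[D.hist i s] (fhat i s))
    (hlb : ∀ i s, ∀ᵐ ω ∂μ, σ ^ 2 ≤ fhat i s ω) (i : ℕ) (b b' : Idx l d) :
    μ[fun ω => D.score φ μ θ fhat i b ω * D.score φ μ θ fhat i b' ω | D.past i] =ᵐ[μ]
      if b = b' then
        μ[fun ω => D.condSqResid φ μ θ i (stage b) ω * (fhat i (stage b) ω)⁻¹ | D.past i]
      else 0 := by
  rcases lt_trichotomy (stage b) (stage b') with h | h | h
  · have hne : b ≠ b' := fun e => by rw [e] at h; exact lt_irrefl _ h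
    rw [if_neg hne]
    exact D.condExp_score_mul_score_of_stage_lt φ μ hα hc hσ hres hY hφ hexpl hf hlb i h
  · obtain ⟨K, hK⟩ := D.exists_abs_wfeat_le φ μ hα hc hσ hφ hexpl hlb
    have hub : ∀ b, AEBdd μ (D.wfeat φ μ fhat i b) := fun b => ⟨_, hK i b⟩
    have hum : ∀ b, StronglyMeasurable (D.wfeat φ μ fhat i b) := fun b =>
      (D.stronglyMeasurable_wfeat φ μ hf i b).mono (D.featSigma_le i b)
    have hrb : ∀ s, AEBdd μ (D.resid φ i s θ) := fun s =>
      AEBdd.of_forall (D.abs_resid_le φ hY hφ θ i s)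
    have hrm : ∀ s, StronglyMeasurable (D.resid φ i s θ) := fun s =>
      (D.stronglyMeasurable_resid φ i s θ).mono (D.past_le _)
    have hb' : StronglyMeasurable[D.featSigma i b] (D.wfeat φ μ fhat i b') := by
      have hm := D.stronglyMeasurable_wfeat φ μ hf i b'
      rwa [← D.featSigma_congr i h] at hm
    have hbm := D.stronglyMeasurable_wfeat φ μ hf i b
    have hfm : StronglyMeasurable[D.hist i (stage b)] (D.condSqResid φ μ θ i (stage b)) :=
      stronglyMeasurable_condExp
    have hfb : AEBdd μ (D.condSqResid φ μ θ i (stage b)) := (hrb (stage b)).sq.condExp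
    have h1 := condExp_mul_eq_of_condExp_eq (μ := μ) (D.hist_le_featSigma i b)
      (D.featSigma_le i b) (hbm.mul hb') ((hub b).mul (hub b'))
      ((hrb (stage b)).sq.integrable ((hrm (stage b)).pow 2).aestronglyMeasurable)
      (D.condExp_comp_resid_featSigma φ μ hres i b (measurable_id.pow_const 2)
        (hrb (stage b)).sq)
    have h2 : μ[fun ω => D.condSqResid φ μ θ i (stage b) ω *
        (D.wfeat φ μ fhat i b ω * D.wfeat φ μ fhat i b' ω) | D.hist i (stage b)] =ᵐ[μ]
        D.condSqResid φ μ θ i (stage b) *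
          μ[fun ω => D.wfeat φ μ fhat i b ω * D.wfeat φ μ fhat i b' ω | D.hist i (stage b)] :=
      condExp_mul_of_stronglyMeasurable_left hfm
        ((hfb.mul ((hub b).mul (hub b'))).integrable ((hfm.mono (D.hist_le i _)).mul
          ((hum b).mul (hum b'))).aestronglyMeasurable)
        (((hub b).mul (hub b')).integrable ((hum b).mul (hum b')).aestronglyMeasurable)
    have h3 := D.condExp_wfeat_mul_wfeat φ μ hα hc hσ hφ hexpl hf hlb i h
    have e : (fun ω => D.score φ μ θ fhat i b ω * D.score φ μ θ fhat i b' ω) =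
        fun ω => D.resid φ i (stage b) θ ω ^ 2 *
          (D.wfeat φ μ fhat i b ω * D.wfeat φ μ fhat i b' ω) := by
      funext ω
      simp only [score, ← h]
      ring
    rw [e]
    refine (condExp_condExp_of_le (D.past_le_hist i (stage b)) (D.hist_le i _)).symm.trans ?_
    have h4 : μ[fun ω => D.resid φ i (stage b) θ ω ^ 2 *
        (D.wfeat φ μ fhat i b ω * D.wfeat φ μ fhat i b' ω) | D.hist i (stage b)] =ᵐ[μ]
        if b = b' then fun ω => D.condSqResid φ μ θ i (stage b) ω * (fhat i (stage b) ω)⁻¹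
        else 0 := by
      refine h1.trans (h2.trans ?_)
      filter_upwards [h3] with ω h5
      rw [Pi.mul_apply, h5]
      by_cases hbb : b = b' <;> simp [hbb]
    refine (condExp_congr_ae h4).trans ?_
    by_cases hbb : b = b'
    · simp only [hbb, if_true]
      exact Filter.EventuallyEq.rfl
    · simp only [hbb, if_false]
      rw [condExp_zero]
  · have hne : b ≠ b' := fun e => by rw [e] at h; exact lt_irrefl _ h
    rw [if_neg hne]
    simp only [mul_comm (D.score φ μ θ fhat i b _)]
    exact D.condExp_score_mul_score_of_stage_lt φ μ hα hc hσ hres hY hφ hexpl hf hlb i h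

end Scores

end Episodes

/-! ### Convergence to zero in probability -/

section TendstoInMeasureZero

variable {Ω : Type*} {m₀ : MeasurableSpace Ω} {μ : Measure Ω}

/-- A sequence dominated by finitely many sequences converging to `0` in probability converges to
`0` in probability. -/
lemma tendstoInMeasure_zero_of_abs_le {ι : Type*} [Fintype ι] {f : ℕ → Ω → ℝ}
    {h : ι → ℕ → Ω → ℝ} (a : ℝ) (h0 : ∀ j, TendstoInMeasure μ (h j) atTop (fun _ => 0))
    (hle : ∀ᶠ n in atTop, ∀ᵐ ω ∂μ, |f n ω| ≤ a * ∑ j, |h j n ω|) :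
    TendstoInMeasure μ f atTop (fun _ => 0) := by
  simp only [tendstoInMeasure_iff_norm, sub_zero, Real.norm_eq_abs] at h0 ⊢
  intro ε hε
  set δ : ℝ := ε / ((|a| + 1) * (Fintype.card ι + 1)) with hδ
  have hδ0 : 0 < δ := by positivity
  have hlim : Tendsto (fun n => ∑ j, μ {ω | δ ≤ |h j n ω|}) atTop (𝓝 0) := by
    simpa using tendsto_finsetSum Finset.univ fun j _ => h0 j δ hδ0
  refine tendsto_of_tendsto_of_tendsto_of_le_of_le' tendsto_const_nhds hlim
    (.of_forall fun _ => zero_le) ?_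
  filter_upwards [hle] with n hn
  refine le_trans (measure_mono_ae ?_) (measure_iUnion_fintype_le μ fun j => {ω | δ ≤ |h j n ω|})
  filter_upwards [hn] with ω h1 h2
  change ω ∈ ⋃ j, {ω | δ ≤ |h j n ω|}
  have h2' : ε ≤ |f n ω| := h2
  by_contra h3
  simp only [Set.mem_iUnion, Set.mem_ofPred_eq, not_exists, not_le] at h3
  have h4 : ∑ j, |h j n ω| ≤ Fintype.card ι * δ := by
    refine (Finset.sum_le_sum fun j _ => (h3 j).le).trans ?_
    simp
  have h5 : 0 ≤ ∑ j, |h j n ω| := Finset.sum_nonneg fun j _ => abs_nonneg _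
  have h6 : a * ∑ j, |h j n ω| ≤ (|a| + 1) * (Fintype.card ι * δ) :=
    mul_le_mul ((le_abs_self a).trans (by linarith)) h4 h5 (by positivity)
  have h7 : ε = (|a| + 1) * ((Fintype.card ι + 1) * δ) := by
    rw [hδ]; field_simp
  have h8 : 0 < (|a| + 1) * δ := by positivity
  nlinarith

lemma tendstoInMeasure_zero_of_sq {f : ℕ → Ω → ℝ}
    (h : TendstoInMeasure μ (fun n ω => f n ω ^ 2) atTop (fun _ => 0)) :
    TendstoInMeasure μ f atTop (fun _ => 0) := by
  simp only [tendstoInMeasure_iff_norm, sub_zero, Real.norm_eq_abs] at h ⊢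
  intro ε hε
  refine tendsto_of_tendsto_of_tendsto_of_le_of_le tendsto_const_nhds (h (ε ^ 2) (by positivity))
    (fun _ => zero_le) fun n => measure_mono fun ω hω => ?_
  simp only [Set.mem_ofPred_eq, abs_pow] at hω ⊢
  gcongr

end TendstoInMeasureZero

namespace Episodes

variable {l d : ℕ} {Ω 𝒳 𝒯 : Type*} [m₀ : MeasurableSpace Ω] [MeasurableSpace 𝒳]
  [MeasurableSpace 𝒯] [Zero 𝒯] (D : Episodes l Ω 𝒳 𝒯) (φ : FeatureMap l d 𝒳 𝒯) (μ : Measure Ω)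

/-- The normalized sum `n^{-1/2} ∑ Ĥ_i m(Z_i; θ)` of the weighted scores. -/
noncomputable def scoreSum (θ : Idx l d → ℝ) (fhat : ℕ → Fin (l + 1) → Ω → ℝ) (n : ℕ) (ω : Ω) :
    EuclideanSpace ℝ (Idx l d) :=
  WithLp.toLp 2 fun b => (√(n : ℝ))⁻¹ * ∑ i ∈ Finset.range n, D.score φ μ θ fhat i b ω

lemma measurable_scoreSum (θ : Idx l d → ℝ) {fhat : ℕ → Fin (l + 1) → Ω → ℝ}
    (hf : ∀ i s, StronglyMeasurable[D.hist i s] (fhat i s)) (n : ℕ) :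
    Measurable (D.scoreSum φ μ θ fhat n) := by
  refine (WithLp.measurable_toLp 2 _).comp (measurable_pi_lambda _ fun b => ?_)
  refine (Finset.measurable_fun_sum _ fun i _ => ?_).const_mul _
  exact ((D.stronglyMeasurable_score φ μ θ hf i b).mono (D.past_le _)).measurable

lemma stronglyMeasurable_condSqResid (θ : Idx l d → ℝ) (i : ℕ) (s : Fin (l + 1)) :
    StronglyMeasurable[D.hist i s] (D.condSqResid φ μ θ i s) := stronglyMeasurable_condExp

lemma condSqResid_nonneg (θ : Idx l d → ℝ) (i : ℕ) (s : Fin (l + 1)) :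
    ∀ᵐ ω ∂μ, 0 ≤ D.condSqResid φ μ θ i s ω :=
  condExp_nonneg (.of_forall fun _ => sq_nonneg _)

variable {C α c σ M : ℝ}

lemma condSqResid_mul_inv_le (hσ : 0 < σ) {θ : Idx l d → ℝ}
    (hM : ∀ i s, ∀ᵐ ω ∂μ, D.condSqResid φ μ θ i s ω ≤ M ^ 2)
    {fhat : ℕ → Fin (l + 1) → Ω → ℝ} (hlb : ∀ i s, ∀ᵐ ω ∂μ, σ ^ 2 ≤ fhat i s ω)
    (i : ℕ) (s : Fin (l + 1)) :
    ∀ᵐ ω ∂μ, 0 ≤ D.condSqResid φ μ θ i s ω * (fhat i s ω)⁻¹ ∧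
      D.condSqResid φ μ θ i s ω * (fhat i s ω)⁻¹ ≤ M ^ 2 * (σ ^ 2)⁻¹ := by
  filter_upwards [hM i s, hlb i s, D.condSqResid_nonneg φ μ θ i s] with ω h1 h2 h3
  have hσ2 : 0 < σ ^ 2 := by positivity
  have h4 : (fhat i s ω)⁻¹ ≤ (σ ^ 2)⁻¹ := inv_anti₀ hσ2 h2
  have h5 : 0 ≤ (fhat i s ω)⁻¹ := inv_nonneg.mpr (hσ2.le.trans h2)
  exact ⟨mul_nonneg h3 h5, mul_le_mul h1 h4 h5 (sq_nonneg M)⟩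

variable [IsProbabilityMeasure μ]

/-! ### Central limit theorem for the weighted scores -/

section ScoreCLT

/-- The conditional second moment of a linear combination of the scores. -/
lemma condExp_sq_sum_score (hα : 0 ≤ α) (hc : 0 < c) (hσ : 0 < σ)
    {θ : Idx l d → ℝ} (hres : D.ResidualIndependence φ μ θ)
    (hY : ∀ i τ ω, |D.Y i τ ω| ≤ C) (hφ : ∀ j x τ k, |φ.toFun j x τ k| ≤ C)
    (hexpl : D.Exploration φ μ α c) {fhat : ℕ → Fin (l + 1) → Ω → ℝ}
    (hf : ∀ i s, StronglyMeasurable[D.hist i s] (fhat i s))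
    (hlb : ∀ i s, ∀ᵐ ω ∂μ, σ ^ 2 ≤ fhat i s ω) (i : ℕ) (a : Idx l d → ℝ) :
    μ[fun ω => (∑ b, a b * D.score φ μ θ fhat i b ω) ^ 2 | D.past i] =ᵐ[μ]
      fun ω => ∑ b, a b ^ 2 * (μ[fun ω' => D.condSqResid φ μ θ i (stage b) ω' *
        (fhat i (stage b) ω')⁻¹ | D.past i]) ω := by
  obtain ⟨K, hK⟩ := D.exists_abs_score_le φ μ hα hc hσ hY hφ hexpl θ hlb
  have hsb : ∀ b, AEBdd μ (D.score φ μ θ fhat i b) := fun b => ⟨_, hK i b⟩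
  have hsm : ∀ b, StronglyMeasurable (D.score φ μ θ fhat i b) := fun b =>
    (D.stronglyMeasurable_score φ μ θ hf i b).mono (D.past_le _)
  have e : (fun ω => (∑ b, a b * D.score φ μ θ fhat i b ω) ^ 2) = fun ω =>
      ∑ p : Idx l d × Idx l d, (a p.1 * a p.2) *
        (D.score φ μ θ fhat i p.1 ω * D.score φ μ θ fhat i p.2 ω) := by
    funext ω
    rw [pow_two, Finset.sum_mul_sum, Fintype.sum_prod_type]
    refine Finset.sum_congr rfl fun b _ => Finset.sum_congr rfl fun b' _ => ?_
    ring
  rw [e]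
  have h1 := condExp_sum_mul_of_bdd (μ := μ) (D.past_le i)
    (W := fun (p : Idx l d × Idx l d) _ => a p.1 * a p.2)
    (g := fun p ω => D.score φ μ θ fhat i p.1 ω * D.score φ μ θ fhat i p.2 ω)
    (fun p => stronglyMeasurable_const) (fun p => AEBdd.const _)
    (fun p => (hsm p.1).mul (hsm p.2)) (fun p => (hsb p.1).mul (hsb p.2))
  refine h1.trans ?_
  filter_upwards [ae_all_iff.mpr fun b => ae_all_iff.mpr fun b' =>
    D.condExp_score_mul_score φ μ hα hc hσ hres hY hφ hexpl hf hlb i b b'] with ω h2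
  rw [Fintype.sum_prod_type]
  refine Finset.sum_congr rfl fun b _ => ?_
  rw [Finset.sum_eq_single b]
  · simp only [h2, if_true]; ring
  · intro b' _ hb'
    simp [h2, Ne.symm hb']
  · simp

/-- The conditional variances of the weighted scores are close to `1` when `f̂` is close to `f`. -/
lemma abs_condExp_ratio_sub_one_le (hσ : 0 < σ) {θ : Idx l d → ℝ}
    (hM : ∀ i s, ∀ᵐ ω ∂μ, D.condSqResid φ μ θ i s ω ≤ M ^ 2)
    {fhat : ℕ → Fin (l + 1) → Ω → ℝ}
    (hf : ∀ i s, StronglyMeasurable[D.hist i s] (fhat i s)) (hint : ∀ i s, Integrable (fhat i s) μ)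
    (hlb : ∀ i s, ∀ᵐ ω ∂μ, σ ^ 2 ≤ fhat i s ω) (i : ℕ) (s : Fin (l + 1)) :
    ∀ᵐ ω ∂μ, |(μ[fun ω' => D.condSqResid φ μ θ i s ω' * (fhat i s ω')⁻¹ | D.past i]) ω - 1| ≤
      (σ ^ 2)⁻¹ * (μ[fun ω' => |D.condSqResid φ μ θ i s ω' - fhat i s ω'| | D.past i]) ω := by
  have hσ2 : 0 < σ ^ 2 := by positivity
  have hi1 : Integrable (fun ω => D.condSqResid φ μ θ i s ω * (fhat i s ω)⁻¹) μ := by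
    refine AEBdd.integrable ⟨M ^ 2 * (σ ^ 2)⁻¹, ?_⟩ (((D.stronglyMeasurable_condSqResid φ μ θ i
      s).mono (D.hist_le i s)).measurable.mul ((hf i s).mono
        (D.hist_le i s)).measurable.inv).aestronglyMeasurable
    filter_upwards [D.condSqResid_mul_inv_le φ μ hσ hM hlb i s] with ω h
    rw [abs_of_nonneg h.1]
    exact h.2
  have hi2 : Integrable (fun ω => |D.condSqResid φ μ θ i s ω - fhat i s ω|) μ :=
    (integrable_condExp.sub (hint i s)).abs
  have h1 := condExp_sub hi1 (integrable_const (1 : ℝ)) (D.past i)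
  rw [condExp_const (D.past_le i)] at h1
  set g : Ω → ℝ := (fun ω => D.condSqResid φ μ θ i s ω * (fhat i s ω)⁻¹) - fun _ => (1 : ℝ)
    with hg
  have hgi : Integrable g μ := hi1.sub (integrable_const _)
  have h2 := abs_condExp_ae_le_condExp_abs (μ := μ) (m := D.past i) g
  have h3 : condExp (D.past i) μ |g| ≤ᵐ[μ]
      μ[(σ ^ 2)⁻¹ • fun ω => |D.condSqResid φ μ θ i s ω - fhat i s ω| | D.past i] := by
    refine condExp_mono hgi.abs (hi2.smul _) ?_
    filter_upwards [hlb i s] with ω h4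
    have h5 : 0 < fhat i s ω := hσ2.trans_le h4
    have h6 : g ω = (D.condSqResid φ μ θ i s ω - fhat i s ω) * (fhat i s ω)⁻¹ := by
      simp only [hg, Pi.sub_apply]
      field_simp
    rw [Pi.abs_apply, h6, abs_mul, abs_of_pos (inv_pos.mpr h5), mul_comm]
    exact mul_le_mul_of_nonneg_right (inv_anti₀ hσ2 h4) (abs_nonneg _)
  have h4 := condExp_smul (μ := μ) (σ ^ 2)⁻¹
    (fun ω => |D.condSqResid φ μ θ i s ω - fhat i s ω|) (D.past i)
  filter_upwards [h1, h2, h3, h4] with ω h5 h6 h7 h8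
  have h9 : |(μ[g | D.past i]) ω| ≤ _ := h6.trans (h7.trans_eq h8)
  rw [h5] at h9
  exact h9

/-- The normalized sum of the weighted scores is asymptotically standard Gaussian. -/
theorem tendstoInDistribution_scoreSum (hα : 0 ≤ α) (hα1 : α < 1) (hc : 0 < c) (hσ : 0 < σ)
    {θ : Idx l d → ℝ} (hbase : D.IsBaselineMean μ (θ none))
    (hblip : D.LinearBlip φ μ θ) (hres : D.ResidualIndependence φ μ θ)
    (hY : ∀ i τ ω, |D.Y i τ ω| ≤ C) (hφ : ∀ j x τ k, |φ.toFun j x τ k| ≤ C)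
    (hexpl : D.Exploration φ μ α c)
    (hM : ∀ i s, ∀ᵐ ω ∂μ, D.condSqResid φ μ θ i s ω ≤ M ^ 2)
    {fhat : ℕ → Fin (l + 1) → Ω → ℝ}
    (hf : ∀ i s, StronglyMeasurable[D.hist i s] (fhat i s)) (hint : ∀ i s, Integrable (fhat i s) μ)
    (hlb : ∀ i s, ∀ᵐ ω ∂μ, σ ^ 2 ≤ fhat i s ω)
    (hcons : ∀ s : Fin (l + 1), TendstoInMeasure μ
      (fun (n : ℕ) ω => (n : ℝ)⁻¹ * ∑ i ∈ Finset.range n,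
        (μ[fun ω' => |D.condSqResid φ μ θ i s ω' - fhat i s ω'| | D.past i]) ω)
      atTop (fun _ => 0)) :
    TendstoInDistribution (D.scoreSum φ μ θ fhat) atTop
      (id : EuclideanSpace ℝ (Idx l d) → EuclideanSpace ℝ (Idx l d))
      (fun _ => μ) (stdGaussian (EuclideanSpace ℝ (Idx l d))) := by
  refine ⟨fun n => (D.measurable_scoreSum φ μ θ hf n).aemeasurable, aemeasurable_id, ?_⟩
  refine ProbabilityMeasure.tendsto_of_tendsto_charFun fun t => ?_
  simp only [ProbabilityMeasure.coe_mk, Measure.map_id, charFun_stdGaussian]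
  set V : ℕ → Idx l d → Ω → ℝ := fun i b =>
    μ[fun ω' => D.condSqResid φ μ θ i (stage b) ω' * (fhat i (stage b) ω')⁻¹ | D.past i] with hV
  -- the summands of the normalized sum in the direction `t`
  set x : ℕ → ℕ → Ω → ℝ := fun n i ω =>
    ∑ b, ((√(n : ℝ))⁻¹ * t b) * D.score φ μ θ fhat i b ω with hx
  obtain ⟨K, hK⟩ := D.exists_abs_score_le φ μ hα hc hσ hY hφ hexpl θ hlb
  have hsb : ∀ i b, AEBdd μ (D.score φ μ θ fhat i b) := fun i b => ⟨_, hK i b⟩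
  have hsm : ∀ i b, StronglyMeasurable (D.score φ μ θ fhat i b) := fun i b =>
    (D.stronglyMeasurable_score φ μ θ hf i b).mono (D.past_le _)
  have hxm : ∀ n i, StronglyMeasurable[D.past (i + 1)] (x n i) := fun n i =>
    Finset.stronglyMeasurable_fun_sum _ fun b _ =>
      (D.stronglyMeasurable_score φ μ θ hf i b).const_mul _
  have hx0 : ∀ n i, μ[x n i | D.past i] =ᵐ[μ] 0 := by
    intro n i
    have h1 := condExp_sum_mul_of_bdd (μ := μ) (D.past_le i)
      (W := fun (b : Idx l d) _ => (√(n : ℝ))⁻¹ * t b) (g := fun b => D.score φ μ θ fhat i b)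
      (fun b => stronglyMeasurable_const) (fun b => AEBdd.const _) (hsm i) (hsb i)
    filter_upwards [h1, ae_all_iff.mpr fun b =>
      D.condExp_score φ μ hα hc hσ hbase hblip hres hY hφ hexpl hf hlb i b] with ω h2 h3
    rw [h2]
    simp [h3]
  have hx2 : ∀ n i, μ[fun ω => x n i ω ^ 2 | D.past i] =ᵐ[μ]
      fun ω => (n : ℝ)⁻¹ * ∑ b, t b ^ 2 * V i b ω := by
    intro n i
    refine (D.condExp_sq_sum_score φ μ hα hc hσ hres hY hφ hexpl hf hlb i _).trans
      (.of_forall fun ω => ?_)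
    simp only [mul_pow, inv_pow, Real.sq_sqrt (Nat.cast_nonneg n), Finset.mul_sum, mul_assoc, hV]
  have hVle : ∀ i b, ∀ᵐ ω ∂μ, V i b ω ≤ M ^ 2 * (σ ^ 2)⁻¹ := fun i b =>
    condExp_le_nonneg_const (by positivity)
      ((D.condSqResid_mul_inv_le φ μ hσ hM hlb i (stage b)).mono fun ω h => h.2)
  set Kε : ℝ := (∑ b, |t b|) * |K| with hKε
  have hlim := tendsto_integral_exp_sum_of_martingale_differences (μ := μ) D.past D.past_mono
    D.past_le x hxm (fun n => Kε * (n : ℝ) ^ (-((1 - α) / 2))) ?_ ?_ (fun n i _ => hx0 n i)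
    ((∑ b, t b ^ 2) * (M ^ 2 * (σ ^ 2)⁻¹)) (∑ b, t b ^ 2) ?_ ?_
  · have hchar : ∀ n, charFun (μ.map (D.scoreSum φ μ θ fhat n)) t =
        ∫ ω, Complex.exp ((∑ i ∈ Finset.range n, x n i ω : ℝ) * Complex.I) ∂μ := by
      intro n
      rw [charFun_apply, integral_map (D.measurable_scoreSum φ μ θ hf n).aemeasurable
        (Measurable.aestronglyMeasurable (by fun_prop))]
      congr 1
      funext ω
      congr 3
      simp only [scoreSum, PiLp.inner_apply, hx, RCLike.inner_apply, conj_trivial]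
      rw [Finset.sum_comm]
      refine Finset.sum_congr rfl fun b _ => ?_
      rw [← Finset.mul_sum]
      ring
    simp only [hchar]
    convert hlim using 2
    have hn : ‖t‖ ^ 2 = ∑ b, t b ^ 2 := by
      rw [EuclideanSpace.norm_sq_eq]
      simp only [Real.norm_eq_abs, sq_abs]
    rw [← hn]
    push_cast
    ring_nf
  · have := (tendsto_rpow_neg_atTop (y := (1 - α) / 2) (by linarith)).comp
      (tendsto_natCast_atTop_atTop (R := ℝ))
    simpa [Function.comp_def] using this.const_mul Kε
  · intro n i hi
    have hn : (0 : ℝ) < n := by exact_mod_cast (Nat.zero_le i).trans_lt hi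
    filter_upwards [ae_all_iff.mpr fun b => hK i b] with ω h1
    have h2 : ((i : ℝ) + 1) ^ (α / 2) ≤ (n : ℝ) ^ (α / 2) := by
      refine Real.rpow_le_rpow (by positivity) ?_ (by linarith)
      exact_mod_cast hi
    have h3 : (√(n : ℝ))⁻¹ * (n : ℝ) ^ (α / 2) = (n : ℝ) ^ (-((1 - α) / 2)) := by
      rw [← rpow_neg_half_eq hn.le, ← Real.rpow_add hn]
      ring_nf
    rw [hKε, Finset.sum_mul, Finset.sum_mul]
    refine (Finset.abs_sum_le_sum_abs _ _).trans (Finset.sum_le_sum fun b _ => ?_)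
    rw [abs_mul, abs_mul, abs_of_nonneg (inv_nonneg.mpr (Real.sqrt_nonneg _)), ← h3]
    have h4 : |D.score φ μ θ fhat i b ω| ≤ |K| * (n : ℝ) ^ (α / 2) :=
      (h1 b).trans (mul_le_mul (le_abs_self K) h2 (by positivity) (abs_nonneg K))
    calc _ ≤ (√(n : ℝ))⁻¹ * |t b| * (|K| * (n : ℝ) ^ (α / 2)) := by gcongr
      _ = _ := by ring
  · intro n
    filter_upwards [ae_all_iff.mpr fun i => hx2 n i,
      ae_all_iff.mpr fun i => ae_all_iff.mpr (hVle i)] with ω h1 h2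
    simp only [h1]
    have h3 : ∀ i, (n : ℝ)⁻¹ * ∑ b, t b ^ 2 * V i b ω ≤
        (n : ℝ)⁻¹ * ((∑ b, t b ^ 2) * (M ^ 2 * (σ ^ 2)⁻¹)) := by
      intro i
      rw [Finset.sum_mul]
      gcongr with b
      exact h2 i b
    refine (Finset.sum_le_sum fun i _ => h3 i).trans ?_
    rw [Finset.sum_const, Finset.card_range, nsmul_eq_mul, ← mul_assoc]
    have h4 : 0 ≤ (∑ b, t b ^ 2) * (M ^ 2 * (σ ^ 2)⁻¹) := by positivity
    have h5 : (n : ℝ) * (n : ℝ)⁻¹ ≤ 1 := mul_inv_le_one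
    exact mul_le_of_le_one_left h4 h5
  · have key := tendstoInMeasure_zero_of_abs_le (μ := μ) (f := fun n ω =>
      ∑ i ∈ Finset.range n, (μ[fun ω' => x n i ω' ^ 2 | D.past i]) ω - ∑ b, t b ^ 2)
      ((∑ b, t b ^ 2) * (σ ^ 2)⁻¹) hcons ?_
    · rw [tendstoInMeasure_iff_norm] at key ⊢
      simpa using key
    · filter_upwards [eventually_gt_atTop 0] with n hn
      have hn' : (n : ℝ) ≠ 0 := by exact_mod_cast hn.ne'
      filter_upwards [ae_all_iff.mpr fun i => hx2 n i, ae_all_iff.mpr fun i => ae_all_iff.mpr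
        fun s => D.abs_condExp_ratio_sub_one_le φ μ hσ hM hf hint hlb i s] with ω h1 h2
      simp only [h1]
      set Δ : Fin (l + 1) → ℝ := fun s => (n : ℝ)⁻¹ * ∑ i ∈ Finset.range n,
        (μ[fun ω' => |D.condSqResid φ μ θ i s ω' - fhat i s ω'| | D.past i]) ω with hΔ
      have e : ∑ i ∈ Finset.range n, (n : ℝ)⁻¹ * ∑ b, t b ^ 2 * V i b ω - ∑ b, t b ^ 2 =
          ∑ b, t b ^ 2 * ((n : ℝ)⁻¹ * ∑ i ∈ Finset.range n, (V i b ω - 1)) := by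
        have e1 : ∀ b, (n : ℝ)⁻¹ * ∑ i ∈ Finset.range n, (V i b ω - 1) =
            (n : ℝ)⁻¹ * ∑ i ∈ Finset.range n, V i b ω - 1 := by
          intro b
          rw [Finset.sum_sub_distrib, mul_sub]
          simp [hn']
        simp only [e1]
        simp only [mul_sub, mul_one, Finset.sum_sub_distrib]
        congr 1
        rw [← Finset.mul_sum, Finset.sum_comm, Finset.mul_sum]
        refine Finset.sum_congr rfl fun b _ => ?_
        rw [← Finset.mul_sum]
        ring
      rw [e]
      have h3 : ∀ b, |(n : ℝ)⁻¹ * ∑ i ∈ Finset.range n, (V i b ω - 1)| ≤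
          (σ ^ 2)⁻¹ * ∑ s, |Δ s| := by
        intro b
        have h4 : |(n : ℝ)⁻¹ * ∑ i ∈ Finset.range n, (V i b ω - 1)| ≤
            (σ ^ 2)⁻¹ * Δ (stage b) := by
          rw [abs_mul, abs_of_nonneg (by positivity : (0 : ℝ) ≤ (n : ℝ)⁻¹), hΔ]
          rw [mul_left_comm]
          refine mul_le_mul_of_nonneg_left ?_ (by positivity)
          rw [Finset.mul_sum]
          exact (Finset.abs_sum_le_sum_abs _ _).trans
            (Finset.sum_le_sum fun i _ => h2 i (stage b))
        refine h4.trans (mul_le_mul_of_nonneg_left ?_ (by positivity))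
        exact (le_abs_self _).trans (Finset.single_le_sum (f := fun s => |Δ s|)
          (fun s _ => abs_nonneg _) (Finset.mem_univ (stage b)))
      refine (Finset.abs_sum_le_sum_abs _ _).trans ?_
      rw [mul_assoc, Finset.sum_mul]
      refine Finset.sum_le_sum fun b _ => ?_
      rw [abs_mul, abs_of_nonneg (sq_nonneg (t b))]
      exact mul_le_mul_of_nonneg_left (h3 b) (sq_nonneg _)

end ScoreCLT

end Episodes

/-! ### Estimates for the diagonal blocks of `B̂_n` -/

/-- An estimate `x` of `f ≤ M²` exceeds `M²` by at most its error, so that `x^{-1/2}` falls short of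
`M⁻¹` by at most a multiple of the error. -/
lemma max_zero_inv_sub_rpow_neg_half_le {M f x : ℝ} (hM : 0 < M) (hf : f ≤ M ^ 2) (hx : 0 < x) :
    max 0 (M⁻¹ - x ^ (-(1 / 2) : ℝ)) ≤ M⁻¹ ^ 3 * |f - x| := by
  refine max_le (by positivity) ?_
  rw [rpow_neg_half_eq hx.le]
  have hs : 0 < √x := Real.sqrt_pos.mpr hx
  have hsx : √x ^ 2 = x := Real.sq_sqrt hx.le
  rcases le_total (√x) M with h | h
  · have h1 : M⁻¹ ≤ (√x)⁻¹ := inv_anti₀ hs h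
    have h2 : 0 ≤ M⁻¹ ^ 3 * |f - x| := by positivity
    linarith
  · have h1 : (√x - M) * (√x + M) ≤ |f - x| := by
      rw [abs_sub_comm]
      refine le_trans ?_ (le_abs_self _)
      nlinarith
    refine le_trans ?_ (mul_le_mul_of_nonneg_left h1 (by positivity))
    have h2 : M⁻¹ - (√x)⁻¹ = (√x - M) * (M⁻¹ * (√x)⁻¹) := by field_simp
    have h3 : M⁻¹ * (√x)⁻¹ ≤ M⁻¹ ^ 3 * (√x + M) := by
      rw [← mul_inv, inv_pow, inv_mul_eq_div, inv_eq_one_div, div_le_div_iff₀ (by positivity)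
        (by positivity)]
      nlinarith [mul_pos hM hs, mul_pos hM hM, mul_self_nonneg (√x), mul_pos hM (mul_pos hs hs)]
    rw [h2, mul_left_comm (M⁻¹ ^ 3)]
    exact mul_le_mul_of_nonneg_left h3 (sub_nonneg.mpr h)

namespace Episodes

variable {l d : ℕ} {Ω 𝒳 𝒯 : Type*} [m₀ : MeasurableSpace Ω] [MeasurableSpace 𝒳]
  [MeasurableSpace 𝒯] [Zero 𝒯] (D : Episodes l Ω 𝒳 𝒯) (φ : FeatureMap l d 𝒳 𝒯) (μ : Measure Ω)

/-- The average over the first `n` episodes of the amount by which `f̂_{i,s}^{-1/2}` falls short of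
`M⁻¹`. -/
noncomputable def shortfall (M : ℝ) (fhat : ℕ → Fin (l + 1) → Ω → ℝ) (s : Fin (l + 1)) (n : ℕ)
    (ω : Ω) : ℝ :=
  (n : ℝ)⁻¹ * ∑ i ∈ Finset.range n, max 0 (M⁻¹ - fhat i s ω ^ (-(1 / 2) : ℝ))

/-- The deviation of an entry of `B̂_n` from its predictable counterpart, for an entry in a diagonal
block. The expression makes sense for all pairs of coordinates. -/
noncomputable def fluctuation (α : ℝ) (fhat : ℕ → Fin (l + 1) → Ω → ℝ) (p : Idx l d × Idx l d)
    (n : ℕ) (ω : Ω) : ℝ :=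
  (n : ℝ) ^ (α / 2 - 1) * ∑ i ∈ Finset.range n,
    (D.wfeat φ μ fhat i p.1 ω * D.feat φ i p.2 ω -
      (μ[fun ω' => D.wfeat φ μ fhat i p.1 ω' * D.feat φ i p.2 ω' | D.hist i (stage p.1)]) ω)

lemma Bhat_apply (α : ℝ) (fhat : ℕ → Fin (l + 1) → Ω → ℝ) (n : ℕ) (ω : Ω) (b b' : Idx l d) :
    D.Bhat φ μ α fhat n ω b b' = (n : ℝ) ^ (α / 2 - 1) * ∑ i ∈ Finset.range n,
      if stage b ≤ stage b' then D.wfeat φ μ fhat i b ω * D.feat φ i b' ω else 0 := by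
  simp only [Bhat, Matrix.neg_apply, Matrix.smul_apply, Matrix.sum_apply,
    D.weight_mul_jacobian, smul_eq_mul]
  rw [← mul_neg, ← Finset.sum_neg_distrib]
  congr 1
  refine Finset.sum_congr rfl fun i _ => ?_
  split_ifs <;> simp

lemma measurable_Bhat_apply (α : ℝ) {fhat : ℕ → Fin (l + 1) → Ω → ℝ}
    (hf : ∀ i s, StronglyMeasurable[D.hist i s] (fhat i s)) (n : ℕ) (b b' : Idx l d) :
    Measurable fun ω => D.Bhat φ μ α fhat n ω b b' := by
  simp only [D.Bhat_apply]
  refine (Finset.measurable_fun_sum _ fun i _ => ?_).const_mul _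
  split_ifs
  · exact (((D.stronglyMeasurable_wfeat φ μ hf i b).mono (D.featSigma_le i b)).mul
      ((D.stronglyMeasurable_feat φ i b').mono (D.featSigma_le i b'))).measurable
  · exact measurable_const

lemma aemeasurable_studentized (α : ℝ) (θ : Idx l d → ℝ) {fhat : ℕ → Fin (l + 1) → Ω → ℝ}
    (hf : ∀ i s, StronglyMeasurable[D.hist i s] (fhat i s)) {θhat : ℕ → Ω → Idx l d → ℝ} (n : ℕ)
    (hθ : AEMeasurable (θhat n) μ) :
    AEMeasurable (fun ω => WithLp.toLp 2
      ((n : ℝ) ^ ((1 - α) / 2) • (D.Bhat φ μ α fhat n ω *ᵥ (θhat n ω - θ)))) μ := by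
  refine (WithLp.measurable_toLp 2 _).comp_aemeasurable (aemeasurable_pi_lambda _ fun b => ?_)
  simp only [Pi.smul_apply, smul_eq_mul, mulVec, dotProduct, Pi.sub_apply]
  refine (Finset.aemeasurable_fun_sum _ fun b' _ => ?_).const_mul _
  exact (D.measurable_Bhat_apply φ μ α hf n b b').aemeasurable.mul
    ((aemeasurable_pi_iff.mp hθ b').sub_const _)

/-- The estimating equation, which is linear in the parameter, expresses the studentized error of
its solution as the normalized sum of the weighted scores. -/
lemma rpow_smul_Bhat_mulVec_eq_scoreSum (α : ℝ) (θ : Idx l d → ℝ)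
    (fhat : ℕ → Fin (l + 1) → Ω → ℝ) {n : ℕ} (hn : 0 < n) (ω : Ω) (ϑ : Idx l d → ℝ)
    (h : (n : ℝ)⁻¹ • ∑ i ∈ Finset.range n,
      D.weight φ μ fhat i ω *ᵥ D.momentVec φ μ i ϑ ω = 0) :
    WithLp.toLp 2 ((n : ℝ) ^ ((1 - α) / 2) • (D.Bhat φ μ α fhat n ω *ᵥ (ϑ - θ))) =
      D.scoreSum φ μ θ fhat n ω := by
  have hn' : (0 : ℝ) < n := by exact_mod_cast hn
  rw [smul_eq_zero_iff_right (inv_ne_zero hn'.ne')] at h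
  have hz : ∀ b, ∑ i ∈ Finset.range n,
      D.resid φ i (stage b) ϑ ω * D.wfeat φ μ fhat i b ω = 0 := by
    intro b
    have := congr_fun h b
    simpa only [Finset.sum_apply, D.weight_mulVec_momentVec, Pi.zero_apply] using this
  rw [scoreSum]
  congr 1
  funext b
  simp only [Pi.smul_apply, smul_eq_mul, mulVec, dotProduct, D.Bhat_apply, Pi.sub_apply, score]
  have hs : ∀ i, D.resid φ i (stage b) θ ω * D.wfeat φ μ fhat i b ω =
      D.resid φ i (stage b) ϑ ω * D.wfeat φ μ fhat i b ω +
      ∑ b', (if stage b ≤ stage b' then D.wfeat φ μ fhat i b ω * D.feat φ i b' ω else 0) *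
        (ϑ b' - θ b') := by
    intro i
    have h1 : D.resid φ i (stage b) θ ω = D.resid φ i (stage b) ϑ ω +
        ∑ b', if stage b ≤ stage b' then D.feat φ i b' ω * (ϑ b' - θ b') else 0 := by
      rw [resid, resid, sub_add, ← Finset.sum_sub_distrib]
      congr 1
      refine Finset.sum_congr rfl fun b' _ => ?_
      split_ifs <;> ring
    rw [h1, add_mul, Finset.sum_mul]
    congr 1
    refine Finset.sum_congr rfl fun b' _ => ?_
    split_ifs <;> ring
  simp only [hs]
  rw [Finset.sum_add_distrib, hz b, zero_add, Finset.sum_comm]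
  simp only [mul_assoc, ← Finset.mul_sum, ← Finset.sum_mul]
  rw [← mul_assoc, ← Real.rpow_add hn', ← rpow_neg_half_eq hn'.le]
  congr 2
  ring

variable {C α c σ M : ℝ}

/-- If exploration bounds the predictable diagonal blocks below, then the eigenvalue condition holds
whenever the shortfalls and the fluctuations are small. -/
lemma mem_goodEvent_of_lt (hc : 0 < c) (hM : 0 < M) (hα : 0 ≤ α)
    {fhat : ℕ → Fin (l + 1) → Ω → ℝ} {n : ℕ} (hn : 0 < n) {ω : Ω}
    (hpos : ∀ (i : ℕ) (s : Fin (l + 1)) (x : Idx l d → ℝ), (∀ b, stage b ≠ s → x b = 0) →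
      c * ((i : ℝ) + 1) ^ (-(α / 2)) * fhat i s ω ^ (-(1 / 2) : ℝ) * ∑ b, x b ^ 2 ≤
        ∑ b, ∑ b', x b * (μ[fun ω' => D.wfeat φ μ fhat i b ω' * D.feat φ i b' ω' |
          D.hist i (stage b)]) ω * x b')
    (hf0 : ∀ i s, 0 ≤ fhat i s ω)
    (hlt : c * ∑ s, |shortfall M fhat s n ω| + ∑ p, |D.fluctuation φ μ α fhat p n ω| <
      c / (2 * M)) :
    ω ∈ D.goodEvent φ μ α c M fhat n := by
  have hn' : (0 : ℝ) < n := by exact_mod_cast hn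
  intro z hz
  refine le_norm_of_mem_spectrum_of_blockTriangular stage _ _ (fun b b' hbb' => ?_)
    (fun s x hx => ?_) z hz
  · simp [D.Bhat_apply, not_le.mpr hbb']
  set a : ℕ → Idx l d → Idx l d → ℝ := fun i b b' =>
    (μ[fun ω' => D.wfeat φ μ fhat i b ω' * D.feat φ i b' ω' | D.hist i (stage b)]) ω with ha
  set N : ℝ := ∑ b, x b ^ 2 with hN
  have hN0 : 0 ≤ N := Finset.sum_nonneg fun b _ => sq_nonneg _
  have hentry : ∀ b b', x b * D.Bhat φ μ α fhat n ω b b' * x b' =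
      (n : ℝ) ^ (α / 2 - 1) * ∑ i ∈ Finset.range n, x b * a i b b' * x b' +
        x b * D.fluctuation φ μ α fhat (b, b') n ω * x b' := by
    intro b b'
    by_cases hb : stage b = s
    · by_cases hb' : stage b' = s
      · rw [D.Bhat_apply, fluctuation, Finset.sum_sub_distrib, ← Finset.sum_mul,
          ← Finset.mul_sum]
        simp only [hb, hb', le_refl, if_true, ha]
        ring
      · simp [hx b' hb']
    · simp [hx b hb]
  have hmain : ((n : ℝ) ^ (α / 2 - 1) * ∑ i ∈ Finset.range n, ∑ b, ∑ b', x b * a i b b' * x b') +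
      ∑ b, ∑ b', x b * D.fluctuation φ μ α fhat (b, b') n ω * x b' =
      ∑ b, ∑ b', x b * D.Bhat φ μ α fhat n ω b b' * x b' := by
    simp only [hentry, Finset.sum_add_distrib, ← Finset.mul_sum]
    congr 2
    rw [Finset.sum_comm]
    refine Finset.sum_congr rfl fun b _ => ?_
    rw [Finset.sum_comm]
  have hterm : ∀ i ∈ Finset.range n,
      (n : ℝ)⁻¹ * (c * (M⁻¹ - max 0 (M⁻¹ - fhat i s ω ^ (-(1 / 2) : ℝ))) * N) ≤
        (n : ℝ) ^ (α / 2 - 1) * ∑ b, ∑ b', x b * a i b b' * x b' := by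
    intro i hi
    have hin : (i : ℝ) + 1 ≤ n := by exact_mod_cast Finset.mem_range.mp hi
    have hi0 : (0 : ℝ) < (i : ℝ) + 1 := by positivity
    -- as `i + 1 ≤ n`, the exploration rate of episode `i` is at least the normalizing rate
    have h1 : (n : ℝ)⁻¹ ≤ (n : ℝ) ^ (α / 2 - 1) * ((i : ℝ) + 1) ^ (-(α / 2)) := by
      calc (n : ℝ)⁻¹ = (n : ℝ) ^ (α / 2 - 1) * (n : ℝ) ^ (-(α / 2)) := by
            rw [← Real.rpow_add hn', ← Real.rpow_neg_one]; congr 1; ring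
        _ ≤ _ := by
            refine mul_le_mul_of_nonneg_left ?_ (by positivity)
            exact Real.rpow_le_rpow_of_nonpos hi0 hin (by linarith)
    have h2 : M⁻¹ - max 0 (M⁻¹ - fhat i s ω ^ (-(1 / 2) : ℝ)) ≤ fhat i s ω ^ (-(1 / 2) : ℝ) := by
      linarith [le_max_right 0 (M⁻¹ - fhat i s ω ^ (-(1 / 2) : ℝ))]
    have h3 : 0 ≤ fhat i s ω ^ (-(1 / 2) : ℝ) := Real.rpow_nonneg (hf0 i s) _
    calc (n : ℝ)⁻¹ * (c * (M⁻¹ - max 0 (M⁻¹ - fhat i s ω ^ (-(1 / 2) : ℝ))) * N)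
        ≤ (n : ℝ)⁻¹ * (c * fhat i s ω ^ (-(1 / 2) : ℝ) * N) := by gcongr
      _ ≤ ((n : ℝ) ^ (α / 2 - 1) * ((i : ℝ) + 1) ^ (-(α / 2))) *
          (c * fhat i s ω ^ (-(1 / 2) : ℝ) * N) := by gcongr
      _ = (n : ℝ) ^ (α / 2 - 1) *
          (c * ((i : ℝ) + 1) ^ (-(α / 2)) * fhat i s ω ^ (-(1 / 2) : ℝ) * N) := by ring
      _ ≤ _ := mul_le_mul_of_nonneg_left (hpos i s x hx) (by positivity)
  have hpred := Finset.sum_le_sum hterm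
  rw [← Finset.mul_sum, ← Finset.mul_sum, ← Finset.sum_mul, ← Finset.mul_sum,
    Finset.sum_sub_distrib, Finset.sum_const, Finset.card_range, nsmul_eq_mul] at hpred
  have hpred' : c * (M⁻¹ - shortfall M fhat s n ω) * N ≤
      (n : ℝ) ^ (α / 2 - 1) * ∑ i ∈ Finset.range n, ∑ b, ∑ b', x b * a i b b' * x b' := by
    refine le_trans (le_of_eq ?_) hpred
    rw [shortfall]
    field_simp
  have hfluc : -(∑ p, |D.fluctuation φ μ α fhat p n ω|) * N ≤
      ∑ b, ∑ b', x b * D.fluctuation φ μ α fhat (b, b') n ω * x b' := by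
    rw [neg_mul, Finset.sum_mul, Fintype.sum_prod_type, ← Finset.sum_neg_distrib]
    refine Finset.sum_le_sum fun b _ => ?_
    rw [← Finset.sum_neg_distrib]
    refine Finset.sum_le_sum fun b' _ => ?_
    have h1 : ∀ b, |x b| ≤ √N := fun b => Real.abs_le_sqrt
      (Finset.single_le_sum (f := fun b => x b ^ 2) (fun b _ => sq_nonneg _) (Finset.mem_univ b))
    have h2 : |x b * D.fluctuation φ μ α fhat (b, b') n ω * x b'| ≤
        |D.fluctuation φ μ α fhat (b, b') n ω| * N := by
      rw [abs_mul, abs_mul, mul_comm |x b|, mul_assoc]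
      refine mul_le_mul_of_nonneg_left ?_ (abs_nonneg _)
      calc |x b| * |x b'| ≤ √N * √N := mul_le_mul (h1 b) (h1 b') (abs_nonneg _) (Real.sqrt_nonneg _)
        _ = N := Real.mul_self_sqrt hN0
    linarith [neg_abs_le (x b * D.fluctuation φ μ α fhat (b, b') n ω * x b')]
  rw [← hmain]
  refine le_trans ?_ (add_le_add hpred' hfluc)
  rw [← add_mul]
  refine mul_le_mul_of_nonneg_right ?_ hN0
  have h1 : shortfall M fhat s n ω ≤ ∑ s, |shortfall M fhat s n ω| :=
    (le_abs_self _).trans (Finset.single_le_sum (f := fun s => |shortfall M fhat s n ω|)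
      (fun s _ => abs_nonneg _) (Finset.mem_univ s))
  have h2 := mul_le_mul_of_nonneg_left h1 hc.le
  have h3 : c * M⁻¹ = c / (2 * M) + c / (2 * M) := by field_simp; norm_num
  linarith

variable [IsProbabilityMeasure μ]

/-- As `f̂` is consistent for `f ≤ M²`, the shortfall of `f̂^{-1/2}` below `M⁻¹` vanishes in
probability. Consistency is assumed for the conditional expectations given the past; it passes to
the shortfall itself through the expectations, by bounded convergence. -/
lemma tendstoInMeasure_shortfall (hσ : 0 < σ) (hM₀ : 0 < M) {θ : Idx l d → ℝ}
    (hM : ∀ i s, ∀ᵐ ω ∂μ, D.condSqResid φ μ θ i s ω ≤ M ^ 2)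
    {fhat : ℕ → Fin (l + 1) → Ω → ℝ}
    (hf : ∀ i s, StronglyMeasurable[D.hist i s] (fhat i s)) (hint : ∀ i s, Integrable (fhat i s) μ)
    (hlb : ∀ i s, ∀ᵐ ω ∂μ, σ ^ 2 ≤ fhat i s ω) (s : Fin (l + 1))
    (hcons : TendstoInMeasure μ
      (fun (n : ℕ) ω => (n : ℝ)⁻¹ * ∑ i ∈ Finset.range n,
        (μ[fun ω' => |D.condSqResid φ μ θ i s ω' - fhat i s ω'| | D.past i]) ω)
      atTop (fun _ => 0)) :
    TendstoInMeasure μ (shortfall M fhat s) atTop (fun _ => 0) := by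
  have hσ2 : 0 < σ ^ 2 := by positivity
  set w : ℕ → Ω → ℝ := fun i ω => max 0 (M⁻¹ - fhat i s ω ^ (-(1 / 2) : ℝ)) with hw
  have hwm : ∀ i, Measurable (w i) := fun i =>
    measurable_const.max (measurable_const.sub
      (((hf i s).mono (D.hist_le i s)).measurable.pow_const _))
  have hw0 : ∀ i ω, 0 ≤ w i ω := fun i ω => le_max_left _ _
  have hwle : ∀ i, ∀ᵐ ω ∂μ, w i ω ≤ M⁻¹ := fun i => by
    filter_upwards [hlb i s] with ω h
    have h1 : 0 ≤ fhat i s ω ^ (-(1 / 2) : ℝ) := Real.rpow_nonneg (hσ2.le.trans h) _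
    exact max_le (by positivity) (by linarith)
  have hwi : ∀ i, Integrable (w i) μ := fun i =>
    AEBdd.integrable ⟨M⁻¹, by
      filter_upwards [hwle i] with ω h
      rwa [abs_of_nonneg (hw0 i ω)]⟩ (hwm i).aestronglyMeasurable
  set v : ℕ → Ω → ℝ := fun i => μ[w i | D.past i] with hv
  have hv0 : ∀ i, ∀ᵐ ω ∂μ, 0 ≤ v i ω := fun i => condExp_nonneg (.of_forall (hw0 i))
  have hvle : ∀ i, ∀ᵐ ω ∂μ, v i ω ≤ M⁻¹ := fun i =>
    condExp_le_nonneg_const (by positivity) (hwle i)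
  have hvcons : ∀ i, ∀ᵐ ω ∂μ, v i ω ≤ M⁻¹ ^ 3 *
      (μ[fun ω' => |D.condSqResid φ μ θ i s ω' - fhat i s ω'| | D.past i]) ω := by
    intro i
    have hi : Integrable (fun ω => |D.condSqResid φ μ θ i s ω - fhat i s ω|) μ :=
      (integrable_condExp.sub (hint i s)).abs
    have h1 : v i ≤ᵐ[μ]
        μ[M⁻¹ ^ 3 • fun ω => |D.condSqResid φ μ θ i s ω - fhat i s ω| | D.past i] := by
      refine condExp_mono (hwi i) (hi.smul _) ?_
      filter_upwards [hlb i s, hM i s] with ω h2 h3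
      exact max_zero_inv_sub_rpow_neg_half_le hM₀ h3 (hσ2.trans_le h2)
    filter_upwards [h1, condExp_smul (μ := μ) (M⁻¹ ^ 3)
      (fun ω => |D.condSqResid φ μ θ i s ω - fhat i s ω|) (D.past i)] with ω h2 h3
    exact h2.trans_eq h3
  have hvm : ∀ i, Integrable (v i) μ := fun i => integrable_condExp
  have hV : TendstoInMeasure μ (fun (n : ℕ) ω => (n : ℝ)⁻¹ * ∑ i ∈ Finset.range n, v i ω) atTop
      (fun _ => 0) := by
    refine tendstoInMeasure_zero_of_abs_le (ι := Unit) (M⁻¹ ^ 3) (fun _ => hcons)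
      (.of_forall fun n => ?_)
    filter_upwards [ae_all_iff.mpr hvcons, ae_all_iff.mpr hv0] with ω h1 h2
    rw [abs_of_nonneg (mul_nonneg (by positivity) (Finset.sum_nonneg fun i _ => h2 i))]
    simp only [Finset.univ_unique, Finset.sum_singleton]
    refine le_trans ?_ (mul_le_mul_of_nonneg_left (le_abs_self _) (by positivity))
    rw [mul_left_comm]
    refine mul_le_mul_of_nonneg_left ?_ (inv_nonneg.mpr (Nat.cast_nonneg n))
    rw [Finset.mul_sum]
    exact Finset.sum_le_sum fun i _ => h1 i
  have hVint : ∀ n : ℕ, Integrable (fun ω => (n : ℝ)⁻¹ * ∑ i ∈ Finset.range n, v i ω) μ :=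
    fun n => (integrable_finsetSum _ fun i _ => hvm i).const_mul _
  have hVlim := tendsto_integral_abs_of_tendstoInMeasure
    (fun n => (hVint n).aestronglyMeasurable) (K := M⁻¹) (fun n => ?_) hV
  · refine tendstoInMeasure_of_tendsto_integral_abs
      (fun n => (integrable_finsetSum _ fun i _ => hwi i).const_mul _) ?_
    convert hVlim using 2 with n
    have e1 : ∫ ω, |shortfall M fhat s n ω| ∂μ =
        ∫ ω, (n : ℝ)⁻¹ * ∑ i ∈ Finset.range n, w i ω ∂μ := by
      refine integral_congr_ae (.of_forall fun ω => ?_)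
      exact abs_of_nonneg (mul_nonneg (by positivity) (Finset.sum_nonneg fun i _ => hw0 i ω))
    have e2 : ∫ ω, |(n : ℝ)⁻¹ * ∑ i ∈ Finset.range n, v i ω| ∂μ =
        ∫ ω, (n : ℝ)⁻¹ * ∑ i ∈ Finset.range n, v i ω ∂μ := by
      refine integral_congr_ae ?_
      filter_upwards [ae_all_iff.mpr hv0] with ω h2
      exact abs_of_nonneg (mul_nonneg (by positivity) (Finset.sum_nonneg fun i _ => h2 i))
    refine e1.trans (Eq.trans ?_ e2.symm)
    rw [integral_const_mul, integral_const_mul, integral_finsetSum _ fun i _ => hwi i,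
      integral_finsetSum _ fun i _ => hvm i]
    congr 1
    exact Finset.sum_congr rfl fun i _ => (integral_condExp (D.past_le i)).symm
  · filter_upwards [ae_all_iff.mpr hvle, ae_all_iff.mpr hv0] with ω h1 h2
    rw [abs_of_nonneg (mul_nonneg (by positivity) (Finset.sum_nonneg fun i _ => h2 i))]
    calc (n : ℝ)⁻¹ * ∑ i ∈ Finset.range n, v i ω ≤ (n : ℝ)⁻¹ * ∑ i ∈ Finset.range n, M⁻¹ := by
          gcongr with i; exact h1 i
      _ = ((n : ℝ)⁻¹ * n) * M⁻¹ := by simp [mul_assoc]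
      _ ≤ M⁻¹ := mul_le_of_le_one_left (by positivity) inv_mul_le_one

/-- The entries of `B̂_n` concentrate around their predictable counterparts: the second moments of
the summands are bounded, since the weights normalize the features, and the summands are
orthogonal. -/
lemma tendstoInMeasure_fluctuation (hα : 0 ≤ α) (hα1 : α < 1) (hc : 0 < c) (hσ : 0 < σ)
    (hφ : ∀ j x τ k, |φ.toFun j x τ k| ≤ C)
    (hexpl : D.Exploration φ μ α c) {fhat : ℕ → Fin (l + 1) → Ω → ℝ}
    (hf : ∀ i s, StronglyMeasurable[D.hist i s] (fhat i s))
    (hlb : ∀ i s, ∀ᵐ ω ∂μ, σ ^ 2 ≤ fhat i s ω) (p : Idx l d × Idx l d) :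
    TendstoInMeasure μ (D.fluctuation φ μ α fhat p) atTop (fun _ => 0) := by
  obtain ⟨b, b'⟩ := p
  have hσ2 : 0 < σ ^ 2 := by positivity
  obtain ⟨K, hK⟩ := D.exists_abs_wfeat_le φ μ hα hc hσ hφ hexpl hlb
  have hub : ∀ i, AEBdd μ (D.wfeat φ μ fhat i b) := fun i => ⟨_, hK i b⟩
  have hfb : ∀ i, AEBdd μ (D.feat φ i b') := fun i => .of_forall (D.abs_feat_le φ hφ i b')
  set g : ℕ → Ω → ℝ := fun i ω => D.wfeat φ μ fhat i b ω * D.feat φ i b' ω with hg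
  have hgp : ∀ i, StronglyMeasurable[D.past (i + 1)] (g i) := fun i =>
    ((D.stronglyMeasurable_wfeat φ μ hf i b).mono (D.featSigma_le_past_succ i b)).mul
      ((D.stronglyMeasurable_feat φ i b').mono (D.featSigma_le_past_succ i b'))
  have hgm : ∀ i, AEStronglyMeasurable (g i) μ := fun i =>
    ((hgp i).mono (D.past_le _)).aestronglyMeasurable
  have hgb : ∀ i, AEBdd μ (g i) := fun i => (hub i).mul (hfb i)
  have hgi : ∀ i, Integrable (g i) μ := fun i => (hgb i).integrable (hgm i)
  set e : ℕ → Ω → ℝ := fun i ω => g i ω - (μ[g i | D.hist i (stage b)]) ω with he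
  have heb : ∀ i, AEBdd μ (e i) := fun i => (hgb i).sub (hgb i).condExp
  have hep : ∀ i j, i < j → StronglyMeasurable[D.hist j (stage b)] (e i) := fun i j hij =>
    ((hgp i).sub (stronglyMeasurable_condExp.mono (D.hist_le_past_succ i _))).mono
      ((D.past_mono hij).trans (D.past_le_hist j _))
  have he0 : ∀ i, μ[e i | D.hist i (stage b)] =ᵐ[μ] 0 := by
    intro i
    have h1 := condExp_sub (hgi i) (integrable_condExp (f := g i) (m := D.hist i (stage b)))
      (D.hist i (stage b))
    rw [condExp_of_stronglyMeasurable (D.hist_le i _) stronglyMeasurable_condExp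
      integrable_condExp, sub_self] at h1
    exact h1
  have he2 : ∀ i, ∫ ω, e i ω ^ 2 ∂μ ≤ (max C 1) ^ 2 * (σ ^ 2)⁻¹ := by
    intro i
    have hL2 : MemLp (g i) 2 μ := by
      obtain ⟨B, hB⟩ := hgb i
      exact MemLp.of_bound (hgm i) B hB
    have hu2 : Integrable (fun ω => D.wfeat φ μ fhat i b ω * D.wfeat φ μ fhat i b ω) μ :=
      ((hub i).mul (hub i)).integrable ((((D.stronglyMeasurable_wfeat φ μ hf i b).mono
        (D.featSigma_le i b)).mul ((D.stronglyMeasurable_wfeat φ μ hf i b).mono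
        (D.featSigma_le i b))).aestronglyMeasurable)
    calc ∫ ω, e i ω ^ 2 ∂μ = ∫ ω, (Var[g i; μ | D.hist i (stage b)]) ω ∂μ :=
          (integral_condExp (D.hist_le i _)).symm
      _ ≤ ∫ ω, (μ[g i ^ 2 | D.hist i (stage b)]) ω ∂μ :=
          integral_mono_ae integrable_condVar integrable_condExp
            (condVar_ae_le_condExp_sq (D.hist_le i _) hL2)
      _ = ∫ ω, g i ω ^ 2 ∂μ := integral_condExp (D.hist_le i _)
      _ ≤ ∫ ω, (max C 1) ^ 2 * (D.wfeat φ μ fhat i b ω * D.wfeat φ μ fhat i b ω) ∂μ := by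
          refine integral_mono hL2.integrable_sq (hu2.const_mul _) fun ω => ?_
          have h1 := sq_le_sq' (abs_le.mp (D.abs_feat_le φ hφ i b' ω)).1
            (abs_le.mp (D.abs_feat_le φ hφ i b' ω)).2
          have h2 := mul_le_mul_of_nonneg_right h1 (mul_self_nonneg (D.wfeat φ μ fhat i b ω))
          refine le_trans (le_of_eq ?_) h2
          simp only [hg]; ring
      _ = (max C 1) ^ 2 * ∫ ω, (fhat i (stage b) ω)⁻¹ ∂μ := by
          rw [integral_const_mul, ← integral_condExp (D.hist_le i (stage b))]
          congr 1
          refine integral_congr_ae ?_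
          simpa using D.condExp_wfeat_mul_wfeat φ μ hα hc hσ hφ hexpl hf hlb i (b := b) rfl
      _ ≤ (max C 1) ^ 2 * (σ ^ 2)⁻¹ := by
          refine mul_le_mul_of_nonneg_left ?_ (sq_nonneg _)
          have h3 : ∀ᵐ ω ∂μ, ‖(fhat i (stage b) ω)⁻¹‖ ≤ (σ ^ 2)⁻¹ := by
            filter_upwards [hlb i (stage b)] with ω h4
            rw [Real.norm_eq_abs, abs_of_nonneg (inv_nonneg.mpr (hσ2.le.trans h4))]
            exact inv_anti₀ hσ2 h4
          refine (le_abs_self _).trans ?_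
          simpa using norm_integral_le_of_norm_le_const h3
  have hsum := integral_sq_sum_le_of_condExp_eq_zero (μ := μ) (fun i => D.hist i (stage b))
    (fun i => D.hist_le i _) e hep heb he0 he2
  have hem : ∀ i, AEStronglyMeasurable (e i) μ := fun i =>
    ((hep i (i + 1) i.lt_succ_self).mono (D.hist_le _ _)).aestronglyMeasurable
  have hflm : ∀ n, AEBdd μ (D.fluctuation φ μ α fhat (b, b') n) ∧
      AEStronglyMeasurable (D.fluctuation φ μ α fhat (b, b') n) μ := fun n =>
    ⟨(AEBdd.const _).mul (AEBdd.sum _ fun i _ => heb i),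
      (Finset.aestronglyMeasurable_fun_sum _ fun i _ => hem i).const_mul _⟩
  refine tendstoInMeasure_zero_of_sq (tendstoInMeasure_of_tendsto_integral_abs
    (fun n => (hflm n).1.sq.integrable ((hflm n).2.pow 2)) ?_)
  have hrate : Tendsto (fun n : ℕ => (max C 1) ^ 2 * (σ ^ 2)⁻¹ * (n : ℝ) ^ (-(1 - α))) atTop
      (𝓝 0) := by
    have := (tendsto_rpow_neg_atTop (y := 1 - α) (by linarith)).comp
      (tendsto_natCast_atTop_atTop (R := ℝ))
    simpa [Function.comp_def] using this.const_mul ((max C 1) ^ 2 * (σ ^ 2)⁻¹)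
  refine squeeze_zero' (.of_forall fun n => integral_nonneg fun ω => abs_nonneg _) ?_ hrate
  filter_upwards [eventually_gt_atTop 0] with n hn
  have hn' : (0 : ℝ) < n := by exact_mod_cast hn
  have h1 : ∀ ω, |D.fluctuation φ μ α fhat (b, b') n ω ^ 2| =
      (n : ℝ) ^ (α - 2) * (∑ i ∈ Finset.range n, e i ω) ^ 2 := by
    intro ω
    rw [abs_of_nonneg (sq_nonneg _), fluctuation, mul_pow, ← Real.rpow_natCast,
      ← Real.rpow_mul hn'.le]
    congr 2
    push_cast
    ring
  simp only [h1]
  rw [integral_const_mul]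
  calc (n : ℝ) ^ (α - 2) * ∫ ω, (∑ i ∈ Finset.range n, e i ω) ^ 2 ∂μ
      ≤ (n : ℝ) ^ (α - 2) * (n * ((max C 1) ^ 2 * (σ ^ 2)⁻¹)) :=
        mul_le_mul_of_nonneg_left (hsum n) (by positivity)
    _ = (max C 1) ^ 2 * (σ ^ 2)⁻¹ * ((n : ℝ) ^ (α - 2) * (n : ℝ) ^ (1 : ℝ)) := by
        rw [Real.rpow_one]; ring
    _ = _ := by rw [← Real.rpow_add hn']; congr 2; ring

/-! ### The studentized estimation error -/

/-- The estimating equation is solved with probability tending to one. -/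
lemma tendsto_measure_compl_goodEvent (hα : 0 ≤ α) (hα1 : α < 1) (hc : 0 < c) (hc1 : c < 1)
    (hσ : 0 < σ) (hM₀ : 0 < M) {θ : Idx l d → ℝ} (hφ : ∀ j x τ k, |φ.toFun j x τ k| ≤ C)
    (hexpl : D.Exploration φ μ α c)
    (hM : ∀ i s, ∀ᵐ ω ∂μ, D.condSqResid φ μ θ i s ω ≤ M ^ 2)
    {fhat : ℕ → Fin (l + 1) → Ω → ℝ}
    (hf : ∀ i s, StronglyMeasurable[D.hist i s] (fhat i s)) (hint : ∀ i s, Integrable (fhat i s) μ)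
    (hlb : ∀ i s, ∀ᵐ ω ∂μ, σ ^ 2 ≤ fhat i s ω)
    (hcons : ∀ s : Fin (l + 1), TendstoInMeasure μ
      (fun (n : ℕ) ω => (n : ℝ)⁻¹ * ∑ i ∈ Finset.range n,
        (μ[fun ω' => |D.condSqResid φ μ θ i s ω' - fhat i s ω'| | D.past i]) ω)
      atTop (fun _ => 0)) :
    Tendsto (fun n => μ (D.goodEvent φ μ α c M fhat n)ᶜ) atTop (𝓝 0) := by
  set R : ℕ → Ω → ℝ := fun n ω => c * ∑ s, |shortfall M fhat s n ω| +
    ∑ p, |D.fluctuation φ μ α fhat p n ω| with hR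
  have hR0 : TendstoInMeasure μ R atTop (fun _ => 0) := by
    refine tendstoInMeasure_zero_of_abs_le (ι := Fin (l + 1) ⊕ (Idx l d × Idx l d))
      (h := Sum.elim (fun s => shortfall M fhat s) (fun p => D.fluctuation φ μ α fhat p)) 1 ?_
      (.of_forall fun n => .of_forall fun ω => ?_)
    · rintro (s | p)
      · exact D.tendstoInMeasure_shortfall φ μ hσ hM₀ hM hf hint hlb s (hcons s)
      · exact D.tendstoInMeasure_fluctuation φ μ hα hα1 hc hσ hφ hexpl hf hlb p
    · rw [Fintype.sum_sum_type, one_mul, abs_of_nonneg (by positivity)]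
      simp only [Sum.elim_inl, Sum.elim_inr, hR]
      gcongr
      exact mul_le_of_le_one_left (by positivity) hc1.le
  rw [tendstoInMeasure_iff_norm] at hR0
  refine tendsto_of_tendsto_of_tendsto_of_le_of_le' tendsto_const_nhds
    (hR0 (c / (2 * M)) (by positivity)) (.of_forall fun _ => zero_le) ?_
  filter_upwards [eventually_gt_atTop 0] with n hn
  refine measure_mono_ae ?_
  filter_upwards [ae_all_iff.mpr fun i => ae_all_iff.mpr fun s =>
      D.le_sum_condExp_wfeat_mul_feat φ μ hα hc hc1 hσ hφ hexpl hf hlb i s,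
    ae_all_iff.mpr fun i => ae_all_iff.mpr (hlb i)] with ω h1 h2 h3
  by_contra h4
  refine h3 (D.mem_goodEvent_of_lt φ μ hc hM₀ hα hn h1
    (fun i s => (sq_nonneg σ).trans (h2 i s)) ?_)
  have h5 : ‖R n ω - 0‖ < c / (2 * M) := not_le.mp h4
  rw [sub_zero] at h5
  exact (le_abs_self _).trans_lt h5

end Episodes

theorem mainTheorem5 {l d : ℕ} {Ω 𝒳 𝒯 : Type*} [MeasurableSpace Ω] [MeasurableSpace 𝒳]
    [MeasurableSpace 𝒯] [Zero 𝒯] (μ : Measure Ω) [IsProbabilityMeasure μ]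
    (D : Episodes l Ω 𝒳 𝒯) (φ : FeatureMap l d 𝒳 𝒯) (θ : Idx l d → ℝ)
    (hexo : D.Exogeneity μ) (hbase : D.IsBaselineMean μ (θ none)) (hblip : D.LinearBlip φ μ θ)
    (hres : D.ResidualIndependence φ μ θ) (hbdd : D.BoundedData φ)
    (α c : ℝ) (hα₀ : 0 ≤ α) (hα₁ : α < 1) (hc₀ : 0 < c) (hc₁ : c < 1)
    (hexpl : D.Exploration φ μ α c)
    (M : ℝ) (hM₀ : 0 < M) (hM : ∀ i s, ∀ᵐ ω ∂μ, D.condSqResid φ μ θ i s ω ≤ M ^ 2)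
    (σ : ℝ) (hσ : 0 < σ) (fhat : ℕ → Fin (l + 1) → Ω → ℝ)
    (hfhat_meas : ∀ i s, StronglyMeasurable[D.hist i s] (fhat i s))
    (hfhat_int : ∀ i s, Integrable (fhat i s) μ)
    (hfhat_lb : ∀ i s, ∀ᵐ ω ∂μ, σ ^ 2 ≤ fhat i s ω)
    (hfhat_cons : ∀ s : Fin (l + 1), TendstoInMeasure μ
      (fun (n : ℕ) ω => (n : ℝ)⁻¹ * ∑ i ∈ Finset.range n,
        (μ[fun ω' => |D.condSqResid φ μ θ i s ω' - fhat i s ω'| | D.past i]) ω)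
      atTop (fun _ => 0))
    (θhat : ℕ → Ω → Idx l d → ℝ) (hθhat : D.IsZEstimator φ μ α c M fhat θhat) :
    TendstoInDistribution
      (fun (n : ℕ) ω => WithLp.toLp 2
        ((n : ℝ) ^ ((1 - α) / 2) • (D.Bhat φ μ α fhat n ω *ᵥ (θhat n ω - θ))))
      atTop (id : EuclideanSpace ℝ (Idx l d) → EuclideanSpace ℝ (Idx l d))
      (fun _ => μ) (stdGaussian (EuclideanSpace ℝ (Idx l d))) := by
  obtain ⟨C, hY, hφ⟩ := hbdd
  refine tendstoInDistribution_of_tendstoInMeasure_sub (X := D.scoreSum φ μ θ fhat) _ _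
    (D.tendstoInDistribution_scoreSum φ μ hα₀ hα₁ hc₀ hσ hbase hblip hres hY hφ hexpl hM
      hfhat_meas hfhat_int hfhat_lb hfhat_cons) ?_
    fun n => D.aemeasurable_studentized φ μ α θ hfhat_meas n (hθhat.1 n)
  rw [tendstoInMeasure_iff_norm]
  intro ε hε
  refine tendsto_of_tendsto_of_tendsto_of_le_of_le' tendsto_const_nhds
    (D.tendsto_measure_compl_goodEvent φ μ hα₀ hα₁ hc₀ hc₁ hσ hM₀ hφ hexpl hM hfhat_meas
      hfhat_int hfhat_lb hfhat_cons) (.of_forall fun _ => zero_le) ?_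
  filter_upwards [eventually_gt_atTop 0] with n hn
  refine measure_mono_ae ?_
  filter_upwards [hθhat.2 n] with ω h1 h2 h3
  have h4 : ε ≤ ‖WithLp.toLp 2 ((n : ℝ) ^ ((1 - α) / 2) •
      (D.Bhat φ μ α fhat n ω *ᵥ (θhat n ω - θ))) - D.scoreSum φ μ θ fhat n ω - 0‖ := h2
  rw [D.rpow_smul_Bhat_mulVec_eq_scoreSum φ μ α θ fhat hn ω (θhat n ω) (h1 h3)] at h4
  simp only [sub_self, norm_zero] at h4
  exact absurd h4 (not_le.mpr hε)
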